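/- Let $f\colon U\to V$ belong to the class $\mathcal F$: $U,V\subset\mathbb C$ are bounded open sets, $0\in\overline U$, $f$ is holomorphic on $U$ with $f(U)\subset V$, the map $f\colon U\setminus\{0\}\to V\setminus\{0\}$ is an unbranched covering, and $V\supset B(0;\operatorname{diam}U)\supset U$, where $B(a;r)$ denotes an open disc. Let $g\colon U\cup\{0\}\to\mathbb C$ be given by $g(0)=c_1$ and $g=f+c_1$ on $U$, and assume that there is a finite set $P\ni 0$ with $g(P)\subset P$ and $P\setminus\{0\}\subset U$ (a marked map with $P_0=\{0\}$; then $g'\neq0$ on $P\setminus\{0\}$). Consider the local holomorphic deformation $(g,G,\mathbf p)_W$ with $W=\mathbb C$, $G_w(z)=g(z)+(w-c_1)$ and $\mathbf p\equiv 0$. A holomorphic motion of $g(P)$ over $(\Lambda,0)$ ($\Lambda\ni0$ a domain in $\mathbb C$) is a family of injective maps $h_\lambda\colon g(P)\to\mathbb C$, $\lambda\in\Lambda$, holomorphic in $\lambda$, with $h_0=\mathrm{id}$. A holomorphic motion $\hat h_\lambda$ of $g(P)$ over a domain $\Lambda_0$ with $0\in\Lambda_0\subset\Lambda$ is a lift of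 $h_\lambda$ over $\Lambda_0$ if, for all $\lambda\in\Lambda_0$, $\hat h_\lambda(0)=0$ in case $0\in g(P)$, and $\hat h_\lambda(x)\in U$, $G_{h_\lambda(c_1)}(\hat h_\lambda(x))=h_\lambda(g(x))$ for all $x\in g(P)\setminus\{0\}$. The deformation has the lifting property if for every holomorphic motion $h^{(0)}_\lambda$ of $g(P)$ over the unit disc there are $\varepsilon>0$, $M>0$ and holomorphic motions $h^{(k)}_\lambda$, $k\ge1$, of $g(P)$ over $\{|\lambda|<\varepsilon\}$ such that $h^{(k+1)}_\lambda$ is a lift of $h^{(k)}_\lambda$ over this disc and $|h^{(k)}_\lambda(x)|\le M$ for all $k\ge0$, $x\in g(P)$, $|\lambda|<\varepsilon$. The transfer operator is the linear map $\mathcal A\colon\mathbb C^{g(P)}\to\mathbb C^{g(P)}$ such that $\mathcal A\big((\tfrac{d}{d\lambda}h_\lambda(x)|_{\lambda=0})_{x\in g(P)}\big)=(\tfrac{d}{d\lambda}\hat h_\lambda(x)|_{\lambda=0})_{x\in g(P)}$ whenever $\hat h_\lambda$ is a lift of $h_\lambda$. Then: 1. $(g,G,\mathbf p)_W$ has the lifting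 property. 2. The transfer operator $\mathcal A$ exists and is unique, and $\operatorname{spec}(\mathcal A)\subset\overline{\mathbb D}\setminus\{1\}$. 3. Suppose in addition that the robust separation property $V\supset\overline{B(0;\operatorname{diam}U)}$ holds. Then the spectral radius of $\mathcal A$ is strictly smaller than $1$, and $\det(I-\rho\mathcal A)\neq0$ for all $|\rho|\le1$. Write $c_i=g^i(0)$ and let $Dg^i$ denote the derivative of the $i$-th iterate of $g$. - (Periodic case.) If $P=\{c_0,\dots,c_{q-1}\}$ with $c_0,\dots,c_{q-1}$ distinct, $q\ge1$ and $c_q=c_0=0$, then $$\det(I-\rho\mathcal A)=\sum_{i=0}^{q-1}\frac{\rho^i}{Dg^i(c_1)}\neq0\qquad\text{for all }|\rho|\le1 ,$$ and if moreover $g$ and $G$ are real (that is, $P\subset\mathbb R$, $U$ is symmetric under complex conjugation, and $g$, $G$ commute with it), then $\sum_{i=0}^{q-1}\frac1{Dg^i(c_1)}>0$. - (Preperiodic case.) If $P=\{c_0,\dots,c_{q-1}\}$ with $c_0,\dots,c_{q-1}$ distinct and $c_q=c_l$ for some $1\le l<q$, then for all $|\rho|\le1$ $$\det(I-\rho\mathcal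 A)=\sum_{i=0}^{q-1}\frac{\rho^i}{Dg^i(c_1)}-\frac{\rho^{q-l}}{Dg^{q-l}(c_l)}\sum_{i=0}^{l-1}\frac{\rho^i}{Dg^i(c_1)}\neq0,$$ and in the real case the value of this expression at $\rho=1$ is a positive real number. -/

import Mathlib

noncomputable section

/-- The class of maps `f : U → V` used for additive families `f + c`: `U`, `V` are bounded open
sets, `0 ∈ closure U`, `f` is holomorphic, `f : U ∖ {0} → V ∖ {0}` is an (unbranched) covering,
and `V ⊇ B(0, diam U) ⊇ U`. Only the values of `f` on `U` matter. -/
structure IsClassF (f : ℂ → ℂ) (U V : Set ℂ) : Prop where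
  isOpen_source : IsOpen U
  isBounded_source : Bornology.IsBounded U
  zero_mem_closure : (0 : ℂ) ∈ closure U
  isOpen_target : IsOpen V
  isBounded_target : Bornology.IsBounded V
  mapsTo : Set.MapsTo f U V
  holomorphic : DifferentiableOn ℂ f U
  covering : ∃ h : Set.MapsTo f (U \ {0}) (V \ {0}), IsCoveringMap (h.restrict f (U \ {0}) (V \ {0}))
  ball_subset_target : Metric.ball (0 : ℂ) (Metric.diam U) ⊆ V
  source_subset_ball : U ⊆ Metric.ball (0 : ℂ) (Metric.diam U)

/-- A marked map with `ν` marked points `c₀ j` (so `P₀ = range c₀`), defined on `P₀ ∪ U`, together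
with its finite forward invariant set `P ⊇ P₀`. The function `toFun` is total, but only its values
on `P₀ ∪ U` matter. -/
structure MarkedMap (ν : ℕ) where
  toFun : ℂ → ℂ
  U : Set ℂ
  c₀ : Fin ν → ℂ
  P : Finset ℂ
  isOpen_U : IsOpen U
  injective_c₀ : Function.Injective c₀
  c₀_mem : ∀ j, c₀ j ∈ P
  mapsTo_P : ∀ x ∈ P, toFun x ∈ P
  mem_U : ∀ x ∈ P, x ∉ Set.range c₀ → x ∈ U
  holomorphic : DifferentiableOn ℂ toFun U
  deriv_ne_zero : ∀ x ∈ P, x ∉ Set.range c₀ → deriv toFun x ≠ 0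

namespace MarkedMap

variable {ν : ℕ} (g : MarkedMap ν)

/-- The marked values `c₁ j = g (c₀ j)`. -/
def c₁ (j : Fin ν) : ℂ := g.toFun (g.c₀ j)

/-- The finite set `g(P)`. -/
def gP : Finset ℂ := g.P.image g.toFun

/-- A marked map is real if `P ⊆ ℝ`, `U` is symmetric and `g` commutes with conjugation. -/
def IsReal : Prop :=
  (∀ x ∈ g.P, x.im = 0) ∧
    ∀ z ∈ g.U, (starRingEnd ℂ) z ∈ g.U ∧ g.toFun ((starRingEnd ℂ) z) = (starRingEnd ℂ) (g.toFun z)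

end MarkedMap

/-- A local holomorphic deformation `(g, G, p)_W` of a marked map `g`. -/
structure LocalDeformation {ν : ℕ} (g : MarkedMap ν) where
  W : Set (Fin ν → ℂ)
  G : (Fin ν → ℂ) → ℂ → ℂ
  p : (Fin ν → ℂ) → (Fin ν → ℂ)
  isOpen_W : IsOpen W
  isConnected_W : IsConnected W
  c₁_mem : g.c₁ ∈ W
  holomorphic_p : DifferentiableOn ℂ p W
  p_c₁ : p g.c₁ = g.c₀
  holomorphic_G : DifferentiableOn ℂ (fun q : (Fin ν → ℂ) × ℂ => G q.1 q.2) (W ×ˢ g.U)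
  G_c₁ : ∀ z ∈ g.U, G g.c₁ z = g.toFun z

/-- The additive deformation `G_w(z) = g(z) + (w - g(c₀))`, `p(w) ≡ c₀`, `W = ℂ`, of a marked map
with a single marked point `c₀`. -/
def MarkedMap.additive (g : MarkedMap 1) : LocalDeformation g where
  W := Set.univ
  G := fun w z => g.toFun z + (w 0 - g.toFun (g.c₀ 0))
  p := fun _ => g.c₀
  isOpen_W := isOpen_univ
  isConnected_W := isConnected_univ
  c₁_mem := Set.mem_univ _
  holomorphic_p := differentiableOn_const _
  p_c₁ := rfl
  holomorphic_G := by
    have h1 : DifferentiableOn ℂ (fun q : (Fin 1 → ℂ) × ℂ => g.toFun q.2) (Set.univ ×ˢ g.U) :=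
      g.holomorphic.comp differentiableOn_snd (fun q hq => hq.2)
    have h2 : Differentiable ℂ (fun q : (Fin 1 → ℂ) × ℂ => q.1 0 - g.toFun (g.c₀ 0)) := by
      fun_prop
    exact h1.add h2.differentiableOn
  G_c₁ := by
    intro z _
    simp [MarkedMap.c₁]

/-- A domain of parameters: a connected open subset of `ℂ` containing `0`. -/
def IsPointedDomain (Λ : Set ℂ) : Prop := IsOpen Λ ∧ IsConnected Λ ∧ (0 : ℂ) ∈ Λ

/-- `h` (written `h lam x`) is a holomorphic motion of `X` over `(Λ, 0)`. -/
structure IsHolomorphicMotion (X Λ : Set ℂ) (h : ℂ → ℂ → ℂ) : Prop where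
  at_zero : ∀ x ∈ X, h 0 x = x
  injOn : ∀ lam ∈ Λ, Set.InjOn (h lam) X
  holomorphic : ∀ x ∈ X, DifferentiableOn ℂ (fun lam => h lam x) Λ

namespace LocalDeformation

variable {ν : ℕ} {g : MarkedMap ν} (D : LocalDeformation g)

/-- `h'` is a lift of the motion `h` of `g(P)` over `Λ₀`: with
`c₁(lam) = (h lam (c₁ 1), …, h lam (c₁ ν))`, one has `h' lam (c₀ j) = p_j (c₁(lam))` whenever
`c₀ j ∈ g(P)`, and `G_{c₁(lam)} (h' lam x) = h lam (g x)` for `x ∈ g(P) ∖ P₀`.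
The conditions `c₁(lam) ∈ W` and `h' lam x ∈ U` say that these expressions are defined. -/
def IsLift (h h' : ℂ → ℂ → ℂ) (Λ₀ : Set ℂ) : Prop :=
  ∀ lam ∈ Λ₀,
    (fun j => h lam (g.c₁ j)) ∈ D.W ∧
    (∀ j, g.c₀ j ∈ g.gP → h' lam (g.c₀ j) = D.p (fun j => h lam (g.c₁ j)) j) ∧
    ∀ x ∈ g.gP, x ∉ Set.range g.c₀ →
      h' lam x ∈ g.U ∧ D.G (fun j => h lam (g.c₁ j)) (h' lam x) = h lam (g.toFun x)

/-- The lifting property: every holomorphic motion of `g(P)` over the unit disc has, on some smaller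
disc, an infinite sequence of successive lifts that are uniformly bounded holomorphic motions. -/
def LiftingProperty : Prop :=
  ∀ h : ℂ → ℂ → ℂ, IsHolomorphicMotion (g.gP : Set ℂ) (Metric.ball 0 1) h →
    ∃ ε : ℝ, 0 < ε ∧ ε ≤ 1 ∧ ∃ H : ℕ → ℂ → ℂ → ℂ, H 0 = h ∧
      (∀ k, IsHolomorphicMotion (g.gP : Set ℂ) (Metric.ball 0 ε) (H k)) ∧
      (∀ k, D.IsLift (H k) (H (k + 1)) (Metric.ball 0 ε)) ∧
      ∃ M : ℝ, 0 < M ∧ ∀ k, ∀ x ∈ g.gP, ∀ lam ∈ Metric.ball (0 : ℂ) ε, ‖H k lam x‖ ≤ M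

/-- `A` is the transfer operator of the deformation: whenever `h'` is a lift of `h`, it sends
`(d/dlam h lam x at 0)_{x ∈ g(P)}` to `(d/dlam h' lam x at 0)_{x ∈ g(P)}`. -/
def IsTransferOperator (A : Module.End ℂ (g.gP → ℂ)) : Prop :=
  ∀ (Λ Λ₀ : Set ℂ) (h h' : ℂ → ℂ → ℂ), IsPointedDomain Λ → IsPointedDomain Λ₀ → Λ₀ ⊆ Λ →
    IsHolomorphicMotion (g.gP : Set ℂ) Λ h → IsHolomorphicMotion (g.gP : Set ℂ) Λ₀ h' →
    D.IsLift h h' Λ₀ →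
    A (fun x : g.gP => deriv (fun lam => h lam (x : ℂ)) 0) =
      fun x : g.gP => deriv (fun lam => h' lam (x : ℂ)) 0

/-- A deformation is real if `W`, `G`, `p` commute with complex conjugation. -/
def IsReal : Prop :=
  ∀ w ∈ D.W, (fun j => (starRingEnd ℂ) (w j)) ∈ D.W ∧
    (∀ z ∈ g.U,
      D.G (fun j => (starRingEnd ℂ) (w j)) ((starRingEnd ℂ) z) = (starRingEnd ℂ) (D.G w z)) ∧
    ∀ j, D.p (fun j => (starRingEnd ℂ) (w j)) j = (starRingEnd ℂ) (D.p w j)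

end LocalDeformation

namespace MarkedMap

variable (g : MarkedMap 1)

/-- The point `c_i = g^i(c₀)` of the marked orbit. -/
def orbit (i : ℕ) : ℂ := g.toFun^[i] (g.c₀ 0)

/-- `P` consists of the `q` distinct points `c_0, …, c_{q-1}` of the marked orbit. -/
def IsMarkedOrbit (q : ℕ) : Prop :=
  Set.InjOn g.orbit (Set.Iio q) ∧ g.P = (Finset.range q).image g.orbit

/-- The sum `∑_{i < n} ρ^i / Dg^i(c_1)`, where `Dg^i` is the derivative of the `i`-th iterate. -/
def orbitSum (n : ℕ) (ρ : ℂ) : ℂ :=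
  ∑ i ∈ Finset.range n, ρ ^ i / deriv (g.toFun^[i]) (g.orbit 1)

end MarkedMap

end

/-! Lifting never runs out of room. A lifted motion takes values in `U ∪ {0}`, and two such points
differ by less than `diam U`, so the right-hand side `h t (f x + c) - h t c` of the next lifting
equation stays in `V`; injectivity of the motion keeps it away from `0`. The covering `f` can
therefore be lifted again over the same disc, with uniformly bounded values (`exists_motion_lift`,
`exists_twisted_lifts`). If the velocity at `0` is an eigenvector `v` with eigenvalue `μ`, the
`k`-th lift has velocity `μ ^ k v`, and Cauchy's estimate forces `‖μ‖ ≤ 1`. Under robust separation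
there is slack to compose every lift with a map `ψ` that fixes `g(P)` pointwise and has derivative
`1 + s > 1` there; the same argument gives `(1 + s) ‖μ‖ ≤ 1`.

Excluding `μ = 1` is the main difficulty. Given a fixed vector, a motion is built that satisfies the
lifting equation at every point except perhaps one, `y`. If the equation failed at `y` with leading
term `κ t ^ m`, the `k`-th lift would drift away from the motion by `t ^ m` times a sum of `k` terms
`A ^ j δ`. An invariant functional, supplied by the eigenvalue `1`, sees `k` times a nonzero
constant in this sum, while Schwarz's lemma bounds it independently of `k`. So the equation holds
identically (`eventually_relation`). If `v c = 0`, this says that an iterate of `z ↦ c + f z` is the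
identity near a periodic point; if `v c ≠ 0`, that the orbit relation of the critical value persists
for all nearby parameters.

Both are impossible. Parametrize a branch by `f (a ζ) = exp ζ` on a half-plane. The product of the
values `f (z_i)` along the orbit, extended by `0` off the set of `ζ` where the relation holds, is
continuous; this is the delicate compactness statement `mem_relationDomain_of_limit`. A Radó-type
argument (`subset_closure_ne_zero`) then makes the relation hold on a dense set of `ζ`, which puts
points into `closure U` that are further apart than `diam U`. For the critical orbit this last step
uses the parallelogram law and a maximum principle on the half-plane.

The determinant is that of a unipotent bidiagonal matrix plus a matrix of rank at most two. In the
real case it is real along `ρ ∈ [0, 1]`, equals `1` at `ρ = 0` and has no zero there, hence is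
positive at `ρ = 1`. -/

section

open Set Filter Topology Metric

/-! ### The covering `f`: nonvanishing derivative, holomorphic lifts, diameter estimates -/

namespace IsClassF

variable {f : ℂ → ℂ} {U V : Set ℂ}

theorem apply_mem (hf : IsClassF f U V) {x : ℂ} (hx : x ∈ U \ {0}) : f x ∈ V \ {0} := by
  obtain ⟨h, -⟩ := hf.covering
  exact h hx

theorem isOpen_diff (hf : IsClassF f U V) : IsOpen (U \ {0}) :=
  hf.isOpen_source.sdiff isClosed_singleton

theorem analyticAt (hf : IsClassF f U V) {x : ℂ} (hx : x ∈ U) : AnalyticAt ℂ f x :=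
  hf.holomorphic.analyticAt (hf.isOpen_source.mem_nhds hx)

/-- A local homeomorphism which is holomorphic has nonvanishing derivative. -/
theorem deriv_ne_zero (hf : IsClassF f U V) {x : ℂ} (hx : x ∈ U \ {0}) : deriv f x ≠ 0 := by
  obtain ⟨h, hcov⟩ := hf.covering
  obtain ⟨e, hxe, he⟩ := hcov.isLocalHomeomorph ⟨x, hx⟩
  have hef : ∀ y : ↥(U \ {0}), (e y : ℂ) = f y := fun y => by rw [← he]; rfl
  have hopen := hf.isOpen_diff
  have hVopen : IsOpen (V \ {0}) := hf.isOpen_target.sdiff isClosed_singleton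
  set y₀ : ↥(V \ {0}) := e ⟨x, hx⟩ with hy₀
  have hy₀t : y₀ ∈ e.target := e.map_source hxe
  -- the local inverse as a function on `ℂ`
  classical
  let s : ℂ → ℂ := fun y => if hy : y ∈ V \ {0} then (e.symm ⟨y, hy⟩ : ℂ) else 0
  have hs : ∀ y : ↥(V \ {0}), s y = e.symm y := fun y => by
    have : (y : ℂ) ∈ V \ {0} := y.2
    simp only [s, this, dif_pos]
  have hT : IsOpen (Subtype.val '' e.target : Set ℂ) :=
    hVopen.isOpenMap_subtype_val _ e.open_target
  have hsc : ∀ y ∈ (Subtype.val '' e.target : Set ℂ), ContinuousAt s y := by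
    rintro _ ⟨y, hy, rfl⟩
    have h1 : ContinuousAt (fun y : ↥(V \ {0}) => s y) y := by
      simp only [hs]
      exact continuous_subtype_val.continuousAt.comp (e.symm.continuousAt hy)
    exact hVopen.isOpenEmbedding_subtypeVal.continuousAt_iff.1 h1
  have hfs : ∀ y ∈ (Subtype.val '' e.target : Set ℂ), f (s y) = y := by
    rintro _ ⟨y, hy, rfl⟩
    rw [hs, ← hef, e.right_inv hy]
  have hsU : ∀ y ∈ (Subtype.val '' e.target : Set ℂ), s y ∈ U \ {0} := by
    rintro _ ⟨y, hy, rfl⟩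
    rw [hs]; exact (e.symm y).2
  have hsx : s (f x) = x := by
    have := hs y₀
    rw [hy₀, e.left_inv hxe, hef] at this
    exact this
  have hfxT : f x ∈ (Subtype.val '' e.target : Set ℂ) := ⟨y₀, hy₀t, by rw [hy₀, hef]⟩
  -- left inverse near `x`
  have hleft : ∀ᶠ z in 𝓝 x, s (f z) = z := by
    have h1 : Subtype.val '' e.source ∈ 𝓝 x :=
      (hopen.isOpenMap_subtype_val _ e.open_source).mem_nhds ⟨_, hxe, rfl⟩
    filter_upwards [h1]
    rintro _ ⟨z, hz, rfl⟩
    rw [← hef, hs, e.left_inv hz]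
  have hfa : AnalyticAt ℂ f x := hf.analyticAt hx.1
  -- `deriv f` does not vanish on a punctured neighbourhood
  have hder : ∀ᶠ z in 𝓝[≠] x, deriv f z ≠ 0 := by
    rcases hfa.deriv.eventually_eq_zero_or_eventually_ne_zero with h0 | h0
    · exfalso
      have h1 : ∀ᶠ z in 𝓝 x, f z = f x := by
        obtain ⟨r, hr, hb⟩ := Metric.eventually_nhds_iff_ball.1 (h0.and hfa.eventually_analyticAt)
        filter_upwards [ball_mem_nhds x hr] with z hz
        refine (convex_ball x r).is_const_of_fderivWithin_eq_zero (𝕜 := ℂ) (f := f)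
          (fun y hy => (hb y hy).2.differentiableAt.differentiableWithinAt) (fun y hy => ?_) hz
          (mem_ball_self hr)
        rw [fderivWithin_of_isOpen isOpen_ball hy]
        ext
        simp [(hb y hy).1]
      have h2 : ∀ᶠ z in 𝓝[≠] x, False := by
        filter_upwards [(h1.and hleft).filter_mono nhdsWithin_le_nhds, self_mem_nhdsWithin]
          with z hz hzx
        apply hzx
        rw [mem_singleton_iff, ← hz.2, hz.1, hsx]
      exact h2.exists.elim fun _ h => h
    · exact h0
  -- Critical points of `f` are isolated near `x`, so `s` is differentiable on a punctured
  -- neighbourhood of `f x`; continuity of `s` at `f x` makes the singularity removable.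
  have hsan : AnalyticAt ℂ s (f x) := by
    apply Complex.analyticAt_of_differentiable_on_punctured_nhds_of_continuousAt _ (hsc _ hfxT)
    have htend : Tendsto s (𝓝[≠] (f x)) (𝓝[≠] x) := by
      refine tendsto_nhdsWithin_iff.2 ⟨?_, ?_⟩
      · have := (hsc _ hfxT).tendsto.mono_left (nhdsWithin_le_nhds (s := {f x}ᶜ))
        rwa [hsx] at this
      · filter_upwards [self_mem_nhdsWithin, nhdsWithin_le_nhds (hT.mem_nhds hfxT)] with y hy hyT h
        apply hy
        rw [mem_singleton_iff] at h ⊢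
        rw [← h, hfs y hyT]
    filter_upwards [htend.eventually hder, nhdsWithin_le_nhds (hT.mem_nhds hfxT)] with y hy hyT
    have h3 : HasDerivAt f (deriv f (s y)) (s y) :=
      (hf.analyticAt (hsU y hyT).1).differentiableAt.hasDerivAt
    refine (HasDerivAt.of_local_left_inverse (hsc y hyT) h3 hy ?_).differentiableAt
    filter_upwards [hT.mem_nhds hyT] with w hw using hfs w hw
  intro h0
  have h4 : HasDerivAt (fun z => s (f z)) (deriv s (f x) * deriv f x) x :=
    HasDerivAt.comp x hsan.differentiableAt.hasDerivAt hfa.differentiableAt.hasDerivAt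
  have h5 : HasDerivAt (fun z => s (f z)) 1 x :=
    (hasDerivAt_id x).congr_of_eventuallyEq hleft
  have := h4.unique h5
  rw [h0, mul_zero] at this
  exact zero_ne_one this

theorem hasStrictDerivAt (hf : IsClassF f U V) {x : ℂ} (hx : x ∈ U) :
    HasStrictDerivAt f (deriv f x) x :=
  (hf.analyticAt hx).hasStrictDerivAt

/-- Local uniqueness of lifts through `f`. -/
theorem eventuallyEq_of_comp_eq (hf : IsClassF f U V) {X : Type*} [TopologicalSpace X]
    {a b : X → ℂ} {t : X} (ha : ContinuousAt a t) (hb : ContinuousAt b t) (hab : a t = b t)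
    (hat : a t ∈ U \ {0}) (h : ∀ᶠ s in 𝓝 t, f (a s) = f (b s)) : ∀ᶠ s in 𝓝 t, a s = b s := by
  have h1 := HasStrictDerivAt.eventually_left_inverse (hf.hasStrictDerivAt hat.1)
    (hf.deriv_ne_zero hat)
  have h2 := ha.tendsto.eventually h1
  have hb' : Tendsto b (𝓝 t) (𝓝 (a t)) := hab ▸ hb.tendsto
  have h3 := hb'.eventually h1
  filter_upwards [h2, h3, h] with s hs2 hs3 hs
  rw [← hs2, ← hs3, hs]

/-- Holomorphic lifts through the covering over convex open sets. -/
theorem exists_lift (hf : IsClassF f U V) {Δ : Set ℂ} (hΔ : IsOpen Δ) (hconv : Convex ℝ Δ)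
    {u : ℂ → ℂ} (hu : DifferentiableOn ℂ u Δ) (huV : MapsTo u Δ (V \ {0})) {t x : ℂ} (ht : t ∈ Δ)
    (hx : x ∈ U \ {0}) (hfx : f x = u t) :
    ∃ φ : ℂ → ℂ, DifferentiableOn ℂ φ Δ ∧ MapsTo φ Δ (U \ {0}) ∧ (∀ s ∈ Δ, f (φ s) = u s) ∧
      φ t = x := by
  obtain ⟨h, hcov⟩ := hf.covering
  -- Convexity makes `Δ` contractible, so continuous maps on it lift through the covering;
  -- holomorphy is then local, since the lift is a local inverse of `f` composed with `u`.
  have : Nonempty Δ := ⟨⟨t, ht⟩⟩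
  have : ContractibleSpace Δ := hconv.contractibleSpace ⟨t, ht⟩
  have : LocallyPathConnectedSpace Δ := hΔ.locallyPathConnectedSpace
  let F : C(Δ, ↥(V \ {0})) := ⟨fun s => ⟨u s, huV s.2⟩,
    (continuousOn_iff_continuous_domRestrict.1 hu.continuousOn).subtype_mk _⟩
  obtain ⟨G, ⟨hG0, hG⟩, -⟩ := hcov.existsUnique_continuousMap_lifts F ⟨t, ht⟩ ⟨x, hx⟩
    (Subtype.ext hfx)
  have hG' : ∀ s : Δ, f (G s) = u s := fun s => congrArg Subtype.val (congrFun hG s)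
  classical
  let φ : ℂ → ℂ := fun s => if hs : s ∈ Δ then (G ⟨s, hs⟩ : ℂ) else 0
  have hφ : ∀ s (hs : s ∈ Δ), φ s = G ⟨s, hs⟩ := fun s hs => by simp only [φ, hs, dif_pos]
  have hmaps : MapsTo φ Δ (U \ {0}) := fun s hs => by rw [hφ s hs]; exact (G ⟨s, hs⟩).2
  have hfφ : ∀ s ∈ Δ, f (φ s) = u s := fun s hs => by rw [hφ s hs]; exact hG' ⟨s, hs⟩
  have hcont : ContinuousOn φ Δ := by
    rw [continuousOn_iff_continuous_domRestrict]
    have : Δ.domRestrict φ = fun s => (G s : ℂ) := by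
      ext s; exact hφ s s.2
    rw [this]; fun_prop
  refine ⟨φ, fun s hs => ?_, hmaps, hfφ, by rw [hφ t ht, hG0]⟩
  have hsU := hmaps hs
  have h1 := hf.hasStrictDerivAt hsU.1
  have h2 := h1.to_localInverse (hf.deriv_ne_zero hsU)
  have h3 := HasStrictDerivAt.eventually_left_inverse h1 (hf.deriv_ne_zero hsU)
  have hc : ContinuousAt φ s := hcont.continuousAt (hΔ.mem_nhds hs)
  have hd : DifferentiableAt ℂ u s := hu.differentiableAt (hΔ.mem_nhds hs)
  rw [hfφ s hs] at h2
  have h4 := (h2.hasDerivAt.differentiableAt.comp s hd).congr_of_eventuallyEq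
    (f₁ := φ) (by
      filter_upwards [hc.tendsto.eventually h3, hΔ.mem_nhds hs] with y hy hyΔ
      simp only [Function.comp]
      rw [← hfφ y hyΔ, hy])
  exact h4.differentiableWithinAt

/-- Uniqueness of holomorphic lifts on preconnected open sets. -/
theorem eqOn_of_comp_eq (hf : IsClassF f U V) {Δ : Set ℂ} (hΔ : IsOpen Δ)
    (hconn : IsPreconnected Δ) {a b : ℂ → ℂ} (ha : DifferentiableOn ℂ a Δ)
    (hb : DifferentiableOn ℂ b Δ) (haU : MapsTo a Δ (U \ {0})) (h : ∀ s ∈ Δ, f (a s) = f (b s))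
    {t : ℂ} (ht : t ∈ Δ) (hab : a t = b t) : EqOn a b Δ := by
  refine (ha.analyticOnNhd hΔ).eqOn_of_preconnected_of_eventuallyEq (hb.analyticOnNhd hΔ) hconn ht ?_
  exact hf.eventuallyEq_of_comp_eq (ha.continuousOn.continuousAt (hΔ.mem_nhds ht))
    (hb.continuousOn.continuousAt (hΔ.mem_nhds ht)) hab (haU ht)
    (by filter_upwards [hΔ.mem_nhds ht] with s hs using h s hs)

theorem nonempty_source (hf : IsClassF f U V) : U.Nonempty :=
  closure_nonempty_iff.1 ⟨0, hf.zero_mem_closure⟩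

theorem norm_lt_diam (hf : IsClassF f U V) {a : ℂ} (ha : a ∈ U) : ‖a‖ < Metric.diam U := by
  simpa using hf.source_subset_ball ha

theorem diam_pos (hf : IsClassF f U V) : 0 < Metric.diam U := by
  obtain ⟨a, ha⟩ := hf.nonempty_source
  exact (norm_nonneg a).trans_lt (hf.norm_lt_diam ha)

/-- Distances between interior points of a planar set and points of its closure are smaller than
the diameter. -/
theorem dist_lt_diam_of_mem_closure (hf : IsClassF f U V) {a b : ℂ} (ha : a ∈ U)
    (hb : b ∈ closure U) : ‖a - b‖ < Metric.diam U := by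
  rcases eq_or_ne a b with rfl | hab
  · simpa using hf.diam_pos
  obtain ⟨r, hr, hball⟩ := Metric.isOpen_iff.1 hf.isOpen_source a ha
  have hn : 0 < ‖a - b‖ := norm_pos_iff.2 (sub_ne_zero.2 hab)
  -- Strictness comes from pushing `a` away from `b` by `r / 2`, which stays in the open set `U` and
  -- gives `(1 + t) ‖a - b‖ ≤ diam U`.
  set t : ℝ := r / (2 * ‖a - b‖) with ht
  have htpos : 0 < t := by positivity
  have hmem : a + (t : ℂ) * (a - b) ∈ U := by
    apply hball
    rw [mem_ball, dist_eq_norm, add_sub_cancel_left, norm_mul, Complex.norm_real,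
      Real.norm_of_nonneg htpos.le, ht]
    field_simp
    linarith
  have h1 := Metric.dist_le_diam_of_mem hf.isBounded_source.closure (subset_closure hmem) hb
  rw [Metric.diam_closure, dist_eq_norm] at h1
  have h2 : a + (t : ℂ) * (a - b) - b = ((1 + t : ℝ) : ℂ) * (a - b) := by push_cast; ring
  rw [h2, norm_mul, Complex.norm_real, Real.norm_of_nonneg (by positivity)] at h1
  nlinarith

theorem dist_lt_diam (hf : IsClassF f U V) {a b : ℂ} (ha : a ∈ insert 0 U) (hb : b ∈ insert 0 U) :
    ‖a - b‖ < Metric.diam U := by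
  rcases ha with rfl | ha
  · rcases hb with rfl | hb
    · simpa using hf.diam_pos
    · simpa using hf.norm_lt_diam hb
  · rcases hb with rfl | hb
    · simpa using hf.norm_lt_diam ha
    · exact hf.dist_lt_diam_of_mem_closure ha (subset_closure hb)

theorem norm_sub_le_diam (hf : IsClassF f U V) {a b : ℂ} (ha : a ∈ closure U)
    (hb : b ∈ closure U) : ‖a - b‖ ≤ Metric.diam U := by
  have h1 := Metric.dist_le_diam_of_mem hf.isBounded_source.closure ha hb
  rwa [Metric.diam_closure, dist_eq_norm] at h1

end IsClassF

/-! ### Motions, their lifts and the transfer operator -/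

/-- `Q` contains `c` and is forward invariant under `x ↦ f x + c` (defined off the origin). -/
structure IsInvariantSet (f : ℂ → ℂ) (U : Set ℂ) (c : ℂ) (Q : Finset ℂ) : Prop where
  base_mem : c ∈ Q
  mem_source : ∀ x ∈ Q, x ≠ 0 → x ∈ U
  map_mem : ∀ x ∈ Q, x ≠ 0 → f x + c ∈ Q

/-- `h'` lifts the motion `h` of `Q` for the additive family through `x ↦ f x + c`. -/
def IsMotionLift (f : ℂ → ℂ) (U : Set ℂ) (c : ℂ) (Q : Finset ℂ) (h h' : ℂ → ℂ → ℂ)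
    (Λ : Set ℂ) : Prop :=
  ∀ t ∈ Λ, (0 ∈ Q → h' t 0 = 0) ∧ ∀ x ∈ Q, x ≠ 0 → h' t x ∈ U ∧ f (h' t x) = h t (f x + c) - h t c

/-- The transfer operator of the additive family, acting on all functions. -/
noncomputable def transfer (f : ℂ → ℂ) (c : ℂ) : Module.End ℂ (ℂ → ℂ) where
  -- This is the derivative at `t = 0` of `f (h' t x) = h t (f x + c) - h t c`; the marked point
  -- does not move, hence the value `0`.
  toFun v x := if x = 0 then 0 else (v (f x + c) - v c) / deriv f x
  map_add' u v := by
    ext x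
    by_cases hx : x = 0 <;> simp [hx]
    ring
  map_smul' a v := by
    ext x
    by_cases hx : x = 0 <;> simp [hx]
    ring

theorem transfer_zero (f : ℂ → ℂ) (c : ℂ) (v : ℂ → ℂ) : transfer f c v 0 = 0 := by
  simp [transfer]

theorem transfer_apply (f : ℂ → ℂ) (c : ℂ) (v : ℂ → ℂ) {x : ℂ} (hx : x ≠ 0) :
    transfer f c v x = (v (f x + c) - v c) / deriv f x := by
  simp [transfer, hx]

theorem IsInvariantSet.transfer_congr {f : ℂ → ℂ} {U : Set ℂ} {c : ℂ} {Q : Finset ℂ}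
    (hQ : IsInvariantSet f U c Q) {u v : ℂ → ℂ} (huv : ∀ x ∈ Q, u x = v x) :
    ∀ x ∈ Q, transfer f c u x = transfer f c v x := by
  intro x hx
  by_cases h0 : x = 0
  · rw [h0, transfer_zero, transfer_zero]
  · rw [transfer_apply _ _ _ h0, transfer_apply _ _ _ h0, huv _ (hQ.map_mem x hx h0),
      huv _ hQ.base_mem]

/-- The affine motion with velocity `v`. -/
theorem exists_motion_of_velocity (Q : Finset ℂ) (v : ℂ → ℂ) :
    ∃ r : ℝ, 0 < r ∧ IsHolomorphicMotion (Q : Set ℂ) (ball 0 r) (fun t x => x + t * v x) := by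
  have hev : ∀ᶠ t in 𝓝 (0 : ℂ), ∀ x ∈ Q, ∀ y ∈ Q, x ≠ y → x + t * v x ≠ y + t * v y := by
    refine (Finset.eventually_all Q).2 fun x _ => (Finset.eventually_all Q).2 fun y _ => ?_
    by_cases hxy : x = y
    · simp [hxy]
    have h1 : ContinuousAt (fun t : ℂ => (x + t * v x) - (y + t * v y)) 0 := by fun_prop
    have h2 : ∀ᶠ t in 𝓝 (0 : ℂ), (x + t * v x) - (y + t * v y) ≠ 0 :=
      h1.eventually_ne (by simpa [sub_eq_zero] using hxy)
    filter_upwards [h2] with t ht _ h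
    exact ht (sub_eq_zero.2 h)
  obtain ⟨r, hr, hb⟩ := Metric.eventually_nhds_iff_ball.1 hev
  refine ⟨r, hr, ⟨fun x _ => by simp, fun t ht x hx y hy hxy => ?_, fun x _ => by fun_prop⟩⟩
  by_contra hne
  exact hb t ht x hx y hy hne hxy

theorem IsHolomorphicMotion.mono {X X' Λ Λ' : Set ℂ} {h : ℂ → ℂ → ℂ}
    (hh : IsHolomorphicMotion X Λ h) (hX : X' ⊆ X) (hΛ : Λ' ⊆ Λ) :
    IsHolomorphicMotion X' Λ' h :=
  ⟨fun x hx => hh.at_zero x (hX hx), fun t ht => (hh.injOn t (hΛ ht)).mono hX,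
    fun x hx => (hh.holomorphic x (hX hx)).mono hΛ⟩

namespace IsClassF

variable {f : ℂ → ℂ} {U V : Set ℂ} {c : ℂ} {Q : Finset ℂ}

/-- A motion over a disc whose shifted values stay in `V` can be lifted. -/
theorem exists_motion_lift (hf : IsClassF f U V) (hQ : IsInvariantSet f U c Q) {ε : ℝ}
    (hε : 0 < ε) {h : ℂ → ℂ → ℂ} (hh : IsHolomorphicMotion (Q : Set ℂ) (ball 0 ε) h)
    (hV : ∀ t ∈ ball (0 : ℂ) ε, ∀ x ∈ Q, x ≠ 0 → h t (f x + c) - h t c ∈ V) :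
    ∃ h' : ℂ → ℂ → ℂ, IsHolomorphicMotion (Q : Set ℂ) (ball 0 ε) h' ∧
      IsMotionLift f U c Q h h' (ball 0 ε) ∧
      ∀ t ∈ ball (0 : ℂ) ε, ∀ x ∈ Q, h' t x ∈ insert 0 U := by
  have h0 : (0 : ℂ) ∈ ball (0 : ℂ) ε := mem_ball_self hε
  have hlift : ∀ x : ℂ, ∃ φ : ℂ → ℂ, x ∈ Q → x ≠ 0 → DifferentiableOn ℂ φ (ball 0 ε) ∧
      MapsTo φ (ball 0 ε) (U \ {0}) ∧
      (∀ s ∈ ball (0 : ℂ) ε, f (φ s) = h s (f x + c) - h s c) ∧ φ 0 = x := by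
    intro x
    by_cases hx : x ∈ Q ∧ x ≠ 0
    · obtain ⟨hx, hx0⟩ := hx
      have hfx := hf.apply_mem ⟨hQ.mem_source x hx hx0, hx0⟩
      have hmem := hQ.map_mem x hx hx0
      obtain ⟨φ, hφ⟩ := hf.exists_lift isOpen_ball (convex_ball (0 : ℂ) ε)
        (u := fun t => h t (f x + c) - h t c)
        ((hh.holomorphic _ hmem).sub (hh.holomorphic _ hQ.base_mem))
        -- A zero of the shifted motion would give `f x + c = c` by injectivity, but `f x ≠ 0`.
        (fun t ht => ⟨hV t ht x hx hx0, fun he => by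
          have := hh.injOn t ht hmem hQ.base_mem (sub_eq_zero.1 he)
          exact hfx.2 (by simpa using this)⟩) h0
        ⟨hQ.mem_source x hx hx0, hx0⟩
        (by simp only [hh.at_zero _ hmem, hh.at_zero _ hQ.base_mem]; ring)
      exact ⟨φ, fun _ _ => hφ⟩
    · exact ⟨0, fun h1 h2 => (hx ⟨h1, h2⟩).elim⟩
  choose φ hφ using hlift
  classical
  refine ⟨fun t x => if x = 0 then 0 else φ x t, ⟨fun x hx => ?_, fun t ht x hx y hy hxy => ?_,
    fun x hx => ?_⟩, fun t ht => ⟨by simp, fun x hx hx0 => ?_⟩, fun t ht x hx => ?_⟩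
  · by_cases hx0 : x = 0
    · simp [hx0]
    · simpa [hx0] using (hφ x hx hx0).2.2.2
  · by_cases hx0 : x = 0
    · by_cases hy0 : y = 0
      · rw [hx0, hy0]
      · simp only [hx0, hy0, if_true, if_false] at hxy
        exact ((hφ y hy hy0).2.1 ht).2 hxy.symm |>.elim
    · by_cases hy0 : y = 0
      · simp only [hx0, hy0, if_true, if_false] at hxy
        exact ((hφ x hx hx0).2.1 ht).2 hxy |>.elim
      · simp only [hx0, hy0, if_false] at hxy
        obtain ⟨a1, a2, a3, a4⟩ := hφ x hx hx0
        obtain ⟨b1, b2, b3, b4⟩ := hφ y hy hy0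
        have e1 := a3 t ht
        rw [hxy, b3 t ht, sub_left_inj] at e1
        have e2 := hh.injOn t ht (hQ.map_mem y hy hy0) (hQ.map_mem x hx hx0) e1
        -- By injectivity of `h t`, points whose lifts meet at `t` have the same image under `f`;
        -- their lifts then lift one function and agree at `t`, hence also at `0`, where they are
        -- `x` and `y`.
        have e3 := hf.eqOn_of_comp_eq isOpen_ball (convex_ball (0 : ℂ) ε).isPreconnected a1 b1 a2
          (fun s hs => by rw [a3 s hs, b3 s hs, e2]) ht hxy
        rw [← a4, ← b4, e3 h0]
  · by_cases hx0 : x = 0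
    · simp [hx0]
    · simpa [hx0] using (hφ x hx hx0).1
  · simp only [hx0, if_false]
    exact ⟨((hφ x hx hx0).2.1 ht).1, (hφ x hx hx0).2.2.1 t ht⟩
  · by_cases hx0 : x = 0
    · simp [hx0]
    · simp only [hx0, if_false]
      exact Or.inr ((hφ x hx hx0).2.1 ht).1

/-- Successive lifting, with a twist by a map `ψ` at each step, is defined over a fixed disc and
stays bounded. -/
theorem exists_twisted_lifts (hf : IsClassF f U V) (hQ : IsInvariantSet f U c Q) {ψ : ℂ → ℂ}
    (hψ : Differentiable ℂ ψ) (hinj : InjOn ψ (insert 0 U)) (hψQ : ∀ x ∈ Q, ψ x = x)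
    (hψV : ∀ a ∈ insert 0 U, ∀ b ∈ insert 0 U, ψ a - ψ b ∈ V) {r : ℝ} (hr : 0 < r)
    {h : ℂ → ℂ → ℂ} (hh : IsHolomorphicMotion (Q : Set ℂ) (ball 0 r) h) :
    ∃ ε : ℝ, 0 < ε ∧ ε ≤ r ∧ ∃ H : ℕ → ℂ → ℂ → ℂ, H 0 = h ∧
      (∀ k, IsHolomorphicMotion (Q : Set ℂ) (ball 0 ε) (H k)) ∧
      (∀ k, ∃ h', IsHolomorphicMotion (Q : Set ℂ) (ball 0 ε) h' ∧
        IsMotionLift f U c Q (H k) h' (ball 0 ε) ∧ H (k + 1) = fun t x => ψ (h' t x)) ∧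
      ∃ M : ℝ, 0 < M ∧ ∀ k, ∀ x ∈ Q, ∀ t ∈ ball (0 : ℂ) ε, ‖H k t x‖ ≤ M := by
  have hcont : ∀ x ∈ Q, ContinuousAt (fun t => h t x) 0 := fun x hx =>
    (hh.holomorphic x hx).continuousOn.continuousAt (ball_mem_nhds 0 hr)
  have hev : ∀ᶠ t in 𝓝 (0 : ℂ), ∀ x ∈ Q, (x ≠ 0 → h t (f x + c) - h t c ∈ V) ∧
      ‖h t x‖ ≤ ‖x‖ + 1 := by
    refine (Finset.eventually_all Q).2 fun x hx => Filter.Eventually.and ?_ ?_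
    · by_cases hx0 : x = 0
      · simp [hx0]
      have hmem := hQ.map_mem x hx hx0
      have h1 : ContinuousAt (fun t => h t (f x + c) - h t c) 0 :=
        (hcont _ hmem).sub (hcont _ hQ.base_mem)
      have h2 := h1.eventually_mem (hf.isOpen_target.mem_nhds (by
        rw [hh.at_zero _ hmem, hh.at_zero _ hQ.base_mem, add_sub_cancel_right]
        exact (hf.apply_mem ⟨hQ.mem_source x hx hx0, hx0⟩).1))
      filter_upwards [h2] with t ht _ using ht
    · have h1 := (hcont x hx).norm
      have h2 : ∀ᶠ t in 𝓝 (0 : ℂ), ‖h t x‖ < ‖x‖ + 1 :=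
        h1.eventually_lt continuousAt_const (by rw [hh.at_zero x hx]; linarith)
      filter_upwards [h2] with t ht using ht.le
  obtain ⟨ε', hε', hb⟩ := Metric.eventually_nhds_iff_ball.1 hev
  set ε := min ε' r with hεdef
  have hε : 0 < ε := lt_min hε' hr
  have hsub : ball (0 : ℂ) ε ⊆ ball 0 r := ball_subset_ball (min_le_right _ _)
  have hsub' : ball (0 : ℂ) ε ⊆ ball 0 ε' := ball_subset_ball (min_le_left _ _)
  -- Admissible motions are those that can be lifted over the fixed disc. Only the initial motion
  -- requires shrinking the disc: after one lift the values lie in `insert 0 U`, and `hψV` makes the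
  -- twisted lift admissible again.
  let Adm : (ℂ → ℂ → ℂ) → Prop := fun h => IsHolomorphicMotion (Q : Set ℂ) (ball 0 ε) h ∧
    ∀ t ∈ ball (0 : ℂ) ε, ∀ x ∈ Q, x ≠ 0 → h t (f x + c) - h t c ∈ V
  have hAdm0 : Adm h := ⟨hh.mono subset_rfl hsub, fun t ht x hx => (hb t (hsub' ht) x hx).1⟩
  have hstep : ∀ k : {h // Adm h}, ∃ h', IsHolomorphicMotion (Q : Set ℂ) (ball 0 ε) h' ∧
      IsMotionLift f U c Q k.1 h' (ball 0 ε) ∧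
      (∀ t ∈ ball (0 : ℂ) ε, ∀ x ∈ Q, h' t x ∈ insert 0 U) ∧ Adm (fun t x => ψ (h' t x)) := by
    rintro ⟨k, hk1, hk2⟩
    obtain ⟨h', h1, h2, h3⟩ := hf.exists_motion_lift hQ hε hk1 hk2
    refine ⟨h', h1, h2, h3, ⟨fun x hx => ?_, fun t ht x hx y hy hxy => ?_, fun x hx => ?_⟩, ?_⟩
    · simp only [h1.at_zero x hx, hψQ x hx]
    · exact h1.injOn t ht hx hy (hinj (h3 t ht x hx) (h3 t ht y hy) hxy)
    · exact hψ.comp_differentiableOn (h1.holomorphic x hx)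
    · intro t ht x hx hx0
      exact hψV _ (h3 t ht _ (hQ.map_mem x hx hx0)) _ (h3 t ht _ hQ.base_mem)
  choose L hL using hstep
  let S : ℕ → {h // Adm h} := fun k =>
    Nat.rec ⟨h, hAdm0⟩ (fun _ s => ⟨fun t x => ψ (L s t x), (hL s).2.2.2⟩) k
  have hbdd : ∃ M : ℝ, ∀ z ∈ insert 0 U, ‖ψ z‖ ≤ M := by
    have hB : Bornology.IsBounded (insert 0 U) := hf.isBounded_source.insert 0
    obtain ⟨M, hM⟩ := hB.isCompact_closure.exists_bound_of_continuousOn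
      hψ.continuous.continuousOn
    exact ⟨M, fun z hz => hM z (subset_closure hz)⟩
  obtain ⟨M₁, hM₁⟩ := hbdd
  refine ⟨ε, hε, min_le_right _ _, fun k => (S k).1, rfl, fun k => (S k).2.1, fun k =>
    ⟨L (S k), (hL (S k)).1, (hL (S k)).2.1, rfl⟩, max M₁ 0 + (∑ x ∈ Q, ‖x‖) + 1, ?_, ?_⟩
  · have := Finset.sum_nonneg (fun x (_ : x ∈ Q) => norm_nonneg x)
    have := le_max_right M₁ 0
    linarith
  · intro k x hx t ht
    have hs := Finset.sum_nonneg (fun x (_ : x ∈ Q) => norm_nonneg x)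
    have hm := le_max_right M₁ 0
    have hm' := le_max_left M₁ 0
    cases k with
    | zero =>
      have h1 := (hb t (hsub' ht) x hx).2
      have h2 := Finset.single_le_sum (fun x (_ : x ∈ Q) => norm_nonneg x) hx
      change ‖h t x‖ ≤ _
      linarith
    | succ k =>
      change ‖ψ (L (S k) t x)‖ ≤ _
      have := hM₁ _ ((hL (S k)).2.2.1 t ht x hx)
      linarith

/-- Differentiating the lifting relation. -/
theorem deriv_motionLift (hf : IsClassF f U V) (hQ : IsInvariantSet f U c Q) {Λ : Set ℂ}
    (hΛ : Λ ∈ 𝓝 (0 : ℂ)) {h h' : ℂ → ℂ → ℂ} (hh : IsHolomorphicMotion (Q : Set ℂ) Λ h)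
    (hh' : IsHolomorphicMotion (Q : Set ℂ) Λ h') (hl : IsMotionLift f U c Q h h' Λ) {x : ℂ}
    (hx : x ∈ Q) :
    deriv (fun t => h' t x) 0 = transfer f c (fun y => deriv (fun t => h t y) 0) x := by
  have hd : ∀ y ∈ Q, DifferentiableAt ℂ (fun t => h t y) 0 := fun y hy =>
    (hh.holomorphic y hy).differentiableAt hΛ
  have hd' : DifferentiableAt ℂ (fun t => h' t x) 0 := (hh'.holomorphic x hx).differentiableAt hΛ
  by_cases hx0 : x = 0
  · subst hx0
    rw [transfer_zero]
    have : (fun t => h' t 0) =ᶠ[𝓝 0] fun _ => 0 := by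
      filter_upwards [hΛ] with t ht using (hl t ht).1 hx
    rw [this.deriv_eq, deriv_const]
  · rw [transfer_apply _ _ _ hx0]
    have hxU := hQ.mem_source x hx hx0
    have hmem := hQ.map_mem x hx hx0
    rw [eq_div_iff (hf.deriv_ne_zero ⟨hxU, hx0⟩)]
    have h1 : HasDerivAt f (deriv f x) (h' 0 x) := by
      rw [hh'.at_zero x hx]; exact (hf.analyticAt hxU).differentiableAt.hasDerivAt
    have h2 : HasDerivAt (fun t => f (h' t x)) (deriv f x * deriv (fun t => h' t x) 0) 0 :=
      HasDerivAt.comp (𝕜 := ℂ) 0 h1 hd'.hasDerivAt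
    have h3 : HasDerivAt (fun t => h t (f x + c) - h t c)
        (deriv (fun t => h t (f x + c)) 0 - deriv (fun t => h t c) 0) 0 :=
      (hd _ hmem).hasDerivAt.sub (hd _ hQ.base_mem).hasDerivAt
    have h4 : (fun t => f (h' t x)) =ᶠ[𝓝 0] (fun t => h t (f x + c) - h t c) := by
      filter_upwards [hΛ] with t ht using ((hl t ht).2 x hx hx0).2
    rw [mul_comm, h2.unique (h3.congr_of_eventuallyEq h4)]

/-- Twisting the lifts by `ψ` with `ψ' = r` on `Q` bounds the eigenvalues of the transfer
operator by `1 / r`. -/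
theorem norm_mul_eigenvalue_le_one (hf : IsClassF f U V) (hQ : IsInvariantSet f U c Q)
    {ψ : ℂ → ℂ} (hψ : Differentiable ℂ ψ) (hinj : InjOn ψ (insert 0 U)) (hψQ : ∀ x ∈ Q, ψ x = x)
    (hψV : ∀ a ∈ insert 0 U, ∀ b ∈ insert 0 U, ψ a - ψ b ∈ V) {r : ℂ}
    (hψr : ∀ x ∈ Q, deriv ψ x = r) {μ : ℂ} {v : ℂ → ℂ}
    (hv : ∀ x ∈ Q, transfer f c v x = μ * v x) (hne : ∃ x ∈ Q, v x ≠ 0) : ‖r * μ‖ ≤ 1 := by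
  obtain ⟨r₀, hr₀, hmot⟩ := exists_motion_of_velocity Q v
  obtain ⟨ε, hε, -, H, hH0, hHm, hHl, M, hM, hbd⟩ :=
    hf.exists_twisted_lifts hQ hψ hinj hψQ hψV hr₀ hmot
  -- Each step applies the transfer operator to the velocity and then multiplies it by `ψ' = r`.
  have hder : ∀ k, ∀ x ∈ Q, deriv (fun t => H k t x) 0 = (r * μ) ^ k * v x := by
    intro k
    induction k with
    | zero =>
      intro x _
      rw [hH0]
      have h1 : HasDerivAt (fun t : ℂ => x + t * v x) (1 * v x) 0 :=
        ((hasDerivAt_id (0 : ℂ)).mul_const (v x)).const_add x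
      rw [h1.deriv]; ring
    | succ k ih =>
      intro x hx
      obtain ⟨h', h1, h2, h3⟩ := hHl k
      have h4 := hf.deriv_motionLift hQ (ball_mem_nhds 0 hε) (hHm k) h1 h2 hx
      have h5 : DifferentiableAt ℂ (fun t => h' t x) 0 :=
        (h1.holomorphic x hx).differentiableAt (ball_mem_nhds 0 hε)
      have h6 : HasDerivAt (fun t => ψ (h' t x)) (r * deriv (fun t => h' t x) 0) 0 := by
        have : HasDerivAt ψ r (h' 0 x) := by
          rw [h1.at_zero x hx, ← hψr x hx]; exact (hψ x).hasDerivAt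
        exact HasDerivAt.comp (𝕜 := ℂ) 0 this h5.hasDerivAt
      rw [h3, h6.deriv, h4, hQ.transfer_congr ih x hx]
      have : (fun x => (r * μ) ^ k * v x) = ((r * μ) ^ k) • v := rfl
      rw [this, map_smul, Pi.smul_apply, smul_eq_mul, hv x hx]
      ring
  obtain ⟨x, hx, hvx⟩ := hne
  by_contra! hlt
  -- Cauchy's estimate on the circle of radius `ε / 2`, with the bound `M` independent of `k`.
  have hbound : ∀ k, ‖r * μ‖ ^ k ≤ M / (ε / 2) / ‖v x‖ := by
    intro k
    have h1 : ‖deriv (fun t => H k t x) 0‖ ≤ M / (ε / 2) := by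
      have hsub : closedBall (0 : ℂ) (ε / 2) ⊆ ball 0 ε := closedBall_subset_ball (by linarith)
      refine Complex.norm_deriv_le_of_forall_mem_sphere_norm_le (by positivity) ?_
        fun z hz => hbd k x hx z (hsub (sphere_subset_closedBall hz))
      refine DifferentiableOn.diffContOnCl ?_
      exact ((hHm k).holomorphic x hx).mono (closure_ball_subset_closedBall.trans hsub)
    rw [hder k x hx, norm_mul, norm_pow] at h1
    rwa [le_div_iff₀ (norm_pos_iff.2 hvx)]
  obtain ⟨k, hk⟩ := (tendsto_pow_atTop_atTop_of_one_lt hlt).eventually_gt_atTop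
    (M / (ε / 2) / ‖v x‖) |>.exists
  exact absurd (hbound k) (not_le.2 hk)

/-- The untwisted case `ψ = id`: differences of points of `insert 0 U` lie in the open disc of
radius `diam U`, hence in `V`. -/
theorem norm_eigenvalue_le_one (hf : IsClassF f U V) (hQ : IsInvariantSet f U c Q) {μ : ℂ}
    {v : ℂ → ℂ} (hv : ∀ x ∈ Q, transfer f c v x = μ * v x) (hne : ∃ x ∈ Q, v x ≠ 0) :
    ‖μ‖ ≤ 1 := by
  have := hf.norm_mul_eigenvalue_le_one hQ (ψ := id) (r := 1) differentiable_id (injOn_id _)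
    (fun _ _ => rfl) (fun a ha b hb => hf.ball_subset_target (by
      simpa using hf.dist_lt_diam ha hb)) (fun x _ => by simp) hv hne
  simpa using this

end IsClassF

/-! ### Robust separation: the twist that makes the spectral bound strict -/

/-- A polynomial vanishing on a finite set with derivative `1` there. -/
theorem exists_polynomial_eval_zero_deriv_one (Q : Finset ℂ) :
    ∃ p : Polynomial ℂ, ∀ x ∈ Q, p.eval x = 0 ∧ p.derivative.eval x = 1 := by
  classical
  -- The nodal weight is the reciprocal of the derivative of the nodal polynomial, so interpolating
  -- the weights normalizes the derivative of the product to `1`.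
  refine ⟨Lagrange.nodal Q id * Lagrange.interpolate Q id (fun x => Lagrange.nodalWeight Q id x),
    fun x hx => ?_⟩
  have h0 : Polynomial.eval x (Lagrange.nodal Q id) = 0 :=
    Lagrange.eval_nodal_at_node (v := id) hx
  have h1 : Polynomial.eval x
      (Lagrange.interpolate Q id (fun x => Lagrange.nodalWeight Q id x)) =
      Lagrange.nodalWeight Q id x :=
    Lagrange.eval_interpolate_at_node (v := id) _ (injOn_id _) hx
  have h2 := Lagrange.nodalWeight_eq_eval_derivative_nodal (v := id) hx
  have h3 := Lagrange.nodalWeight_ne_zero (v := id) (injOn_id _) hx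
  refine ⟨by rw [Polynomial.eval_mul, h0, zero_mul], ?_⟩
  rw [Polynomial.derivative_mul, Polynomial.eval_add, Polynomial.eval_mul, Polynomial.eval_mul,
    h0, h1, zero_mul, add_zero, h2]
  rw [h2] at h3
  exact mul_inv_cancel₀ (fun h => h3 (inv_eq_zero.2 h))

namespace IsClassF

variable {f : ℂ → ℂ} {U V : Set ℂ} {c : ℂ} {Q : Finset ℂ}

/-- Under robust separation the eigenvalues of the transfer operator stay away from the unit
circle. -/
theorem norm_eigenvalue_lt_one (hf : IsClassF f U V) (hQ : IsInvariantSet f U c Q)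
    (hV : closedBall (0 : ℂ) (Metric.diam U) ⊆ V) {μ : ℂ} {v : ℂ → ℂ}
    (hv : ∀ x ∈ Q, transfer f c v x = μ * v x) (hne : ∃ x ∈ Q, v x ≠ 0) : ‖μ‖ < 1 := by
  set d := Metric.diam U with hd
  have hd0 : 0 < d := hf.diam_pos
  obtain ⟨δ, hδ, hthick⟩ :=
    (isCompact_closedBall (0 : ℂ) d).exists_thickening_subset_open hf.isOpen_target hV
  rw [thickening_closedBall hδ hd0.le] at hthick
  obtain ⟨p, hp⟩ := exists_polynomial_eval_zero_deriv_one Q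
  obtain ⟨L, hL⟩ := (isCompact_closedBall (0 : ℂ) d).exists_bound_of_continuousOn
    (f := fun z => p.derivative.eval z) (Polynomial.continuous _).continuousOn
  have hL0 : 0 ≤ L := (norm_nonneg _).trans (hL 0 (mem_closedBall_self hd0.le))
  have hlip : ∀ a ∈ insert 0 U, ∀ b ∈ insert 0 U, ‖p.eval a - p.eval b‖ ≤ L * ‖a - b‖ := by
    intro a ha b hb
    have hmem : ∀ a ∈ insert 0 U, a ∈ closedBall (0 : ℂ) d := fun a ha => by
      simpa using (hf.dist_lt_diam ha (mem_insert 0 U)).le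
    exact (convex_closedBall (0 : ℂ) d).norm_image_sub_le_of_norm_hasDerivWithin_le
      (f := fun z => p.eval z) (fun x _ => (p.hasDerivAt x).hasDerivWithinAt) hL
      (hmem b hb) (hmem a ha)
  -- Both terms of the minimum are needed: `s * L < 1` makes `z + s p(z)` injective on `insert 0 U`,
  -- and `s * L * d ≤ δ` keeps its differences in the `δ`-neighbourhood of the closed disc. The
  -- denominator `L + 1` avoids dividing by `L = 0`.
  set s : ℝ := min (1 / 2) (δ / d) / (L + 1) with hs
  have hspos : 0 < s := by positivity
  have hsL : s * L < 1 := by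
    have : s * L ≤ s * (L + 1) := by gcongr; linarith
    rw [hs, div_mul_cancel₀ _ (by positivity)] at this
    have := min_le_left (1 / 2 : ℝ) (δ / d)
    linarith
  have hsd : s * L * d ≤ δ := by
    have : s * L ≤ s * (L + 1) := by gcongr; linarith
    rw [hs, div_mul_cancel₀ _ (by positivity)] at this
    have h2 := this.trans (min_le_right (1 / 2 : ℝ) (δ / d))
    rwa [le_div_iff₀ hd0] at h2
  have hdψ : ∀ z, HasDerivAt (fun z : ℂ => z + s * p.eval z) (1 + s * p.derivative.eval z) z :=
    fun z => (hasDerivAt_id z).add ((p.hasDerivAt z).const_mul (s : ℂ))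
  have hsub : ∀ a ∈ insert 0 U, ∀ b ∈ insert 0 U,
      ‖(s : ℂ) * (p.eval a - p.eval b)‖ ≤ s * L * ‖a - b‖ := by
    intro a ha b hb
    rw [norm_mul, Complex.norm_real, Real.norm_of_nonneg hspos.le, mul_assoc]
    gcongr
    exact hlip a ha b hb
  have key := hf.norm_mul_eigenvalue_le_one hQ (ψ := fun z => z + s * p.eval z) (r := 1 + s)
    (fun z => (hdψ z).differentiableAt) ?_ ?_ ?_ ?_ hv hne
  · have h1 : ‖(1 + s : ℂ)‖ = 1 + s := by
      rw [← Complex.ofReal_one, ← Complex.ofReal_add, Complex.norm_real,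
        Real.norm_of_nonneg (by positivity)]
    rw [norm_mul, h1] at key
    nlinarith [norm_nonneg μ]
  · intro a ha b hb hab
    simp only at hab
    by_contra hne
    have h1 : a - b = -(s * (p.eval a - p.eval b)) := by linear_combination hab
    have h2 := hsub a ha b hb
    rw [← norm_neg, ← h1] at h2
    have : 0 < ‖a - b‖ := norm_pos_iff.2 (sub_ne_zero.2 hne)
    nlinarith
  · intro x hx
    simp [(hp x hx).1]
  · intro a ha b hb
    apply hthick
    rw [mem_ball_zero_iff]
    have h1 : a + s * p.eval a - (b + s * p.eval b) = (a - b) + s * (p.eval a - p.eval b) := by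
      ring
    simp only [h1]
    have h2 := norm_add_le (a - b) (s * (p.eval a - p.eval b))
    have h3 := hsub a ha b hb
    have h4 := hf.dist_lt_diam ha hb
    have h5 : s * L * ‖a - b‖ ≤ s * L * d := by gcongr
    linarith
  · intro x hx
    rw [(hdψ x).deriv, (hp x hx).2, mul_one]

/-- Infinitesimal form of the lifting relation to order `m`. -/
theorem isLittleO_of_comp (hf : IsClassF f U V) {x : ℂ} (hx : x ∈ U \ {0}) {a b : ℂ → ℂ}
    (ha : ContinuousAt a 0) (hb : ContinuousAt b 0) (ha0 : a 0 = x) (hb0 : b 0 = x) {m : ℕ} {ρ : ℂ}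
    (h : (fun t => f (a t) - f (b t) - t ^ m * ρ) =o[𝓝 0] fun t => t ^ m) :
    (fun t => a t - b t - t ^ m * (ρ / deriv f x)) =o[𝓝 0] fun t => t ^ m := by
  have hd := hf.hasStrictDerivAt hx.1
  have hd0 := hf.deriv_ne_zero hx
  have hleft := HasStrictDerivAt.eventually_left_inverse hd hd0
  have hinv := hd.to_localInverse hd0
  set g := hd.localInverse f (deriv f x) x hd0 with hg
  have hcf : ContinuousAt f x := hd.hasDerivAt.continuousAt
  have hfa : Tendsto (fun t => f (a t)) (𝓝 0) (𝓝 (f x)) :=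
    hcf.tendsto.comp (ha0 ▸ ha.tendsto)
  have hfb : Tendsto (fun t => f (b t)) (𝓝 0) (𝓝 (f x)) :=
    hcf.tendsto.comp (hb0 ▸ hb.tendsto)
  have hO : (fun t => f (a t) - f (b t)) =O[𝓝 0] fun t => t ^ m := by
    have h1 : (fun t : ℂ => t ^ m * ρ) =O[𝓝 0] fun t => t ^ m := by
      simpa [mul_comm] using Asymptotics.isBigO_const_mul_self ρ (fun t : ℂ => t ^ m) (𝓝 0)
    simpa using h.isBigO.add h1
  -- Strict differentiability of the local inverse controls `a - b` by `f ∘ a - f ∘ b` although both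
  -- arguments vary.
  have h1 := hinv.isLittleO.comp_tendsto (hfa.prodMk_nhds hfb)
  have h2 : (fun t => a t - b t - (f (a t) - f (b t)) * (deriv f x)⁻¹) =o[𝓝 0]
      fun t => t ^ m := by
    refine Asymptotics.IsLittleO.congr' (h1.trans_isBigO hO) ?_ EventuallyEq.rfl
    filter_upwards [(ha0 ▸ ha.tendsto : Tendsto a _ (𝓝 x)).eventually hleft,
      (hb0 ▸ hb.tendsto : Tendsto b _ (𝓝 x)).eventually hleft] with t h3 h4
    simp only [Function.comp, ContinuousLinearMap.toSpanSingleton_apply, smul_eq_mul]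
    rw [h3, h4]
  have h3 := h2.add (h.const_mul_left (deriv f x)⁻¹)
  refine h3.congr (fun t => ?_) fun t => rfl
  rw [div_eq_mul_inv]
  ring

/-- If the first lift of a motion differs from the motion by `t ^ m * δ` to leading order, then
the sums `∑ j < k, A ^ j δ` stay bounded. -/
theorem exists_bound_sum_transfer (hf : IsClassF f U V) (hQ : IsInvariantSet f U c Q) {r : ℝ}
    (hr : 0 < r) {h : ℂ → ℂ → ℂ} (hh : IsHolomorphicMotion (Q : Set ℂ) (ball 0 r) h)
    (h0 : ∀ᶠ t in 𝓝 0, 0 ∈ Q → h t 0 = 0) {m : ℕ} (hm : 1 ≤ m) {ρ : ℂ → ℂ}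
    (hρ : ∀ x ∈ Q, x ≠ 0 → (fun t => h t (f x + c) - h t c - f (h t x) - t ^ m * ρ x) =o[𝓝 0]
      fun t => t ^ m) :
    ∃ C : ℝ, ∀ k, ∀ x ∈ Q, ‖∑ j ∈ Finset.range k,
      ((transfer f c ^ j) (fun x => if x = 0 then 0 else ρ x / deriv f x)) x‖ ≤ C := by
  obtain ⟨ε, hε, -, H, hH0, hHm, hHl, M, hM, hbd⟩ :=
    hf.exists_twisted_lifts hQ (ψ := id) differentiable_id (injOn_id _) (fun _ _ => rfl)
      (fun a ha b hb => hf.ball_subset_target (by simpa using hf.dist_lt_diam ha hb)) hr hh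
  have hHl' : ∀ k, IsMotionLift f U c Q (H k) (H (k + 1)) (ball 0 ε) := fun k => by
    obtain ⟨h', -, h2, h3⟩ := hHl k
    rw [h3]; exact h2
  set δ : ℂ → ℂ := fun x => if x = 0 then 0 else ρ x / deriv f x with hδ
  have hball := ball_mem_nhds (0 : ℂ) hε
  have hcont : ∀ k, ∀ x ∈ Q, ContinuousAt (fun t => H k t x) 0 := fun k x hx =>
    ((hHm k).holomorphic x hx).continuousOn.continuousAt hball
  -- Two consecutive lifts differ by the image under `transfer` of the previous difference, to order
  -- `m`.
  have hstep : ∀ k, ∀ x ∈ Q, (fun t => H (k + 1) t x - H k t x -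
      t ^ m * (transfer f c ^ k) δ x) =o[𝓝 0] fun t => t ^ m := by
    intro k
    induction k with
    | zero =>
      intro x hx
      by_cases hx0 : x = 0
      · subst hx0
        refine (Asymptotics.isLittleO_zero _ _).congr' ?_ EventuallyEq.rfl
        filter_upwards [hball, h0] with t ht ht0
        simp [(hHl' 0 t ht).1 hx, hH0, ht0 hx, hδ]
      · have := hf.isLittleO_of_comp (x := x) ⟨hQ.mem_source x hx hx0, hx0⟩
          (hcont 1 x hx) (hcont 0 x hx) ((hHm 1).at_zero x hx) ((hHm 0).at_zero x hx)
          (m := m) (ρ := ρ x) ((hρ x hx hx0).congr' (by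
            filter_upwards [hball] with t ht
            rw [((hHl' 0 t ht).2 x hx hx0).2, hH0]) EventuallyEq.rfl)
        simpa [hδ, hx0] using this
    | succ k ih =>
      intro x hx
      by_cases hx0 : x = 0
      · subst hx0
        refine (Asymptotics.isLittleO_zero _ _).congr' ?_ EventuallyEq.rfl
        filter_upwards [hball] with t ht
        rw [(hHl' k t ht).1 hx, (hHl' (k + 1) t ht).1 hx, pow_succ', Module.End.mul_apply,
          transfer_zero]
        simp
      · have := hf.isLittleO_of_comp (x := x) ⟨hQ.mem_source x hx hx0, hx0⟩
          (hcont (k + 1 + 1) x hx) (hcont (k + 1) x hx) ((hHm _).at_zero x hx)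
          ((hHm _).at_zero x hx)
          (m := m) (ρ := (transfer f c ^ k) δ (f x + c) - (transfer f c ^ k) δ c)
          (((ih _ (hQ.map_mem x hx hx0)).sub (ih _ hQ.base_mem)).congr' (by
            filter_upwards [hball] with t ht
            rw [((hHl' (k + 1) t ht).2 x hx hx0).2, ((hHl' k t ht).2 x hx hx0).2]
            ring) EventuallyEq.rfl)
        rw [pow_succ', Module.End.mul_apply, transfer_apply _ _ _ hx0]
        exact this
  have hsum : ∀ k, ∀ x ∈ Q, (fun t => H k t x - H 0 t x -
      t ^ m * ∑ j ∈ Finset.range k, (transfer f c ^ j) δ x) =o[𝓝 0] fun t => t ^ m := by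
    intro k x hx
    induction k with
    | zero => simp
    | succ k ih =>
      refine (ih.add (hstep k x hx)).congr (fun t => ?_) fun t => rfl
      rw [Finset.sum_range_succ]
      ring
  refine ⟨2 * M / ε ^ m, fun k x hx => ?_⟩
  set S := ∑ j ∈ Finset.range k, (transfer f c ^ j) δ x with hS
  set u : ℂ → ℂ := fun t => H k t x - H 0 t x with hu
  have hu0 : u 0 = 0 := by simp [hu, (hHm _).at_zero x hx]
  obtain ⟨n, rfl⟩ := Nat.exists_eq_add_of_le' hm
  have huO : (fun t => u t - u 0) =o[𝓝 0] fun w => ‖w - 0‖ ^ n := by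
    have h1 : (fun t : ℂ => t ^ (n + 1)) =o[𝓝 0] fun t => t ^ n := by
      have := Asymptotics.isLittleO_pow_pow (𝕜 := ℂ) (lt_add_one n)
      exact this
    have h2 : (fun t : ℂ => t ^ (n + 1) * S) =O[𝓝 0] fun t => t ^ (n + 1) := by
      simpa [mul_comm] using Asymptotics.isBigO_const_mul_self S (fun t : ℂ => t ^ (n + 1)) (𝓝 0)
    have h3 := ((hsum k x hx).isBigO.add h2).trans_isLittleO h1
    refine h3.norm_right.congr (fun t => ?_) fun t => by simp
    rw [hu0, sub_zero, ← hS, sub_add_cancel]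
  -- The difference `u` is bounded by `2 * M` and vanishes to order `m = n + 1` at `0`, so the
  -- higher-order Schwarz lemma bounds its coefficient of `t ^ m`, which is `S`, by `2 * M / ε ^ m`.
  have hSchwarz : ∀ t ∈ ball (0 : ℂ) ε, ‖u t‖ ≤ 2 * M * (‖t‖ / ε) ^ (n + 1) := by
    intro t ht
    have := Complex.dist_le_mul_div_pow_of_mapsTo_ball_of_isLittleO (f := u) (c := 0) (z := t)
      (R₁ := ε) (R₂ := 2 * M) (n := n)
      (((hHm k).holomorphic x hx).sub ((hHm 0).holomorphic x hx))
      (fun s hs => by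
        rw [hu0, mem_closedBall_zero_iff]
        have h1 := norm_sub_le (H k s x) (H 0 s x)
        have h2 := hbd k x hx s hs
        have h3 := hbd 0 x hx s hs
        simp only [hu]; linarith) huO ht
    simpa [hu0] using this
  have hlim : Tendsto (fun t : ℂ => t ^ (n + 1) * S / t ^ (n + 1) + (u t - t ^ (n + 1) * S) /
      t ^ (n + 1)) (𝓝[≠] 0) (𝓝 (S + 0)) := by
    refine Tendsto.add ?_ ?_
    · refine tendsto_const_nhds.congr' ?_
      filter_upwards [self_mem_nhdsWithin] with t ht
      have : t ^ (n + 1) ≠ 0 := pow_ne_zero _ ht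
      field_simp
    · exact (hsum k x hx).tendsto_div_nhds_zero.mono_left nhdsWithin_le_nhds
  rw [add_zero] at hlim
  refine le_of_tendsto hlim.norm ?_
  filter_upwards [self_mem_nhdsWithin, nhdsWithin_le_nhds hball] with t ht htε
  have h1 : t ^ (n + 1) * S / t ^ (n + 1) + (u t - t ^ (n + 1) * S) / t ^ (n + 1) =
      u t / t ^ (n + 1) := by ring
  have htpos : 0 < ‖t‖ := norm_pos_iff.2 ht
  rw [h1, norm_div, norm_pow, div_le_iff₀ (by positivity)]
  have h2 := hSchwarz t htε
  rw [div_pow] at h2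
  calc ‖u t‖ ≤ _ := h2
    _ = _ := by ring

/-- If a motion satisfies the lifting relation at all points but `y`, and an invariant functional
detects `y`, then it satisfies the lifting relation at `y`, too. -/
theorem eventually_relation (hf : IsClassF f U V) (hQ : IsInvariantSet f U c Q) {r : ℝ}
    (hr : 0 < r) {h : ℂ → ℂ → ℂ} (hh : IsHolomorphicMotion (Q : Set ℂ) (ball 0 r) h)
    (h0 : ∀ᶠ t in 𝓝 0, 0 ∈ Q → h t 0 = 0) {y : ℂ} (hy : y ∈ Q) (hy0 : y ≠ 0)
    (hrel : ∀ x ∈ Q, x ≠ 0 → x ≠ y → ∀ᶠ t in 𝓝 0, h t (f x + c) - h t c = f (h t x))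
    (S : Submodule ℂ (ℂ → ℂ)) (hyS : Pi.single y 1 ∈ S) (ℓ : ℂ → ℂ) (hℓy : ℓ y ≠ 0)
    (hS : ∀ v ∈ S, transfer f c v ∈ S ∧ ∑ x ∈ Q, ℓ x * transfer f c v x = ∑ x ∈ Q, ℓ x * v x) :
    ∀ᶠ t in 𝓝 0, h t (f y + c) - h t c = f (h t y) := by
  have hball := ball_mem_nhds (0 : ℂ) hr
  have hyU := hQ.mem_source y hy hy0
  have han : ∀ x ∈ Q, AnalyticAt ℂ (fun t => h t x) 0 := fun x hx =>
    (hh.holomorphic x hx).analyticAt hball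
  have hRan : AnalyticAt ℂ (fun t => h t (f y + c) - h t c - f (h t y)) 0 := by
    refine ((han _ (hQ.map_mem y hy hy0)).sub (han _ hQ.base_mem)).sub ?_
    refine AnalyticAt.fun_comp (g := f) ?_ (han y hy)
    rw [hh.at_zero y hy]
    exact hf.analyticAt hyU
  by_contra hcon
  have hnz : ¬ ∀ᶠ t in 𝓝 0, h t (f y + c) - h t c - f (h t y) = 0 := fun hc =>
    hcon (hc.mono fun t ht => sub_eq_zero.1 ht)
  -- If the relation fails, its defect has an exact order `m` and a nonzero leading coefficient; `m
  -- ≥ 1` because the relation holds at `t = 0`.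
  obtain ⟨m, G, hG, hG0, hGe⟩ := hRan.exists_eventuallyEq_pow_smul_nonzero_iff.2 hnz
  have hm : 1 ≤ m := by
    rcases Nat.eq_zero_or_pos m with rfl | hm
    · exfalso
      have h1 := hGe.self_of_nhds
      simp only [sub_zero, pow_zero, one_smul, hh.at_zero _ (hQ.map_mem y hy hy0),
        hh.at_zero _ hQ.base_mem, hh.at_zero _ hy] at h1
      exact hG0 (by rw [← h1]; ring)
    · exact hm
  set κ := G 0 with hκ
  have hRo : (fun t => h t (f y + c) - h t c - f (h t y) - t ^ m * κ) =o[𝓝 0]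
      fun t => t ^ m := by
    have h1 : (fun t => G t - κ) =o[𝓝 0] fun _ => (1 : ℂ) := by
      rw [Asymptotics.isLittleO_one_iff]
      have := hG.continuousAt.tendsto.sub_const κ
      simpa [hκ] using this
    have h2 := (Asymptotics.isBigO_refl (fun t : ℂ => t ^ m) (𝓝 0)).mul_isLittleO h1
    refine h2.congr' ?_ (by simp)
    filter_upwards [hGe] with t ht
    rw [ht]
    simp only [sub_zero, smul_eq_mul]
    ring
  classical
  obtain ⟨C, hC⟩ := hf.exists_bound_sum_transfer hQ hr hh h0 hm (ρ := Pi.single y κ) (by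
    intro x hx hx0
    by_cases hxy : x = y
    · subst hxy; simpa using hRo
    · refine (Asymptotics.isLittleO_zero _ _).congr' ?_ EventuallyEq.rfl
      filter_upwards [hrel x hx hx0 hxy] with t ht
      simp [hxy, ht])
  set δ : ℂ → ℂ := fun x => if x = 0 then 0 else (Pi.single y κ : ℂ → ℂ) x / deriv f x with hδ
  have hδ' : δ = (κ / deriv f y) • (Pi.single y 1 : ℂ → ℂ) := by
    ext x
    by_cases hxy : x = y
    · subst hxy; simp [hδ, hy0]
    · simp [hδ, hxy]
  have hδS : δ ∈ S := hδ' ▸ S.smul_mem _ hyS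
  have hinv : ∀ j, (transfer f c ^ j) δ ∈ S ∧
      ∑ x ∈ Q, ℓ x * (transfer f c ^ j) δ x = ∑ x ∈ Q, ℓ x * δ x := by
    intro j
    induction j with
    | zero => exact ⟨hδS, rfl⟩
    | succ j ih =>
      rw [pow_succ', Module.End.mul_apply]
      exact ⟨(hS _ ih.1).1, (hS _ ih.1).2.trans ih.2⟩
  have hval : ∑ x ∈ Q, ℓ x * δ x = ℓ y * (κ / deriv f y) := by
    rw [Finset.sum_eq_single y]
    · rw [hδ']; simp
    · intro x _ hxy
      rw [hδ']; simp [hxy]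
    · exact fun h => (h hy).elim
  have hvne : ℓ y * (κ / deriv f y) ≠ 0 :=
    mul_ne_zero hℓy (div_ne_zero hG0 (hf.deriv_ne_zero ⟨hyU, hy0⟩))
  -- All terms of the sum have the same `ℓ`-value, so `ℓ` of the sum grows linearly in `k`, against
  -- the uniform bound `C`.
  have hbound : ∀ k : ℕ, k * ‖ℓ y * (κ / deriv f y)‖ ≤ ∑ x ∈ Q, ‖ℓ x‖ * C := by
    intro k
    have h1 : ∑ x ∈ Q, ℓ x * ∑ j ∈ Finset.range k, (transfer f c ^ j) δ x =
        k * (ℓ y * (κ / deriv f y)) := by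
      simp_rw [Finset.mul_sum]
      rw [Finset.sum_comm, Finset.sum_congr rfl fun j _ => (hinv j).2.trans hval]
      simp
    have h2 : ‖(k : ℂ) * (ℓ y * (κ / deriv f y))‖ = k * ‖ℓ y * (κ / deriv f y)‖ := by
      rw [norm_mul, Complex.norm_natCast]
    rw [← h2, ← h1]
    refine (norm_sum_le _ _).trans (Finset.sum_le_sum fun x hx => ?_)
    rw [norm_mul]
    gcongr
    exact hC k x hx
  obtain ⟨k, hk⟩ := exists_nat_gt ((∑ x ∈ Q, ‖ℓ x‖ * C) / ‖ℓ y * (κ / deriv f y)‖)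
  rw [div_lt_iff₀ (norm_pos_iff.2 hvne)] at hk
  exact absurd (hbound k) (not_le.2 hk)

end IsClassF

/-! ### Two function-theoretic tools: a Harnack-type estimate and a Radó-type theorem -/

/-- A zero-free bounded holomorphic function on a disc that is small at the centre is small on a
smaller concentric disc. -/
theorem norm_pow_three_le_of_ne_zero {g : ℂ → ℂ} {u : ℂ} {R M : ℝ} (hR : 0 < R)
    (hg : DifferentiableOn ℂ g (ball u R)) (hg0 : ∀ z ∈ ball u R, g z ≠ 0)
    (hM : ∀ z ∈ ball u R, ‖g z‖ ≤ M) (hu : ‖g u‖ < M) {z : ℂ} (hz : ‖z - u‖ ≤ R / 4) :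
    ‖g z‖ ^ 3 ≤ ‖g u‖ * M ^ 2 := by
  have hu0 : u ∈ ball u R := mem_ball_self hR
  have hgu : 0 < ‖g u‖ := norm_pos_iff.2 (hg0 u hu0)
  have hM0 : 0 < M := hgu.trans hu
  have hlog : DifferentiableOn ℂ (fun z => deriv g z / g z) (ball u R) :=
    (hg.deriv isOpen_ball).div hg hg0
  -- A primitive `q` of the logarithmic derivative serves as a logarithm of `g`, up to a constant.
  obtain ⟨q, hq⟩ := hlog.isExactOn_ball
  have hconst : ∀ z ∈ ball u R, g z * Complex.exp (-q z) = g u * Complex.exp (-q u) := by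
    intro z hz
    refine (convex_ball u R).is_const_of_fderivWithin_eq_zero (𝕜 := ℂ)
      (f := fun z => g z * Complex.exp (-q z)) ?_ ?_ hz hu0
    · exact hg.mul (fun y hy => ((hq y hy).differentiableAt.neg.cexp).differentiableWithinAt)
    · intro y hy
      rw [fderivWithin_of_isOpen isOpen_ball hy]
      have h1 : HasDerivAt g (deriv g y) y :=
        (hg.differentiableAt (isOpen_ball.mem_nhds hy)).hasDerivAt
      have h2 := h1.mul (hq y hy).fun_neg.cexp
      have h3 : deriv g y * Complex.exp (-q y) +
          g y * (Complex.exp (-q y) * -(deriv g y / g y)) = 0 := by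
        have := hg0 y hy
        field_simp
        ring
      rw [h3] at h2
      have h4 : HasDerivAt (fun z => g z * Complex.exp (-q z)) 0 y := h2
      rw [h4.hasFDerivAt.fderiv]
      simp
  have hexp : ∀ z ∈ ball u R, g z = g u * Complex.exp (q z - q u) := by
    intro z hz
    have h1 := hconst z hz
    rw [Complex.exp_neg, Complex.exp_neg] at h1
    have h2 := Complex.exp_ne_zero (q z)
    have h3 := Complex.exp_ne_zero (q u)
    rw [Complex.exp_sub]
    field_simp at h1 ⊢
    linear_combination h1
  set T := Real.log (M / ‖g u‖) with hT
  have hT0 : 0 < T := Real.log_pos (by rwa [one_lt_div hgu])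
  have hsub : ∀ y ∈ ball (0 : ℂ) R, u + y ∈ ball u R := fun y hy => by simpa using hy
  have hre : ∀ y ∈ ball (0 : ℂ) R, (q (u + y) - q u).re ≤ T := by
    intro y hy
    have h1 := hM _ (hsub y hy)
    rw [hexp _ (hsub y hy), norm_mul, Complex.norm_exp] at h1
    rw [hT, Real.le_log_iff_exp_le (by positivity), le_div_iff₀ hgu, mul_comm]
    exact h1
  have hzb : z - u ∈ ball (0 : ℂ) R := by
    rw [mem_ball_zero_iff]; linarith
  have hBC := Complex.borelCaratheodory_zero (f := fun y => q (u + y) - q u) (M := T) (R := R)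
    (z := z - u) hT0 (fun y hy => by
      have := (hq _ (hsub y hy)).differentiableAt
      exact ((this.comp y (by fun_prop : DifferentiableAt ℂ (fun y => u + y) y)).sub_const
        _).differentiableWithinAt) (fun y hy => hre y hy) hR hzb (by simp)
  simp only [add_sub_cancel] at hBC
  -- The Borel–Carathéodory factor `2 r / (R - r)` is at most `2 / 3` for `r ≤ R / 4`; this is where
  -- the cube comes from.
  have hBC2 : ‖q z - q u‖ ≤ 2 * T / 3 := by
    refine hBC.trans ?_
    rw [div_le_iff₀ (by linarith)]
    nlinarith [norm_nonneg (z - u)]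
  have h1 : (q z - q u).re ≤ 2 * T / 3 := (Complex.re_le_norm _).trans hBC2
  have hzU : z ∈ ball u R := by
    rw [mem_ball, dist_eq_norm]; linarith
  rw [hexp z hzU, norm_mul, Complex.norm_exp, mul_pow, ← Real.exp_nat_mul]
  have h2 : Real.exp (((3 : ℕ) : ℝ) * (q z - q u).re) ≤ (M / ‖g u‖) ^ 2 := by
    have h3 : (M / ‖g u‖) ^ 2 = Real.exp (((2 : ℕ) : ℝ) * T) := by
      rw [Real.exp_nat_mul, hT, Real.exp_log (by positivity)]
    rw [h3]
    apply Real.exp_le_exp.2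
    push_cast
    linarith
  calc ‖g u‖ ^ 3 * Real.exp (((3 : ℕ) : ℝ) * (q z - q u).re)
      ≤ ‖g u‖ ^ 3 * (M / ‖g u‖) ^ 2 := by gcongr
    _ = ‖g u‖ * M ^ 2 := by field_simp

/-- A function that is continuous on a domain and holomorphic off its zero set cannot vanish on a
nonempty open set unless it vanishes identically. -/
theorem subset_closure_ne_zero {F : ℂ → ℂ} {Ω : Set ℂ} (hΩ : IsOpen Ω) (hconn : IsPreconnected Ω)
    (hF : ContinuousOn F Ω) (hd : ∀ z ∈ Ω, F z ≠ 0 → DifferentiableAt ℂ F z) {z₀ : ℂ}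
    (hz₀ : z₀ ∈ Ω) (hF0 : F z₀ ≠ 0) : Ω ⊆ closure {z ∈ Ω | F z ≠ 0} := by
  by_contra hcon
  obtain ⟨p, hp, hpc⟩ := not_subset.1 hcon
  set N : Set ℂ := {z | ∀ᶠ y in 𝓝 z, F y = 0} with hN
  have hNo : IsOpen N := isOpen_setOfPred_eventually_nhds
  have hpN : p ∈ N := by
    have h1 : (closure {z ∈ Ω | F z ≠ 0})ᶜ ∈ 𝓝 p := isClosed_closure.isOpen_compl.mem_nhds hpc
    filter_upwards [h1, hΩ.mem_nhds hp] with y hy hyΩ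
    by_contra hne
    exact hy (subset_closure ⟨hyΩ, hne⟩)
  suffices h : Ω ⊆ N from hF0 (h hz₀).self_of_nhds
  refine hconn.subset_of_closure_inter_subset hNo ⟨p, hp, hpN⟩ ?_
  rintro z ⟨hzc, hzΩ⟩
  obtain ⟨R, hR, hball⟩ := Metric.isOpen_iff.1 hΩ z hzΩ
  obtain ⟨p', hp', hpz⟩ := Metric.mem_closure_iff.1 hzc (R / 2) (by positivity)
  have hcl : closedBall p' (R / 2) ⊆ Ω := by
    intro y hy
    apply hball
    rw [mem_closedBall] at hy
    rw [mem_ball]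
    calc dist y z ≤ dist y p' + dist p' z := dist_triangle _ _ _
      _ < R / 2 + R / 2 := by rw [dist_comm p']; linarith
      _ = R := by ring
  obtain ⟨ε, hε, hεF⟩ := Metric.eventually_nhds_iff_ball.1 hp'
  have hR2 : 0 < R / 2 := by positivity
  have hFc : ContinuousOn F (closedBall p' (R / 2)) := hF.mono hcl
  obtain ⟨M, hM⟩ := (isCompact_closedBall p' (R / 2)).exists_bound_of_continuousOn hFc
  have hvanish : ∀ y ∈ ball p' (R / 2), F y = 0 := by
    intro y hy
    by_contra hne
    set W : Set ℂ := {x ∈ ball p' (R / 2) | F x ≠ 0} with hW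
    have hWsub : W ⊆ closedBall p' (R / 2) := fun x hx => ball_subset_closedBall hx.1
    have hWcl : closure W ⊆ closedBall p' (R / 2) := closure_minimal hWsub isClosed_closedBall
    have hWo : IsOpen W := by
      have : W = ball p' (R / 2) ∩ F ⁻¹' {0}ᶜ := by ext; simp [hW]
      rw [this]
      exact (hFc.mono ball_subset_closedBall).isOpen_inter_preimage isOpen_ball
        isOpen_compl_singleton
    have haway : ∀ x ∈ closure W, x - p' ≠ 0 := by
      intro x hx h0
      obtain ⟨x', hx', hxx⟩ := Metric.mem_closure_iff.1 hx ε hε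
      rw [sub_eq_zero.1 h0, dist_comm] at hxx
      exact hx'.2 (hεF x' hxx)
    -- At a frontier point of `W` either `F = 0` or the point lies on the circle of radius `R / 2`.
    -- As `F` vanishes near the centre `p'`, dividing by `(x - p') ^ k` is harmless on `W`; the
    -- maximum principle with `k → ∞` then kills `F` inside.
    have hfront : ∀ k : ℕ, ∀ x ∈ frontier W, ‖F x / (x - p') ^ k‖ ≤ M / (R / 2) ^ k := by
      intro k x hx
      have hxcl := hWcl hx.1
      have hM0 : 0 ≤ M := (norm_nonneg _).trans (hM x hxcl)
      by_cases hFx : F x = 0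
      · rw [hFx]; simp only [zero_div, norm_zero]; positivity
      · have : x ∉ ball p' (R / 2) := fun hb => hx.2 (by
          rw [hWo.interior_eq]; exact ⟨hb, hFx⟩)
        rw [mem_ball, not_lt, dist_eq_norm] at this
        rw [norm_div, norm_pow]
        gcongr
        exact hM x hxcl
    have hyW : y ∈ W := ⟨hy, hne⟩
    have hbound : ∀ k : ℕ, ‖F y‖ ≤ M * (‖y - p'‖ / (R / 2)) ^ k := by
      intro k
      have h1 := Complex.norm_le_of_forall_mem_frontier_norm_le
        (f := fun x => F x / (x - p') ^ k) (U := W)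
        (isBounded_closedBall.subset hWsub) ⟨fun x hx => ?_, ?_⟩ (hfront k) (subset_closure hyW)
      · have hpos : 0 < ‖y - p'‖ := norm_pos_iff.2 (haway y (subset_closure hyW))
        simp only [norm_div, norm_pow] at h1
        rw [div_le_iff₀ (by positivity)] at h1
        refine h1.trans (le_of_eq ?_)
        rw [div_pow _ (R / 2)]
        ring
      · refine DifferentiableAt.differentiableWithinAt ?_
        exact (hd x (hcl (hWsub hx)) hx.2).fun_div (by fun_prop)
          (pow_ne_zero _ (haway x (subset_closure hx)))
      · exact (hFc.mono hWcl).div (by fun_prop) fun x hx => pow_ne_zero _ (haway x hx)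
    have hlt : ‖y - p'‖ / (R / 2) < 1 := by
      rw [div_lt_one hR2, ← dist_eq_norm]; exact hy
    have hlim : Tendsto (fun k : ℕ => M * (‖y - p'‖ / (R / 2)) ^ k) atTop (𝓝 (M * 0)) :=
      (tendsto_pow_atTop_nhds_zero_of_lt_one (by positivity) hlt).const_mul M
    rw [mul_zero] at hlim
    exact hne (norm_le_zero_iff.1 (ge_of_tendsto' hlim hbound))
  have hzb : z ∈ ball p' (R / 2) := hpz
  filter_upwards [isOpen_ball.mem_nhds hzb] with y hy using hvanish y hy

/-! ### Parameter-dependent orbits and orbit relations -/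

/-- The iterates `z₀ = a`, `z_{i+1} = w + f(z_i)`, depending on a parameter. -/
def chain (f w a : ℂ → ℂ) : ℕ → ℂ → ℂ
  | 0 => a
  | i + 1 => fun ζ => w ζ + f (chain f w a i ζ)

/-- The parameters at which the first `n` iterates stay in `U ∖ {0}`. -/
def chainDomain (f : ℂ → ℂ) (U : Set ℂ) (w a : ℂ → ℂ) (Ω : Set ℂ) (n : ℕ) : Set ℂ :=
  {ζ ∈ Ω | ∀ i < n, chain f w a i ζ ∈ U \ {0}}

/-- The parameters near which the relation `z_n = s` holds. -/
def relationDomain (f : ℂ → ℂ) (U : Set ℂ) (w a : ℂ → ℂ) (Ω : Set ℂ) (n : ℕ) (s : ℂ → ℂ) :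
    Set ℂ :=
  {ζ ∈ chainDomain f U w a Ω n | ∀ᶠ ζ' in 𝓝 ζ, chain f w a n ζ' = s ζ'}

/-- No germ of an iterate of `z ↦ c + f z` along an orbit in `U ∖ {0}` is the identity. -/
def NoIdentityGerm (f : ℂ → ℂ) (U : Set ℂ) (c : ℂ) : Prop :=
  ∀ x : ℂ, ∀ p : ℕ, 1 ≤ p → (∀ i < p, (fun z => c + f z)^[i] x ∈ U \ {0}) →
    ¬ ∀ᶠ z in 𝓝 x, (fun z => c + f z)^[p] z = z

namespace IsClassF

variable {f : ℂ → ℂ} {U V : Set ℂ} {w a : ℂ → ℂ} {Ω : Set ℂ} {n : ℕ}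

theorem differentiableAt_chain (hf : IsClassF f U V) (hΩ : IsOpen Ω)
    (hw : DifferentiableOn ℂ w Ω) (ha : DifferentiableOn ℂ a Ω) {ζ : ℂ} (hζ : ζ ∈ Ω) {i : ℕ}
    (h : ∀ j < i, chain f w a j ζ ∈ U \ {0}) : DifferentiableAt ℂ (chain f w a i) ζ := by
  induction i with
  | zero => exact ha.differentiableAt (hΩ.mem_nhds hζ)
  | succ i ih =>
    refine (hw.differentiableAt (hΩ.mem_nhds hζ)).add ?_
    refine DifferentiableAt.comp (g := f) ζ ?_ (ih fun j hj => h j (by omega))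
    exact (hf.analyticAt (h i (by omega)).1).differentiableAt

theorem isOpen_chainDomain (hf : IsClassF f U V) (hΩ : IsOpen Ω)
    (hw : DifferentiableOn ℂ w Ω) (ha : DifferentiableOn ℂ a Ω) :
    IsOpen (chainDomain f U w a Ω n) := by
  refine isOpen_iff_mem_nhds.2 fun ζ hζ => ?_
  have h1 : ∀ᶠ ζ' in 𝓝 ζ, ∀ i ∈ Finset.range n, chain f w a i ζ' ∈ U \ {0} := by
    refine (Finset.eventually_all _).2 fun i hi => ?_
    have hin := Finset.mem_range.1 hi
    exact (hf.differentiableAt_chain hΩ hw ha hζ.1 fun j hj =>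
      hζ.2 j (hj.trans hin)).continuousAt.eventually_mem
        (hf.isOpen_diff.mem_nhds (hζ.2 i hin))
  filter_upwards [h1, hΩ.mem_nhds hζ.1] with ζ' h2 h3
  exact ⟨h3, fun i hi => h2 i (Finset.mem_range.2 hi)⟩

theorem differentiableOn_chain (hf : IsClassF f U V) (hΩ : IsOpen Ω)
    (hw : DifferentiableOn ℂ w Ω) (ha : DifferentiableOn ℂ a Ω) {i : ℕ} (hi : i ≤ n) :
    DifferentiableOn ℂ (chain f w a i) (chainDomain f U w a Ω n) := fun _ hζ =>
  (hf.differentiableAt_chain hΩ hw ha hζ.1 fun j hj =>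
    hζ.2 j (hj.trans_le hi)).differentiableWithinAt

/-- If the iterates have limits in `U ∖ {0}`, they are defined at the limit parameter. -/
theorem mem_chainDomain_of_tendsto (hf : IsClassF f U V) (hΩ : IsOpen Ω)
    (hw : DifferentiableOn ℂ w Ω) (ha : DifferentiableOn ℂ a Ω) {l : Filter ℂ} [l.NeBot] {ζ : ℂ}
    (hζ : ζ ∈ Ω) (hl : l ≤ 𝓝 ζ) {β : ℕ → ℂ}
    (hβ : ∀ i < n, Tendsto (chain f w a i) l (𝓝 (β i)) ∧ β i ∈ U \ {0}) :
    ζ ∈ chainDomain f U w a Ω n := by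
  refine ⟨hζ, fun i => ?_⟩
  induction i using Nat.strong_induction_on with
  | _ i ih =>
    intro hi
    have h1 := (hf.differentiableAt_chain hΩ hw ha hζ fun j hj =>
      ih j hj (hj.trans hi)).continuousAt
    rw [tendsto_nhds_unique (h1.tendsto.mono_left hl) (hβ i hi).1]
    exact (hβ i hi).2

/-- The possible targets of a relation: zero or an earlier iterate. -/
theorem analyticAt_target (hf : IsClassF f U V) (hΩ : IsOpen Ω)
    (hw : DifferentiableOn ℂ w Ω) (ha : DifferentiableOn ℂ a Ω) {s : ℂ → ℂ}
    (hs : (s = fun _ => 0) ∨ ∃ l < n, s = chain f w a l) {ζ : ℂ}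
    (hζ : ζ ∈ chainDomain f U w a Ω n) : AnalyticAt ℂ s ζ := by
  rcases hs with rfl | ⟨l, hl, rfl⟩
  · exact analyticAt_const
  · exact (hf.differentiableOn_chain hΩ hw ha hl.le).analyticAt
      ((hf.isOpen_chainDomain hΩ hw ha).mem_nhds hζ)

theorem isOpen_relationDomain (hf : IsClassF f U V) (hΩ : IsOpen Ω)
    (hw : DifferentiableOn ℂ w Ω) (ha : DifferentiableOn ℂ a Ω) {s : ℂ → ℂ} :
    IsOpen (relationDomain f U w a Ω n s) :=
  (hf.isOpen_chainDomain hΩ hw ha).inter isOpen_setOfPred_eventually_nhds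

/-- Identity theorem: at `ζ` both sides of the relation are analytic, and they agree at points
accumulating there. So the relation domain is relatively closed in the domain of the iterates. -/
theorem mem_relationDomain_of_mem_closure (hf : IsClassF f U V) (hΩ : IsOpen Ω)
    (hw : DifferentiableOn ℂ w Ω) (ha : DifferentiableOn ℂ a Ω) {s : ℂ → ℂ}
    (hs : (s = fun _ => 0) ∨ ∃ l < n, s = chain f w a l) {ζ : ℂ}
    (hζ : ζ ∈ chainDomain f U w a Ω n) (hcl : ζ ∈ closure (relationDomain f U w a Ω n s)) :
    ζ ∈ relationDomain f U w a Ω n s := by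
  refine ⟨hζ, ?_⟩
  have ho := hf.isOpen_chainDomain (n := n) hΩ hw ha
  have h1 : AnalyticAt ℂ (fun z => chain f w a n z - s z) ζ :=
    ((hf.differentiableOn_chain hΩ hw ha le_rfl).analyticAt (ho.mem_nhds hζ)).sub
      (hf.analyticAt_target hΩ hw ha hs hζ)
  by_cases hmem : ζ ∈ relationDomain f U w a Ω n s
  · exact hmem.2
  rcases h1.eventually_eq_zero_or_eventually_ne_zero with h2 | h2
  · exact h2.mono fun z hz => sub_eq_zero.1 hz
  · exfalso
    have h3 : ∃ᶠ z in 𝓝 ζ, z ∈ relationDomain f U w a Ω n s := mem_closure_iff_frequently.1 hcl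
    rw [eventually_nhdsWithin_iff] at h2
    obtain ⟨z, hz, hz2⟩ := (h3.and_eventually h2).exists
    exact hz2 (fun h => hmem (h ▸ hz)) (sub_eq_zero.2 hz.2.self_of_nhds)

end IsClassF

/-! ### Inverse branches along a limiting orbit -/

/-- Inverse branches of `f` near the points `α (i + 1) - ω`, for `i < n`. -/
structure BranchSystem (f : ℂ → ℂ) (U : Set ℂ) (n : ℕ) (α : ℕ → ℂ) (ω : ℂ) (ρ : ℝ)
    (φ : ℕ → ℂ → ℂ) : Prop where
  diff : ∀ i < n, DifferentiableOn ℂ (φ i) (ball (α (i + 1) - ω) (4 * ρ))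
  maps : ∀ i < n, MapsTo (φ i) (ball (α (i + 1) - ω) (4 * ρ)) (U \ {0})
  right_inv : ∀ i < n, ∀ u ∈ ball (α (i + 1) - ω) (4 * ρ), f (φ i u) = u

/-- The branches take values `t`-close to `α i` at points `t`-close to `α (i + 1) - ω`. -/
def BranchNear (n : ℕ) (α : ℕ → ℂ) (ω : ℂ) (t : ℝ) (φ : ℕ → ℂ → ℂ) : Prop :=
  ∀ i < n, ∃ u, ‖u - (α (i + 1) - ω)‖ ≤ t ∧ ‖φ i u - α i‖ ≤ t

namespace IsClassF

variable {f : ℂ → ℂ} {U V : Set ℂ} {n : ℕ} {α : ℕ → ℂ} {ω : ℂ} {ρ : ℝ} {φ : ℕ → ℂ → ℂ}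

theorem branch_lipschitz (hf : IsClassF f U V) (hρ : 0 < ρ) (hφ : BranchSystem f U n α ω ρ φ)
    {i : ℕ} (hi : i < n) {u v : ℂ} (hu : ‖u - (α (i + 1) - ω)‖ < ρ)
    (hv : ‖v - (α (i + 1) - ω)‖ < ρ) :
    ‖φ i u - φ i v‖ ≤ Metric.diam U / ρ * ‖u - v‖ := by
  set κ := α (i + 1) - ω
  refine (convex_ball κ ρ).norm_image_sub_le_of_norm_deriv_le (𝕜 := ℂ) (f := φ i)
    (fun x hx => (hφ.diff i hi).differentiableAt (isOpen_ball.mem_nhds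
      (ball_subset_ball (by linarith) hx))) (fun x hx => ?_) (mem_ball_iff_norm.2 hv)
    (mem_ball_iff_norm.2 hu)
  have hsub : closedBall x ρ ⊆ ball κ (4 * ρ) := by
    intro y hy
    rw [mem_ball] at hx ⊢
    rw [mem_closedBall] at hy
    linarith [dist_triangle y x κ]
  -- Cauchy's estimate on a disc of radius `ρ`, as branch values lie in `U` and so have norm below
  -- `diam U`.
  refine Complex.norm_deriv_le_of_forall_mem_sphere_norm_le hρ
    (((hφ.diff i hi).mono (closure_ball_subset_closedBall.trans hsub)).diffContOnCl)
    fun z hz => (hf.norm_lt_diam (hφ.maps i hi (hsub (sphere_subset_closedBall hz))).1).le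

/-- Propagation of closeness backwards along the branches. -/
theorem branch_estimate (hf : IsClassF f U V) (hρ : 0 < ρ) (hφ : BranchSystem f U n α ω ρ φ)
    {K t : ℝ} (hK : K = 4 * (Metric.diam U / ρ + 1)) (ht : 0 < t) (htρ : K ^ n * t + t < ρ)
    (hnear : BranchNear n α ω t φ) {ω' : ℂ} (hω : ‖ω' - ω‖ ≤ t) {z : ℕ → ℂ} {j : ℕ} (hj : j ≤ n)
    (hz : ∀ i < j, z i = φ i (z (i + 1) - ω')) (hzj : ‖z j - α j‖ ≤ t) :
    ∀ k i, i + k = j → ‖z i - α i‖ ≤ K ^ k * t ∧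
      (i < j → ‖z (i + 1) - ω' - (α (i + 1) - ω)‖ ≤ K ^ n * t + t) := by
  have hL : 0 ≤ Metric.diam U / ρ := div_nonneg Metric.diam_nonneg hρ.le
  have hK1 : 1 ≤ K := by rw [hK]; linarith
  intro k
  induction k with
  | zero =>
    rintro i rfl
    simpa using hzj
  | succ k ih =>
    intro i hik
    have hin : i < n := by omega
    obtain ⟨h1, -⟩ := ih (i + 1) (by omega)
    have hKk : K ^ k ≤ K ^ n := pow_le_pow_right₀ hK1 (by omega)
    have hKk1 : 1 ≤ K ^ k := one_le_pow₀ hK1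
    have h2 : ‖z (i + 1) - ω' - (α (i + 1) - ω)‖ ≤ K ^ k * t + t := by
      have : z (i + 1) - ω' - (α (i + 1) - ω) = (z (i + 1) - α (i + 1)) - (ω' - ω) := by ring
      rw [this]
      exact (norm_sub_le _ _).trans (add_le_add h1 hω)
    have h3' : ‖z (i + 1) - ω' - (α (i + 1) - ω)‖ ≤ K ^ n * t + t := by
      refine h2.trans ?_
      gcongr
    have h3 := h3'.trans_lt htρ
    refine ⟨?_, fun _ => h3'⟩
    obtain ⟨u, hu1, hu2⟩ := hnear i hin
    have htlt : t < ρ := by nlinarith [pow_pos (zero_lt_one.trans_le hK1) n]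
    have h4 := hf.branch_lipschitz hρ hφ hin h3 (hu1.trans_lt htlt)
    rw [hz i (by omega)]
    have h5 : ‖z (i + 1) - ω' - u‖ ≤ K ^ k * t + t + t := by
      have : z (i + 1) - ω' - u = (z (i + 1) - ω' - (α (i + 1) - ω)) - (u - (α (i + 1) - ω)) := by
        ring
      rw [this]
      exact (norm_sub_le _ _).trans (add_le_add h2 hu1)
    have h6 : φ i (z (i + 1) - ω') - α i =
        (φ i (z (i + 1) - ω') - φ i u) + (φ i u - α i) := by ring
    rw [h6]
    refine (norm_add_le _ _).trans ((add_le_add h4 hu2).trans ?_)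
    -- With `L = diam U / ρ`, one backward step turns an error `K ^ k * t` into at most `L (K ^ k t
    -- + 2 t) + t ≤ 4 (L + 1) K ^ k t`; hence the choice of `K`.
    calc Metric.diam U / ρ * ‖z (i + 1) - ω' - u‖ + t
        ≤ Metric.diam U / ρ * (K ^ k * t + t + t) + t := by gcongr
      _ ≤ K ^ (k + 1) * t := by
        rw [pow_succ, hK]
        rw [hK] at hKk1
        set L := Metric.diam U / ρ
        set A := (4 * (L + 1)) ^ k
        have : L * t ≤ L * (A * t) := by
          have : t ≤ A * t := by nlinarith
          gcongr
        nlinarith [mul_nonneg hL ht.le, mul_le_mul_of_nonneg_right hKk1 ht.le]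


theorem _root_.BranchNear.mono {t t' : ℝ} (h : BranchNear n α ω t φ) (htt : t ≤ t') :
    BranchNear n α ω t' φ := fun i hi => by
  obtain ⟨u, h1, h2⟩ := h i hi
  exact ⟨u, h1.trans htt, h2.trans htt⟩

/-- A branch whose limiting value lies outside `U ∖ {0}` is nearly constant. -/
theorem branch_small (hf : IsClassF f U V) (hρ : 0 < ρ)
    {i : ℕ} (hi : i < n) (hα : α i ∉ U \ {0}) (hαU : α i ∈ closure U) {τ : ℝ} (hτ : 0 < τ) :
    ∃ t > 0, ∀ φ : ℕ → ℂ → ℂ, BranchSystem f U n α ω ρ φ →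
      BranchNear n α ω t φ → ∀ u, ‖u - (α (i + 1) - ω)‖ ≤ ρ / 4 → ‖φ i u - α i‖ ≤ τ := by
  set d := Metric.diam U with hd
  have hd0 : 0 < d := hf.diam_pos
  -- The branch omits the value `α i`, so `φ i - α i` is zero-free and bounded by `2 * d`. The cube
  -- estimate then needs a central value of at most `τ ^ 3 / (2 d) ^ 2`; the term `ρ / 4` keeps the
  -- disc of radius `3 ρ` around `v` inside the branch domain.
  refine ⟨min (ρ / 4) (τ ^ 3 / (4 * d ^ 2)), by positivity, fun φ hφ hnear u hu => ?_⟩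
  obtain ⟨v, hv1, hv2⟩ := hnear i hi
  have hv3 := hv1.trans (min_le_left _ _)
  have hv4 := hv2.trans (min_le_right _ _)
  have hsub : ball v (3 * ρ) ⊆ ball (α (i + 1) - ω) (4 * ρ) := by
    intro y hy
    rw [mem_ball] at hy ⊢
    have := dist_triangle y v (α (i + 1) - ω)
    rw [dist_eq_norm v] at this
    linarith
  have hbd : ∀ z ∈ ball v (3 * ρ), ‖φ i z - α i‖ < 2 * d := fun z hz => by
    have := hf.dist_lt_diam_of_mem_closure (hφ.maps i hi (hsub hz)).1 hαU
    linarith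
  have key := norm_pow_three_le_of_ne_zero (g := fun z => φ i z - α i) (u := v) (R := 3 * ρ)
    (M := 2 * d) (by positivity) (((hφ.diff i hi).mono hsub).sub_const _)
    (fun z hz h0 => hα (sub_eq_zero.1 h0 ▸ hφ.maps i hi (hsub hz)))
    (fun z hz => (hbd z hz).le) (hbd v (mem_ball_self (by positivity))) (z := u) (by
      have : u - v = (u - (α (i + 1) - ω)) - (v - (α (i + 1) - ω)) := by ring
      rw [this]
      linarith [norm_sub_le (u - (α (i + 1) - ω)) (v - (α (i + 1) - ω))])
  refine le_of_pow_le_pow_left₀ (three_ne_zero) hτ.le (key.trans ?_)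
  calc ‖φ i v - α i‖ * (2 * d) ^ 2 ≤ τ ^ 3 / (4 * d ^ 2) * (2 * d) ^ 2 := by gcongr
    _ = τ ^ 3 := by field_simp; ring

end IsClassF

/-! ### The relation persists under limits, hence holds densely -/

namespace IsClassF

variable {f : ℂ → ℂ} {U V : Set ℂ} {w a s : ℂ → ℂ} {Ω : Set ℂ} {n : ℕ} {α : ℕ → ℂ} {ρ : ℝ}

theorem continuousAt_iterate (hf : IsClassF f U V) {c z : ℂ} {p : ℕ}
    (h : ∀ i < p, (fun z => c + f z)^[i] z ∈ U) :
    ContinuousAt (fun q : ℂ × ℂ => (fun z => q.1 + f z)^[p] q.2) (c, z) := by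
  induction p with
  | zero => exact continuousAt_snd
  | succ p ih =>
    simp only [Function.iterate_succ_apply']
    refine continuousAt_fst.add ?_
    refine ContinuousAt.comp' (g := f) ?_ (ih fun i hi => h i (by omega))
    exact (hf.analyticAt (h p (by omega))).continuousAt

theorem analyticAt_iterate (hf : IsClassF f U V) {c z : ℂ} {p : ℕ}
    (h : ∀ i < p, (fun z => c + f z)^[i] z ∈ U) :
    AnalyticAt ℂ (fun z => (fun z => c + f z)^[p] z) z := by
  induction p with
  | zero => exact analyticAt_id
  | succ p ih =>
    simp only [Function.iterate_succ_apply']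
    refine analyticAt_const.add ?_
    exact AnalyticAt.fun_comp (g := f) (hf.analyticAt (h p (by omega)))
      (ih fun i hi => h i (by omega))

/-- Small circles around a periodic point carry no periodic points, uniformly in the parameter. -/
theorem exists_sphere_iterate_ne (hf : IsClassF f U V) {c x : ℂ} (hc : NoIdentityGerm f U c)
    {p : ℕ} (hp : 1 ≤ p) (h : ∀ i < p, (fun z => c + f z)^[i] x ∈ U \ {0}) {r₀ : ℝ}
    (hr₀ : 0 < r₀) :
    ∃ r, 0 < r ∧ r < r₀ ∧ ∀ᶠ c' in 𝓝 c, ∀ z ∈ sphere x r, (fun z => c' + f z)^[p] z ≠ z := by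
  have hU : ∀ᶠ z in 𝓝 x, ∀ i ∈ Finset.range p, (fun z => c + f z)^[i] z ∈ U := by
    refine (Finset.eventually_all _).2 fun i hi => ?_
    have hip := Finset.mem_range.1 hi
    exact (hf.analyticAt_iterate fun j hj => (h j (hj.trans hip)).1).continuousAt.eventually_mem
      (hf.isOpen_source.mem_nhds (h i hip).1)
  have han : AnalyticAt ℂ (fun z => (fun z => c + f z)^[p] z - z) x :=
    (hf.analyticAt_iterate fun j hj => (h j hj).1).sub analyticAt_id
  rcases han.eventually_eq_zero_or_eventually_ne_zero with h0 | h0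
  · exact (hc x p hp h (h0.mono fun z hz => sub_eq_zero.1 hz)).elim
  rw [eventually_nhdsWithin_iff] at h0
  obtain ⟨ε, hε, hb⟩ := Metric.eventually_nhds_iff_ball.1 (hU.and h0)
  have hr : 0 < min ε r₀ / 2 := by positivity
  have hrε : min ε r₀ / 2 < ε := by linarith [min_le_left ε r₀, lt_min hε hr₀]
  refine ⟨min ε r₀ / 2, hr, by linarith [min_le_right ε r₀, lt_min hε hr₀], ?_⟩
  -- The fixed point `x` is at most an isolated one for the `p`-th iterate; compactness of the
  -- sphere and joint continuity in `(c', z)` make the inequality stable in the parameter.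
  refine (isCompact_sphere x (min ε r₀ / 2)).eventually_forall_of_forall_eventually
    fun z hz => ?_
  have hzb : z ∈ ball x ε := by
    rw [mem_sphere] at hz
    rw [mem_ball, hz]; exact hrε
  have hzx : z ≠ x := by
    rintro rfl
    rw [mem_sphere, dist_self] at hz
    linarith
  obtain ⟨h1, h2⟩ := hb z hzb
  have h3 := hf.continuousAt_iterate (p := p) fun i hi => h1 i (Finset.mem_range.2 hi)
  have h4 : ContinuousAt (fun q : ℂ × ℂ => (fun z => q.1 + f z)^[p] q.2 - q.2) (c, z) :=
    h3.sub continuousAt_snd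
  exact (h4.eventually_ne (h2 hzx)).mono fun q hq hqe => hq (sub_eq_zero.2 hqe)

/-- There are arbitrarily small radii such that the last iterate cannot reach the circle of that
radius around its limit along the branches near the limiting orbit. -/
theorem exists_nonescape_radius (hf : IsClassF f U V) (hΩ : IsOpen Ω)
    (hw : DifferentiableOn ℂ w Ω) (hwU : MapsTo w Ω U)
    (hs : ContinuousOn s Ω ∨ ∃ l < n, s = chain f w a l ∧ ∀ c ∈ U, NoIdentityGerm f U c)
    {ζs : ℂ} (hζs : ζs ∈ Ω) {l : Filter ℂ} [l.NeBot] (hl : l ≤ 𝓝 ζs)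
    (hlD : ∀ᶠ ζ in l, ζ ∈ relationDomain f U w a Ω n s)
    (hα : ∀ i ≤ n, Tendsto (chain f w a i) l (𝓝 (α i))) (hαU : ∀ i ≤ n, α i ∈ closure U)
    (hρ : 0 < ρ) {r₀ : ℝ} (hr₀ : 0 < r₀) :
    ∃ r, 0 < r ∧ r < r₀ ∧ ∃ δ > 0, ∃ t > 0, ∀ φ : ℕ → ℂ → ℂ,
      BranchSystem f U n α (w ζs) ρ φ → BranchNear n α (w ζs) t φ →
      ∀ ζ ∈ ball ζs δ, ζ ∈ relationDomain f U w a Ω n s →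
        (∀ i < n, chain f w a i ζ = φ i (chain f w a (i + 1) ζ - w ζ)) →
        ‖chain f w a n ζ - α n‖ ≤ r → ‖chain f w a n ζ - α n‖ ≠ r := by
  have hwc : ContinuousAt w ζs := (hw.differentiableAt (hΩ.mem_nhds hζs)).continuousAt
  have hrel : ∀ ζ ∈ relationDomain f U w a Ω n s, chain f w a n ζ = s ζ :=
    fun ζ hζ => hζ.2.self_of_nhds
  have hsl : Tendsto s l (𝓝 (α n)) :=
    (hα n le_rfl).congr' (hlD.mono fun ζ hζ => hrel ζ hζ)
  rcases hs with hs | ⟨k, hk, rfl, hNo⟩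
  -- The target is continuous at the limit parameter, so the last iterate is simply close to `α n`.
  · have hsc := hs.continuousAt (hΩ.mem_nhds hζs)
    have hsα : s ζs = α n := tendsto_nhds_unique (hsc.tendsto.mono_left hl) hsl
    obtain ⟨δ, hδ, hb⟩ := Metric.continuousAt_iff.1 hsc (r₀ / 2) (by positivity)
    refine ⟨r₀ / 2, by positivity, by linarith, δ, hδ, 1, one_pos, fun φ _ _ ζ hζ hζD _ _ => ?_⟩
    have := hb hζ
    rw [hrel ζ hζD, ← hsα, ← dist_eq_norm]
    exact this.ne
  · have hαk : α k = α n := tendsto_nhds_unique (hα k hk.le) hsl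
    by_cases hall : ∀ i, k ≤ i → i < n → α i ∈ U \ {0}
    -- The limiting orbit survives from `k` to `n`, so `α k = α n` is periodic; a circle around it
    -- free of nearby periodic points is a barrier, as `chain k = chain n` is periodic.
    · have hiter : ∀ j, k + j ≤ n → (fun z => w ζs + f z)^[j] (α k) = α (k + j) := by
        intro j
        induction j with
        | zero => intro _; rfl
        | succ j ih =>
          intro hj
          rw [Function.iterate_succ_apply', ih (by omega)]
          have h1 : Tendsto (fun ζ => w ζ + f (chain f w a (k + j) ζ)) l
              (𝓝 (w ζs + f (α (k + j)))) :=
            (hwc.tendsto.mono_left hl).add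
              ((hf.analyticAt (hall (k + j) (by omega) (by omega)).1).continuousAt.tendsto.comp
                (hα _ (by omega)))
          exact tendsto_nhds_unique h1 (hα (k + j + 1) hj)
      obtain ⟨p, hp⟩ := Nat.exists_eq_add_of_lt hk
      obtain ⟨r, hr, hrr, hev⟩ := hf.exists_sphere_iterate_ne (hNo _ (hwU hζs)) (x := α k)
        (p := p + 1) (by omega) (fun i hi => by
          rw [hiter i (by omega)]; exact hall _ (by omega) (by omega)) hr₀
      obtain ⟨δ, hδ, hb⟩ := Metric.eventually_nhds_iff_ball.1 (hwc.tendsto.eventually hev)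
      refine ⟨r, hr, hrr, δ, hδ, 1, one_pos, fun φ _ _ ζ hζ hζD _ _ heq => ?_⟩
      have hcomp : ∀ j, (fun z => w ζ + f z)^[j] (chain f w a k ζ) = chain f w a (k + j) ζ := by
        intro j
        induction j with
        | zero => rfl
        | succ j ih => rw [Function.iterate_succ_apply', ih]; rfl
      have h2 := hrel ζ hζD
      have h3 := hcomp (p + 1)
      rw [← add_assoc, ← hp, h2] at h3
      refine hb ζ hζ (chain f w a k ζ) ?_ h3
      rw [mem_sphere, dist_eq_norm, ← h2, hαk, heq]
    -- The limiting orbit leaves `U \ {0}` at some `i₀` between `k` and `n`. The branch at `i₀` is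
    -- then nearly constant, so pulling back from `i₀` to `k` places `chain k = chain n` within `r /
    -- 2` of `α n`.
    · push Not at hall
      obtain ⟨i₀, hki, hin, hαi⟩ := hall
      set K : ℝ := 4 * (Metric.diam U / ρ + 1) with hK
      have hL : 0 ≤ Metric.diam U / ρ := div_nonneg Metric.diam_nonneg hρ.le
      have hK1 : 1 ≤ K := by rw [hK]; linarith
      have hKn : 1 ≤ K ^ n := one_le_pow₀ hK1
      obtain ⟨r, hr, hrmin⟩ := exists_between (lt_min hr₀ (by positivity : 0 < ρ / (8 * K ^ n)))
      have hr1 := hrmin.trans_le (min_le_left _ _)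
      have hr2 : K ^ n * r + r < ρ / 4 := by
        have := hrmin.trans_le (min_le_right _ _)
        rw [lt_div_iff₀ (by positivity)] at this
        nlinarith
      set τ : ℝ := r / (2 * K ^ n) with hτ
      have hτ0 : 0 < τ := by positivity
      have hτK : K ^ n * τ = r / 2 := by rw [hτ]; field_simp
      have hτr : τ ≤ r := by nlinarith
      obtain ⟨t, ht, hsmall⟩ := hf.branch_small (ω := w ζs) hρ hin hαi (hαU _ hin.le) hτ0
      obtain ⟨δ, hδ, hb⟩ := Metric.continuousAt_iff.1 hwc τ hτ0
      refine ⟨r, hr, hr1, δ, hδ, min t τ, lt_min ht hτ0, fun φ hφ hnear ζ hζ hζD hchain hle => ?_⟩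
      have hω : ‖w ζ - w ζs‖ ≤ τ := by rw [← dist_eq_norm]; exact (hb hζ).le
      have h1 := hf.branch_estimate hρ hφ hK hr (by linarith)
        (hnear.mono ((min_le_right _ _).trans hτr)) (hω.trans hτr) (z := fun i => chain f w a i ζ)
        le_rfl hchain hle (n - i₀) i₀ (by omega)
      have h2 := hsmall φ hφ (hnear.mono (min_le_left _ _)) _ ((h1.2 hin).trans hr2.le)
      rw [← hchain i₀ hin] at h2
      have h3 := (hf.branch_estimate hρ hφ hK hτ0 (by nlinarith)
        (hnear.mono (min_le_right _ _)) hω (z := fun i => chain f w a i ζ) hin.le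
        (fun i hi => hchain i (hi.trans hin)) h2 (i₀ - k) k (by omega)).1
      rw [hrel ζ hζD, ← hαk]
      have h4 : K ^ (i₀ - k) * τ ≤ K ^ n * τ := by
        gcongr
        omega
      linarith

/-- A limit of parameters at which the relation holds, with iterated images of `f` bounded away
from zero, is again such a parameter. -/
theorem mem_relationDomain_of_limit (hf : IsClassF f U V) (hΩ : IsOpen Ω)
    (hw : DifferentiableOn ℂ w Ω) (ha : DifferentiableOn ℂ a Ω) (hwU : MapsTo w Ω U)
    (hn : 0 < n) (hs : (s = fun _ => 0) ∨ s = a ∨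
      ∃ l < n, s = chain f w a l ∧ ∀ c ∈ U, NoIdentityGerm f U c)
    {ζs : ℂ} (hζs : ζs ∈ Ω) {η : ℝ} (hη : 0 < η)
    (hcl : ζs ∈ closure {ζ ∈ relationDomain f U w a Ω n s |
      η ≤ ‖∏ i ∈ Finset.range n, f (chain f w a i ζ)‖}) :
    ζs ∈ relationDomain f U w a Ω n s := by
  set D := relationDomain f U w a Ω n s with hD
  have hs' : (s = fun _ => 0) ∨ ∃ l < n, s = chain f w a l := by
    rcases hs with h | h | ⟨l, hl, h, -⟩
    · exact Or.inl h
    · exact Or.inr ⟨0, hn, h⟩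
    · exact Or.inr ⟨l, hl, h⟩
  have hs'' : ContinuousOn s Ω ∨ ∃ l < n, s = chain f w a l ∧ ∀ c ∈ U, NoIdentityGerm f U c := by
    rcases hs with h | h | h
    · exact Or.inl (h ▸ continuousOn_const)
    · exact Or.inl (h ▸ ha.continuousOn)
    · exact Or.inr h
  have hDo : IsOpen D := hf.isOpen_relationDomain hΩ hw ha
  have hwc : ∀ ζ ∈ Ω, ContinuousAt w ζ := fun ζ hζ =>
    (hw.differentiableAt (hΩ.mem_nhds hζ)).continuousAt
  have hzU : ∀ ζ ∈ D, ∀ i ≤ n, chain f w a i ζ ∈ insert 0 U := by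
    intro ζ hζ i hi
    rcases hi.lt_or_eq with hi | rfl
    · exact Or.inr (hζ.1.2 i hi).1
    · rw [hζ.2.self_of_nhds]
      rcases hs' with rfl | ⟨l, hl, rfl⟩
      · exact Or.inl rfl
      · exact Or.inr (hζ.1.2 l hl).1
  have hclU : insert 0 U ⊆ closure U :=
    insert_subset hf.zero_mem_closure subset_closure
  -- Along an ultrafilter every iterate has a limit in the compact set `closure U`, without passing
  -- to subsequences.
  obtain ⟨l, hlE, hl⟩ := mem_closure_iff_ultrafilter.1 hcl
  have hlD : ∀ᶠ ζ in (l : Filter ℂ), ζ ∈ D := by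
    filter_upwards [hlE] with ζ hζ using hζ.1
  have hex : ∀ i, ∃ αi, i ≤ n → αi ∈ closure U ∧
      Tendsto (chain f w a i) l (𝓝 αi) := by
    intro i
    by_cases hi : i ≤ n
    · have h1 : (l.map (chain f w a i) : Filter ℂ) ≤ 𝓟 (closure U) := by
        exact le_principal_iff.2 (hlD.mono fun ζ hζ => hclU (hzU ζ hζ i hi))
      obtain ⟨x, hx, hxl⟩ := hf.isBounded_source.isCompact_closure.ultrafilter_le_nhds _ h1
      exact ⟨x, fun _ => ⟨hx, hxl⟩⟩
    · exact ⟨0, fun h => (hi h).elim⟩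
  choose α hα using hex
  set ω := w ζs with hω
  have hωU : ω ∈ U := hwU hζs
  have hwl : Tendsto w l (𝓝 ω) := (hwc ζs hζs).tendsto.mono_left hl
  have hfl : ∀ i < n, Tendsto (fun ζ => f (chain f w a i ζ)) l (𝓝 (α (i + 1) - ω)) := by
    intro i hi
    refine ((hα (i + 1) hi).2.sub hwl).congr fun ζ => ?_
    simp [chain]
  set d := Metric.diam U with hd
  -- The limits of `f (z_i)` are differences of a point of `closure U` and one of the open set `U`,
  -- hence of norm below `d`; the lower bound `η` on the product keeps each of them away from `0`.
  have hκd : ∀ i < n, α (i + 1) - ω ∈ ball (0 : ℂ) d \ {0} := by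
    intro i hi
    refine ⟨?_, fun h0 => ?_⟩
    · rw [mem_ball_zero_iff, norm_sub_rev]
      exact hf.dist_lt_diam_of_mem_closure hωU (hα (i + 1) hi).1
    · have h1 := tendsto_finsetProd (Finset.range n) fun i hi => hfl i (Finset.mem_range.1 hi)
      rw [Finset.prod_eq_zero (f := fun i => α (i + 1) - ω) (Finset.mem_range.2 hi) h0] at h1
      have h2 := ge_of_tendsto h1.norm (by
        filter_upwards [hlE] with ζ hζ using hζ.2)
      rw [norm_zero] at h2
      linarith
  obtain ⟨ρ, hρ, hball⟩ : ∃ ρ > 0, ∀ i < n,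
      ball (α (i + 1) - ω) (4 * ρ) ⊆ ball (0 : ℂ) d \ {0} := by
    have h1 : ∀ᶠ ρ in 𝓝[>] (0 : ℝ), ∀ i ∈ Finset.range n,
        ball (α (i + 1) - ω) (4 * ρ) ⊆ ball (0 : ℂ) d \ {0} := by
      refine (Finset.eventually_all _).2 fun i hi => ?_
      obtain ⟨ε, hε, hb⟩ := Metric.isOpen_iff.1 (isOpen_ball.sdiff isClosed_singleton) _
        (hκd i (Finset.mem_range.1 hi))
      filter_upwards [Ioo_mem_nhdsGT (by positivity : (0 : ℝ) < ε / 4)] with ρ hρ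
      exact (ball_subset_ball (by linarith [hρ.2])).trans hb
    obtain ⟨ρ, h2, h3⟩ := (h1.and self_mem_nhdsWithin).exists
    exact ⟨ρ, h3, fun i hi => h2 i (Finset.mem_range.2 hi)⟩
  have hballV : ∀ i < n, ball (α (i + 1) - ω) (4 * ρ) ⊆ V \ {0} := fun i hi x hx =>
    ⟨hf.ball_subset_target (hball i hi hx).1, (hball i hi hx).2⟩
  set K : ℝ := 4 * (d / ρ + 1) with hK
  have hL : 0 ≤ d / ρ := div_nonneg Metric.diam_nonneg hρ.le
  have hK1 : 1 ≤ K := by rw [hK]; linarith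
  have hKn : 1 ≤ K ^ n := one_le_pow₀ hK1
  obtain ⟨r, hr, hrρ, δ₁, hδ₁, t, ht, hne⟩ := hf.exists_nonescape_radius (α := α) hΩ hw hwU hs''
    hζs hl hlD (fun i hi => (hα i hi).2) (fun i hi => (hα i hi).1) hρ
    (by positivity : 0 < ρ / (4 * K ^ n))
  have hr2 : K ^ n * r + r < ρ := by
    rw [lt_div_iff₀ (by positivity)] at hrρ
    nlinarith
  obtain ⟨δ₂, hδ₂, hw₂⟩ := Metric.continuousAt_iff.1 (hwc ζs hζs) r hr
  obtain ⟨δ₃, hδ₃, hΩ₃⟩ := Metric.isOpen_iff.1 hΩ ζs hζs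
  set δ := min δ₁ (min δ₂ δ₃) with hδ
  have hδ0 : 0 < δ := by positivity
  have hB1 : ball ζs δ ⊆ ball ζs δ₁ := ball_subset_ball (min_le_left _ _)
  have hBw : ∀ ζ ∈ ball ζs δ, ‖w ζ - ω‖ ≤ r := fun ζ hζ => by
    rw [← dist_eq_norm]
    exact (hw₂ (ball_subset_ball ((min_le_right _ _).trans (min_le_left _ _)) hζ)).le
  have hBΩ : ball ζs δ ⊆ Ω :=
    (ball_subset_ball ((min_le_right _ _).trans (min_le_right _ _))).trans hΩ₃
  set t' := min t (min r ρ) with ht'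
  have ht'0 : 0 < t' := by positivity
  -- a parameter close to the limit
  have hev : ∀ᶠ ζ in (l : Filter ℂ), ζ ∈ D ∧ ζ ∈ ball ζs δ ∧ ‖chain f w a n ζ - α n‖ < r ∧
      ∀ i ∈ Finset.range n, ‖chain f w a i ζ - α i‖ < t' ∧
        ‖f (chain f w a i ζ) - (α (i + 1) - ω)‖ < t' := by
    refine hlD.and ((show ∀ᶠ ζ in (l : Filter ℂ), ζ ∈ ball ζs δ from hl (ball_mem_nhds ζs hδ0)).and (Eventually.and ?_ ?_))
    · have := ((hα n le_rfl).2.sub_const (α n)).norm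
      rw [sub_self, norm_zero] at this
      exact this.eventually_lt_const hr
    · refine (Finset.eventually_all _).2 fun i hi => ?_
      have hin := Finset.mem_range.1 hi
      have h1 := ((hα i hin.le).2.sub_const (α i)).norm
      have h2 := ((hfl i hin).sub_const (α (i + 1) - ω)).norm
      rw [sub_self, norm_zero] at h1 h2
      exact (h1.eventually_lt_const ht'0).and (h2.eventually_lt_const ht'0)
  obtain ⟨ζ₁, hζ₁D, hζ₁B, hζ₁n, hζ₁⟩ := hev.exists
  have hbr : ∀ i, ∃ φi : ℂ → ℂ, i < n →
      DifferentiableOn ℂ φi (ball (α (i + 1) - ω) (4 * ρ)) ∧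
      MapsTo φi (ball (α (i + 1) - ω) (4 * ρ)) (U \ {0}) ∧
      (∀ u ∈ ball (α (i + 1) - ω) (4 * ρ), f (φi u) = u) ∧
      φi (f (chain f w a i ζ₁)) = chain f w a i ζ₁ := by
    intro i
    by_cases hi : i < n
    · obtain ⟨φ, hφ⟩ := hf.exists_lift (Δ := ball (α (i + 1) - ω) (4 * ρ)) isOpen_ball
        (convex_ball _ _) differentiableOn_id (hballV i hi) (t := f (chain f w a i ζ₁))
        (x := chain f w a i ζ₁) (by
          rw [mem_ball, dist_eq_norm]
          have h1 := (hζ₁ i (Finset.mem_range.2 hi)).2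
          have h2 := (min_le_right t (min r ρ)).trans (min_le_right r ρ)
          linarith) (hζ₁D.1.2 i hi) rfl
      exact ⟨φ, fun _ => hφ⟩
    · exact ⟨0, fun h => (hi h).elim⟩
  choose φ hφ using hbr
  have hsys : BranchSystem f U n α ω ρ φ :=
    ⟨fun i hi => (hφ i hi).1, fun i hi => (hφ i hi).2.1, fun i hi => (hφ i hi).2.2.1⟩
  have hnear' : BranchNear n α ω t' φ := fun i hi =>
    ⟨f (chain f w a i ζ₁), (hζ₁ i (Finset.mem_range.2 hi)).2.le, by
      rw [(hφ i hi).2.2.2]; exact (hζ₁ i (Finset.mem_range.2 hi)).1.le⟩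
  have hnear_t : BranchNear n α ω t φ := hnear'.mono (min_le_left _ _)
  have hnear_r : BranchNear n α ω r φ :=
    hnear'.mono ((min_le_right _ _).trans (min_le_left _ _))
  -- Continuity method on the ball: `S` collects the parameters whose orbit follows the chosen
  -- branches and ends within `r` of `α n`. It is nonempty, open and relatively closed, so it
  -- contains the centre `ζs`.
  set S : Set ℂ := {ζ | ζ ∈ ball ζs δ ∧ ζ ∈ D ∧ ‖chain f w a n ζ - α n‖ < r ∧
    ∀ i < n, chain f w a i ζ = φ i (chain f w a (i + 1) ζ - w ζ)} with hS
  have hest : ∀ ζ ∈ ball ζs δ, ‖chain f w a n ζ - α n‖ ≤ r →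
      (∀ i < n, chain f w a i ζ = φ i (chain f w a (i + 1) ζ - w ζ)) →
      ∀ i < n, chain f w a (i + 1) ζ - w ζ ∈ ball (α (i + 1) - ω) (4 * ρ) := by
    intro ζ hζ hle hch i hi
    have := (hf.branch_estimate hρ hsys hK hr hr2 hnear_r (hBw ζ hζ)
      (z := fun i => chain f w a i ζ) le_rfl hch hle (n - i) i (by omega)).2 hi
    rw [mem_ball, dist_eq_norm]
    linarith
  have hchd : ∀ ζ ∈ D, ∀ i ≤ n, ContinuousAt (chain f w a i) ζ := fun ζ hζ i hi =>
    (hf.differentiableAt_chain hΩ hw ha hζ.1.1 fun j hj =>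
      hζ.1.2 j (hj.trans_le hi)).continuousAt
  have hSo : IsOpen S := by
    refine isOpen_iff_mem_nhds.2 fun ζ hζ => ?_
    obtain ⟨hζB, hζD, hζr, hζφ⟩ := hζ
    have h1 : ∀ᶠ ζ' in 𝓝 ζ, ∀ i ∈ Finset.range n,
        chain f w a i ζ' = φ i (chain f w a (i + 1) ζ' - w ζ') := by
      refine (Finset.eventually_all _).2 fun i hi => ?_
      have hin := Finset.mem_range.1 hi
      have hmem := hest ζ hζB hζr.le hζφ i hin
      have hc2 : ContinuousAt (fun ζ' => chain f w a (i + 1) ζ' - w ζ') ζ :=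
        (hchd ζ hζD (i + 1) hin).sub (hwc ζ hζD.1.1)
      have hc3 : ContinuousAt (fun ζ' => φ i (chain f w a (i + 1) ζ' - w ζ')) ζ :=
        ContinuousAt.comp' (g := φ i) ((hsys.diff i hin).continuousOn.continuousAt
          (isOpen_ball.mem_nhds hmem)) hc2
      refine hf.eventuallyEq_of_comp_eq (hchd ζ hζD i hin.le) hc3 (hζφ i hin) (hζD.1.2 i hin) ?_
      filter_upwards [hc2.eventually_mem (isOpen_ball.mem_nhds hmem)] with ζ' hζ'
      rw [hsys.right_inv i hin _ hζ']
      simp [chain]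
    have h2 : ∀ᶠ ζ' in 𝓝 ζ, ‖chain f w a n ζ' - α n‖ < r :=
      ((hchd ζ hζD n le_rfl).sub continuousAt_const).norm.eventually_lt continuousAt_const hζr
    filter_upwards [isOpen_ball.mem_nhds hζB, hDo.mem_nhds hζD, h1, h2] with ζ' h3 h4 h5 h6
    exact ⟨h3, h4, h6, fun i hi => h5 i (Finset.mem_range.2 hi)⟩
  have hSne : (ball ζs δ ∩ S).Nonempty := by
    refine ⟨ζ₁, hζ₁B, hζ₁B, hζ₁D, hζ₁n, fun i hi => ?_⟩
    have h1 : chain f w a (i + 1) ζ₁ - w ζ₁ = f (chain f w a i ζ₁) := by simp [chain]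
    rw [h1, (hφ i hi).2.2.2]
  have hSc : closure S ∩ ball ζs δ ⊆ S := by
    rintro ζ ⟨hζS, hζB⟩
    obtain ⟨u, huS, hu⟩ := mem_closure_iff_ultrafilter.1 hζS
    have huS' : ∀ᶠ ζ' in (u : Filter ℂ), ζ' ∈ S := huS
    have hwu : Tendsto w u (𝓝 (w ζ)) := (hwc ζ (hBΩ hζB)).tendsto.mono_left hu
    have hlim : ∀ k i, i + k = n → ∃ β, Tendsto (chain f w a i) u (𝓝 β) ∧
        (i < n → β ∈ U \ {0}) := by
      intro k
      induction k with
      | zero =>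
        rintro i rfl
        have h1 : (u.map (chain f w a (i + 0)) : Filter ℂ) ≤ 𝓟 (closedBall (α (i + 0)) r) := by
          refine le_principal_iff.2 (huS'.mono fun ζ' hζ' => ?_)
          rw [mem_closedBall, dist_eq_norm]
          exact hζ'.2.2.1.le
        obtain ⟨x, -, hxl⟩ := (isCompact_closedBall _ _).ultrafilter_le_nhds _ h1
        exact ⟨x, hxl, fun h => absurd h (by omega)⟩
      | succ k ih =>
        intro i hik
        have hin : i < n := by omega
        obtain ⟨β, hβ, -⟩ := ih (i + 1) (by omega)
        have h1 := hβ.sub hwu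
        have h2 : β - w ζ ∈ ball (α (i + 1) - ω) (4 * ρ) := by
          have h3 : ‖β - w ζ - (α (i + 1) - ω)‖ ≤ K ^ n * r + r := by
            refine le_of_tendsto (h1.sub_const (α (i + 1) - ω)).norm ?_
            filter_upwards [huS'] with ζ' hζ'
            exact (hf.branch_estimate hρ hsys hK hr hr2 hnear_r (hBw ζ' hζ'.1)
              (z := fun i => chain f w a i ζ') le_rfl hζ'.2.2.2 hζ'.2.2.1.le (n - i) i
              (by omega)).2 hin
          rw [mem_ball, dist_eq_norm]
          linarith
        refine ⟨φ i (β - w ζ), ?_, fun _ => hsys.maps i hin h2⟩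
        refine (((hsys.diff i hin).continuousOn.continuousAt
          (isOpen_ball.mem_nhds h2)).tendsto.comp h1).congr' ?_
        filter_upwards [huS'] with ζ' hζ'
        exact (hζ'.2.2.2 i hin).symm
    have hlim' : ∀ i, ∃ β, i ≤ n → Tendsto (chain f w a i) u (𝓝 β) ∧ (i < n → β ∈ U \ {0}) := by
      intro i
      by_cases hi : i ≤ n
      · obtain ⟨β, hβ⟩ := hlim (n - i) i (by omega)
        exact ⟨β, fun _ => hβ⟩
      · exact ⟨0, fun h => (hi h).elim⟩
    choose β hβ using hlim'
    have hζ0 : ζ ∈ chainDomain f U w a Ω n := hf.mem_chainDomain_of_tendsto hΩ hw ha (hBΩ hζB) hu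
      fun i hi => ⟨(hβ i hi.le).1, (hβ i hi.le).2 hi⟩
    have hζD : ζ ∈ D := hf.mem_relationDomain_of_mem_closure hΩ hw ha hs' hζ0
      (closure_mono (fun _ h => h.2.1) hζS)
    have hch : ∀ i ≤ n, Tendsto (chain f w a i) u (𝓝 (chain f w a i ζ)) := fun i hi =>
      (hchd ζ hζD i hi).tendsto.mono_left hu
    have hle : ‖chain f w a n ζ - α n‖ ≤ r := by
      refine le_of_tendsto ((hch n le_rfl).sub_const (α n)).norm ?_
      filter_upwards [huS'] with ζ' hζ' using hζ'.2.2.1.le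
    have heq : ∀ i < n, chain f w a i ζ = φ i (chain f w a (i + 1) ζ - w ζ) := by
      intro i hi
      have h1 := (hch (i + 1) hi).sub hwu
      have h2 : chain f w a (i + 1) ζ - w ζ ∈ ball (α (i + 1) - ω) (4 * ρ) := by
        have h3 : ‖chain f w a (i + 1) ζ - w ζ - (α (i + 1) - ω)‖ ≤ K ^ n * r + r := by
          refine le_of_tendsto (h1.sub_const (α (i + 1) - ω)).norm ?_
          filter_upwards [huS'] with ζ' hζ'
          exact (hf.branch_estimate hρ hsys hK hr hr2 hnear_r (hBw ζ' hζ'.1)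
            (z := fun i => chain f w a i ζ') le_rfl hζ'.2.2.2 hζ'.2.2.1.le (n - i) i
            (by omega)).2 hi
        rw [mem_ball, dist_eq_norm]
        linarith
      refine tendsto_nhds_unique (hch i hi.le) ?_
      refine (((hsys.diff i hi).continuousOn.continuousAt
        (isOpen_ball.mem_nhds h2)).tendsto.comp h1).congr' ?_
      filter_upwards [huS'] with ζ' hζ'
      exact (hζ'.2.2.2 i hi).symm
    -- In the limit the bound only survives as `≤ r`; equality is excluded by the choice of `r` as a
    -- nonescape radius.
    exact ⟨hζB, hζD, lt_of_le_of_ne hle (hne φ hsys hnear_t ζ (hB1 hζB) hζD heq hle), heq⟩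
  have hsub : ball ζs δ ⊆ S :=
    (convex_ball ζs δ).isPreconnected.subset_of_closure_inter_subset hSo hSne hSc
  exact (hsub (mem_ball_self hδ0)).2.1

/-- If the relation holds somewhere, it holds on a dense set of parameters. -/
theorem subset_closure_relationDomain (hf : IsClassF f U V) (hΩ : IsOpen Ω)
    (hconn : IsPreconnected Ω)
    (hw : DifferentiableOn ℂ w Ω) (ha : DifferentiableOn ℂ a Ω) (hwU : MapsTo w Ω U)
    (hn : 0 < n) (hs : (s = fun _ => 0) ∨ s = a ∨
      ∃ l < n, s = chain f w a l ∧ ∀ c ∈ U, NoIdentityGerm f U c)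
    (hne : (relationDomain f U w a Ω n s).Nonempty) :
    Ω ⊆ closure (relationDomain f U w a Ω n s) := by
  classical
  set D := relationDomain f U w a Ω n s with hD
  have hDo : IsOpen D := hf.isOpen_relationDomain hΩ hw ha
  set P : ℂ → ℂ := fun ζ => ∏ i ∈ Finset.range n, f (chain f w a i ζ) with hP
  -- At a point of `Ω` outside `D`, a failure of continuity would mean nearby parameters of `D` with
  -- product at least `η`, which the limit theorem forbids. So `F` is continuous, and its nonzero
  -- set is exactly `D`.
  set F : ℂ → ℂ := fun ζ => if ζ ∈ D then P ζ else 0 with hF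
  have hFD : ∀ ζ ∈ D, F ζ = P ζ ∧ P ζ ≠ 0 := fun ζ hζ => by
    refine ⟨by simp [hF, hζ], Finset.prod_ne_zero_iff.2 fun i hi => ?_⟩
    exact (hf.apply_mem (hζ.1.2 i (Finset.mem_range.1 hi))).2
  have hmem : ∀ ζ, F ζ ≠ 0 → ζ ∈ D := fun ζ h => by
    by_contra hζ
    exact h (by simp [hF, hζ])
  have hd : ∀ ζ ∈ D, DifferentiableAt ℂ F ζ := by
    intro ζ hζ
    have h1 : DifferentiableAt ℂ P ζ := by
      refine DifferentiableAt.fun_finsetProd fun i hi => ?_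
      have hin := Finset.mem_range.1 hi
      exact DifferentiableAt.comp (g := f) ζ (hf.analyticAt (hζ.1.2 i hin).1).differentiableAt
        (hf.differentiableAt_chain hΩ hw ha hζ.1.1 fun j hj => hζ.1.2 j (hj.trans hin))
    refine h1.congr_of_eventuallyEq ?_
    filter_upwards [hDo.mem_nhds hζ] with ζ' hζ' using (hFD ζ' hζ').1
  have hcont : ContinuousOn F Ω := by
    intro ζ hζ
    by_cases hζD : ζ ∈ D
    · exact (hd ζ hζD).continuousAt.continuousWithinAt
    have hF0 : F ζ = 0 := by simp [hF, hζD]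
    refine ContinuousAt.continuousWithinAt (Metric.continuousAt_iff'.2 fun η hη => ?_)
    by_contra hcon
    refine hζD (hf.mem_relationDomain_of_limit hΩ hw ha hwU hn hs hζ hη ?_)
    rw [mem_closure_iff_frequently]
    refine (not_eventually.1 hcon).mono fun ζ' hζ' => ?_
    rw [hF0, dist_zero_right, not_lt] at hζ'
    have hζ'D := hmem ζ' fun h0 => by
      rw [h0, norm_zero] at hζ'
      linarith
    rw [(hFD ζ' hζ'D).1] at hζ'
    exact ⟨hζ'D, hζ'⟩
  obtain ⟨z₀, hz₀⟩ := hne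
  refine (subset_closure_ne_zero hΩ hconn hcont (fun z _ h => hd z (hmem z h)) hz₀.1.1
    (by rw [(hFD z₀ hz₀).1]; exact (hFD z₀ hz₀).2)).trans ?_
  exact closure_mono fun z hz => hmem z hz.2

end IsClassF

/-! ### The exponential half-plane and the exclusion of persistent relations -/

/-- The half-plane which `exp` maps onto the punctured disc of radius `d`. -/
def expHalfPlane (d : ℝ) : Set ℂ := {ζ | ζ.re < Real.log d}

theorem isOpen_expHalfPlane (d : ℝ) : IsOpen (expHalfPlane d) :=
  isOpen_lt Complex.continuous_re continuous_const

theorem convex_expHalfPlane (d : ℝ) : Convex ℝ (expHalfPlane d) :=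
  convex_halfSpace_re_lt (Real.log d)

theorem norm_exp_lt_of_mem {d : ℝ} (hd : 0 < d) {ζ : ℂ} (hζ : ζ ∈ expHalfPlane d) :
    ‖Complex.exp ζ‖ < d := by
  rw [Complex.norm_exp, ← Real.lt_log_iff_exp_lt hd]
  exact hζ

theorem add_pi_mul_I_mem {d : ℝ} {ζ : ℂ} (hζ : ζ ∈ expHalfPlane d) :
    ζ + Real.pi * Complex.I ∈ expHalfPlane d := by
  simpa [expHalfPlane] using hζ

theorem log_mem_expHalfPlane {d r : ℝ} (hr : 0 < r) (hrd : r < d) :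
    ((Real.log r : ℝ) : ℂ) ∈ expHalfPlane d := by
  simpa [expHalfPlane] using Real.log_lt_log hr hrd

theorem exp_ofReal_log {r : ℝ} (hr : 0 < r) : Complex.exp ((Real.log r : ℝ) : ℂ) = r := by
  rw [← Complex.ofReal_exp, Real.exp_log hr]

theorem exp_add_pi (ζ : ℂ) : Complex.exp (ζ + Real.pi * Complex.I) = -Complex.exp ζ := by
  rw [Complex.exp_add, Complex.exp_pi_mul_I, mul_neg_one]

/-- The maximum principle on a half-plane for bounded functions with vanishing boundary values. -/
theorem eq_zero_of_norm_sq_le {Θ : ℂ → ℂ} {d : ℝ} (hd : 0 < d)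
    (hΘ : DifferentiableOn ℂ Θ (expHalfPlane d))
    (hb : ∀ ζ ∈ expHalfPlane d, ‖Θ ζ‖ ^ 2 ≤ d ^ 2 - ‖Complex.exp ζ‖ ^ 2) :
    ∀ ζ ∈ expHalfPlane d, Θ ζ = 0 := by
  intro ζ hζ
  -- Phragmén–Lindelöf on `re ≤ x`, where `Θ` is bounded by `d`, reduces to the boundary line;
  -- letting `x` tend to `log d` makes the bound vanish.
  have key : ∀ x : ℝ, ζ.re ≤ x → x < Real.log d → ‖Θ ζ‖ ≤ √(d ^ 2 - Real.exp x ^ 2) := by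
    intro x hx hxd
    have hmem : ∀ z : ℂ, 0 ≤ z.re → (x : ℂ) - z ∈ expHalfPlane d := by
      intro z hz
      simp only [expHalfPlane, mem_ofPred_eq, Complex.sub_re, Complex.ofReal_re]
      linarith
    have hbd : ∀ z : ℂ, 0 ≤ z.re → ‖Θ (x - z)‖ ≤ d := by
      intro z hz
      have := hb _ (hmem z hz)
      refine abs_le_of_sq_le_sq' ?_ hd.le |>.2
      nlinarith [sq_nonneg ‖Complex.exp (x - z)‖]
    have h1 := PhragmenLindelof.right_half_plane_of_bounded_on_real (f := fun z => Θ (x - z))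
      (C := √(d ^ 2 - Real.exp x ^ 2)) (z := x - ζ) ?_ ⟨1, by norm_num, 0, ?_⟩ ?_ ?_ ?_
    · simpa using h1
    · refine DifferentiableOn.diffContOnCl fun z hz => ?_
      rw [Complex.closure_setOfPred_lt_re] at hz
      have h2 : DifferentiableAt ℂ Θ (x - z) :=
        hΘ.differentiableAt ((isOpen_expHalfPlane d).mem_nhds (hmem z hz))
      exact (h2.comp z (by fun_prop :
        DifferentiableAt ℂ (fun z => (x : ℂ) - z) z)).differentiableWithinAt
    · refine Asymptotics.IsBigO.of_bound d ?_
      refine Filter.mem_inf_of_right ?_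
      rw [mem_principal]
      intro z hz
      simpa using hbd z (le_of_lt hz)
    · refine ⟨d, ?_⟩
      rw [eventually_map]
      filter_upwards [eventually_ge_atTop (0 : ℝ)] with y hy
      exact hbd y (by simpa using hy)
    · intro y
      refine Real.le_sqrt_of_sq_le ?_
      have h2 := hb _ (hmem (y * Complex.I) (by simp))
      rwa [Complex.norm_exp, Complex.sub_re, Complex.ofReal_re, Complex.re_ofReal_mul,
        Complex.I_re, mul_zero, sub_zero] at h2
    · simpa using hx
  have hlim : Tendsto (fun x : ℝ => √(d ^ 2 - Real.exp x ^ 2)) (𝓝[<] (Real.log d)) (𝓝 0) := by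
    have hc : Continuous fun x : ℝ => √(d ^ 2 - Real.exp x ^ 2) := by fun_prop
    have := (hc.tendsto (Real.log d)).mono_left (nhdsWithin_le_nhds (s := Iio (Real.log d)))
    simpa [Real.exp_log hd] using this
  have h0 : ‖Θ ζ‖ ≤ 0 := by
    refine ge_of_tendsto hlim ?_
    filter_upwards [Ioo_mem_nhdsLT (show ζ.re < Real.log d from hζ)] with x hx
    exact key x hx.1.le hx.2
  exact norm_le_zero_iff.1 h0

namespace IsClassF

variable {f : ℂ → ℂ} {U V : Set ℂ}

/-- Lifts of `exp` through `f`. -/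
theorem exists_exp_lift (hf : IsClassF f U V) {x : ℂ} (hx : x ∈ U \ {0})
    (hfx : ‖f x‖ < Metric.diam U) :
    ∃ ζ₀ ∈ expHalfPlane (Metric.diam U), ∃ a : ℂ → ℂ,
      DifferentiableOn ℂ a (expHalfPlane (Metric.diam U)) ∧
      MapsTo a (expHalfPlane (Metric.diam U)) (U \ {0}) ∧
      (∀ ζ ∈ expHalfPlane (Metric.diam U), f (a ζ) = Complex.exp ζ) ∧ a ζ₀ = x := by
  have hfx0 : f x ≠ 0 := (hf.apply_mem hx).2
  have hζ₀ : Complex.log (f x) ∈ expHalfPlane (Metric.diam U) := by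
    simp only [expHalfPlane, mem_ofPred_eq, Complex.log_re]
    exact Real.log_lt_log (norm_pos_iff.2 hfx0) hfx
  refine ⟨Complex.log (f x), hζ₀, ?_⟩
  refine hf.exists_lift (isOpen_expHalfPlane _) (convex_expHalfPlane _)
    Complex.differentiable_exp.differentiableOn (fun ζ hζ => ⟨hf.ball_subset_target ?_,
      Complex.exp_ne_zero ζ⟩) hζ₀ hx (Complex.exp_log hfx0).symm
  simpa using norm_exp_lt_of_mem hf.diam_pos hζ

/-- Antipodal points on the circle of radius `3/4 * diam U` around `c` are `3/2 * diam U` apart. -/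
theorem false_of_disc_subset_closure (hf : IsClassF f U V) {c : ℂ}
    (h : ∀ ζ ∈ expHalfPlane (Metric.diam U), c + Complex.exp ζ ∈ closure U) : False := by
  have hd := hf.diam_pos
  set d := Metric.diam U with hd'
  have hm := log_mem_expHalfPlane (d := d) (r := 3 / 4 * d) (by linarith) (by linarith)
  have h1 := h _ hm
  have h2 := h _ (add_pi_mul_I_mem hm)
  rw [exp_add_pi] at h2
  rw [exp_ofReal_log (by linarith)] at h1 h2
  have h3 := hf.norm_sub_le_diam h1 h2
  have h4 : c + ((3 / 4 * d : ℝ) : ℂ) - (c + -((3 / 4 * d : ℝ) : ℂ)) =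
      ((3 / 2 * d : ℝ) : ℂ) := by push_cast; ring
  rw [h4, Complex.norm_real, Real.norm_of_nonneg (by linarith)] at h3
  linarith

/-- The relation `F^[p] (a ζ) = a ζ`, with `F z = c + f z`, spreads to a dense set of `ζ`, and there
the first iterate `c + exp ζ` lies in `U`. A disc of radius `diam U` would then lie in `closure U`.
-/
theorem noIdentityGerm (hf : IsClassF f U V) {c : ℂ} (hc : c ∈ U) : NoIdentityGerm f U c := by
  intro x p hp horb hid
  have hx : x ∈ U \ {0} := horb 0 (by omega)
  have hx1 : c + f x ∈ U := by
    rcases hp.lt_or_eq with hp | rfl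
    · exact (horb 1 hp).1
    · have := hid.self_of_nhds
      simp only [Function.iterate_one] at this
      rw [this]; exact hx.1
  obtain ⟨ζ₀, hζ₀, a, ha, haU, hfa, ha0⟩ := hf.exists_exp_lift hx (by
    have := hf.dist_lt_diam (Or.inr hx1) (Or.inr hc)
    simpa using this)
  set Ω := expHalfPlane (Metric.diam U) with hΩdef
  have hΩ : IsOpen Ω := isOpen_expHalfPlane _
  have hchain : ∀ i ζ, chain f (fun _ => c) a i ζ = (fun z => c + f z)^[i] (a ζ) := by
    intro i ζ
    induction i with
    | zero => rfl
    | succ i ih => rw [Function.iterate_succ_apply', ← ih]; rfl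
  have hmem : ζ₀ ∈ relationDomain f U (fun _ => c) a Ω p a := by
    refine ⟨⟨hζ₀, fun i hi => ?_⟩, ?_⟩
    · rw [hchain, ha0]; exact horb i hi
    · have hac : ContinuousAt a ζ₀ := ha.continuousOn.continuousAt (hΩ.mem_nhds hζ₀)
      have h1 : Tendsto a (𝓝 ζ₀) (𝓝 x) := ha0 ▸ hac.tendsto
      filter_upwards [h1.eventually hid] with ζ hζ
      rw [hchain, hζ]
  have hdense := hf.subset_closure_relationDomain hΩ (convex_expHalfPlane _).isPreconnected
    (differentiableOn_const c) ha (fun _ _ => hc) (by omega) (Or.inr (Or.inl rfl)) ⟨ζ₀, hmem⟩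
  refine hf.false_of_disc_subset_closure (c := c) fun ζ hζ => ?_
  refine map_mem_closure (f := fun ζ => c + Complex.exp ζ) (by fun_prop) (hdense hζ)
    fun ζ' hζ' => ?_
  have h1 : chain f (fun _ => c) a 1 ζ' = c + Complex.exp ζ' := by
    rw [← hfa ζ' hζ'.1.1]; rfl
  simp only
  rw [← h1]
  rcases hp.lt_or_eq with hp | rfl
  · exact (hζ'.1.2 1 hp).1
  · rw [hζ'.2.self_of_nhds]; exact (haU hζ'.1.1).1

/-- The parameter `0` may lie outside `U`, so the density theorem does not apply. For it `U \ {0} ⊆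
V \ {0}` suffices: orbit points can be pulled back through `f` over the whole half-plane until `exp`
itself is seen to take values in `U`. -/
theorem noIdentityGerm_zero (hf : IsClassF f U V) : NoIdentityGerm f U 0 := by
  intro x p hp horb hid
  have hx : x ∈ U \ {0} := horb 0 (by omega)
  have hx1 : (fun z => 0 + f z)^[1] x ∈ U := by
    rcases hp.lt_or_eq with hp | rfl
    · exact (horb 1 hp).1
    · rw [hid.self_of_nhds]; exact hx.1
  have hxp : (fun z => 0 + f z)^[p] x = x := hid.self_of_nhds
  obtain ⟨ζ₀, hζ₀, a, ha, haU, hfa, ha0⟩ := hf.exists_exp_lift hx (by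
    simpa using hf.norm_lt_diam hx1)
  set Ω := expHalfPlane (Metric.diam U) with hΩdef
  have hΩ : IsOpen Ω := isOpen_expHalfPlane _
  have hexp0 : 0 + f x = Complex.exp ζ₀ := by rw [← hfa ζ₀ hζ₀, ha0, zero_add]
  have hac : Tendsto a (𝓝 ζ₀) (𝓝 x) :=
    ha0 ▸ (ha.continuousOn.continuousAt (hΩ.mem_nhds hζ₀)).tendsto
  -- Descending in `i` from `p - 1`, where the identity germ gives `F^[p - 1] (exp ζ) = a ζ` with `F
  -- z = 0 + f z`, down to `i = 0`.
  have hpull : ∀ j i, i + j + 1 = p → ∃ y : ℂ → ℂ, DifferentiableOn ℂ y Ω ∧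
      MapsTo y Ω (U \ {0}) ∧ ∀ᶠ ζ in 𝓝 ζ₀, y ζ = (fun z => 0 + f z)^[i] (Complex.exp ζ) := by
    intro j
    induction j with
    | zero =>
      rintro i rfl
      refine ⟨a, ha, haU, ?_⟩
      filter_upwards [hac.eventually hid, hΩ.mem_nhds hζ₀] with ζ hζ hζΩ
      rw [← hfa ζ hζΩ]
      nth_rewrite 1 [← hζ]
      rw [add_zero, Function.iterate_succ_apply, zero_add]
    | succ j ih =>
      intro i hij
      obtain ⟨y, hy, hyU, hye⟩ := ih (i + 1) (by omega)
      have horbi : (fun z => 0 + f z)^[i] (Complex.exp ζ₀) ∈ U \ {0} := by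
        rw [← hexp0]
        have := horb (i + 1) (by omega)
        rwa [Function.iterate_succ_apply] at this
      have hyζ := hye.self_of_nhds
      rw [Function.iterate_succ_apply', zero_add] at hyζ
      obtain ⟨y', hy', hy'U, hfy', hy'0⟩ := hf.exists_lift hΩ (convex_expHalfPlane _) hy
        (fun ζ hζ => ⟨hf.ball_subset_target (hf.source_subset_ball (hyU hζ).1), (hyU hζ).2⟩)
        hζ₀ horbi hyζ.symm
      refine ⟨y', hy', hy'U, ?_⟩
      refine hf.eventuallyEq_of_comp_eq (hy'.continuousOn.continuousAt (hΩ.mem_nhds hζ₀)) ?_ hy'0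
        (hy'U hζ₀) ?_
      · refine ContinuousAt.comp' (g := fun z => (fun z => 0 + f z)^[i] z) ?_
          Complex.continuous_exp.continuousAt
        refine (hf.analyticAt_iterate fun k hk => ?_).continuousAt
        rw [← hexp0]
        have := (horb (k + 1) (by omega)).1
        rwa [Function.iterate_succ_apply] at this
      · filter_upwards [hye, hΩ.mem_nhds hζ₀] with ζ h1 h2
        rw [hfy' ζ h2, h1, Function.iterate_succ_apply', zero_add]
  obtain ⟨y, hy, hyU, hye⟩ := hpull (p - 1) 0 (by omega)
  have heq : EqOn y Complex.exp Ω :=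
    (hy.analyticOnNhd hΩ).eqOn_of_preconnected_of_eventuallyEq
      (Complex.differentiable_exp.differentiableOn.analyticOnNhd hΩ)
      (convex_expHalfPlane _).isPreconnected hζ₀ hye
  refine hf.false_of_disc_subset_closure (c := 0) fun ζ hζ => ?_
  rw [zero_add, ← heq hζ]
  exact subset_closure (hyU hζ).1

/-- The critical orbit relation does not hold identically in the parameter. -/
theorem not_eventually_orbit_relation (hf : IsClassF f U V) {c : ℂ} {n : ℕ} (hn : 0 < n)
    (horb : ∀ i < n, chain f id id i c ∈ U \ {0}) {s : ℂ → ℂ}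
    (hs : (s = fun _ => 0) ∨ ∃ l, 1 ≤ l ∧ l < n ∧ s = chain f id id l) :
    ¬ ∀ᶠ z in 𝓝 c, chain f id id n z = s z := by
  intro hid
  have hc : c ∈ U \ {0} := horb 0 hn
  have hlast : ∀ (ζ : ℂ), (∀ i < n, chain f id id i ζ ∈ U \ {0}) → chain f id id n ζ = s ζ →
      ∀ i ≤ n, chain f id id i ζ ∈ insert 0 U := by
    intro ζ h1 h2 i hi
    rcases hi.lt_or_eq with hi | rfl
    · exact Or.inr (h1 i hi).1
    · rw [h2]
      rcases hs with rfl | ⟨l, -, hl, rfl⟩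
      · exact Or.inl rfl
      · exact Or.inr (h1 l hl).1
  obtain ⟨ζ₀, hζ₀, a, ha, haU, hfa, ha0⟩ := hf.exists_exp_lift hc (by
    have h1 := hlast c horb hid.self_of_nhds 1 hn
    have h2 := hf.dist_lt_diam h1 (Or.inr hc.1)
    simpa [chain] using h2)
  set Ω := expHalfPlane (Metric.diam U) with hΩdef
  have hΩ : IsOpen Ω := isOpen_expHalfPlane _
  have hac : Tendsto a (𝓝 ζ₀) (𝓝 c) :=
    ha0 ▸ (ha.continuousOn.continuousAt (hΩ.mem_nhds hζ₀)).tendsto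
  have hchain : ∀ i ζ, chain f a a i ζ = chain f id id i (a ζ) := by
    intro i ζ
    induction i with
    | zero => rfl
    | succ i ih => simp only [chain, ih, id]
  have hrel : ∀ᶠ ζ in 𝓝 ζ₀, chain f a a n ζ = s (a ζ) := by
    filter_upwards [hac.eventually hid] with ζ hζ
    rw [hchain, hζ]
  have hmem : ζ₀ ∈ relationDomain f U a a Ω n (fun ζ => s (a ζ)) :=
    ⟨⟨hζ₀, fun i hi => by rw [hchain, ha0]; exact horb i hi⟩, hrel⟩
  have hs' : ((fun ζ => s (a ζ)) = fun _ => 0) ∨ (fun ζ => s (a ζ)) = a ∨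
      ∃ l < n, (fun ζ => s (a ζ)) = chain f a a l ∧ ∀ c ∈ U, NoIdentityGerm f U c := by
    rcases hs with rfl | ⟨l, -, hl, rfl⟩
    · exact Or.inl rfl
    · exact Or.inr (Or.inr ⟨l, hl, funext fun ζ => (hchain l ζ).symm,
        fun c hc => hf.noIdentityGerm hc⟩)
  have hdense := hf.subset_closure_relationDomain hΩ (convex_expHalfPlane _).isPreconnected ha ha
    (fun ζ hζ => (haU hζ).1) hn hs' ⟨ζ₀, hmem⟩
  have hD : ∀ ζ ∈ relationDomain f U a a Ω n (fun ζ => s (a ζ)), ∀ i ≤ n,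
      chain f a a i ζ ∈ closure U := by
    intro ζ hζ i hi
    rw [hchain]
    refine insert_subset hf.zero_mem_closure subset_closure (hlast (a ζ) (fun j hj => ?_) ?_ i hi)
    · rw [← hchain]; exact hζ.1.2 j hj
    · rw [← hchain]; exact hζ.2.self_of_nhds
  have hone : ∀ ζ ∈ Ω, chain f a a 1 ζ = a ζ + Complex.exp ζ := fun ζ hζ => by
    rw [← hfa ζ hζ]; rfl
  have hac' : ∀ ζ ∈ Ω, ContinuousAt a ζ := fun ζ hζ =>
    ha.continuousOn.continuousAt (hΩ.mem_nhds hζ)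
  have hone' : ∀ ζ ∈ Ω, a ζ + Complex.exp ζ ∈ closure U := by
    intro ζ hζ
    have h1 : ContinuousAt (fun ζ => a ζ + Complex.exp ζ) ζ :=
      (hac' ζ hζ).add Complex.continuous_exp.continuousAt
    have h2 := mem_closure_image h1 (hdense hζ)
    rw [← closure_closure]
    refine closure_mono ?_ h2
    rintro _ ⟨ζ', hζ', rfl⟩
    simp only
    rw [← hone ζ' hζ'.1.1]
    exact hD ζ' hζ' 1 hn
  rcases (show n = 1 ∨ 2 ≤ n by omega) with rfl | hn2
  · have hs0 : s = fun _ => 0 := by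
      rcases hs with h | ⟨l, h1, h2, -⟩
      · exact h
      · omega
    -- For `n = 1` the relation reads `a + exp = 0`, so `U` contains a whole punctured disc of
    -- radius `diam U`.
    have heq : EqOn a (fun ζ => -Complex.exp ζ) Ω := by
      refine (ha.analyticOnNhd hΩ).eqOn_of_preconnected_of_eventuallyEq
        (Complex.differentiable_exp.neg.differentiableOn.analyticOnNhd hΩ)
        (convex_expHalfPlane _).isPreconnected hζ₀ ?_
      filter_upwards [hrel, hΩ.mem_nhds hζ₀] with ζ h1 h2
      rw [hone ζ h2, hs0] at h1
      exact eq_neg_of_add_eq_zero_left h1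
    refine hf.false_of_disc_subset_closure (c := 0) fun ζ hζ => ?_
    have h1 := heq (add_pi_mul_I_mem hζ)
    simp only [exp_add_pi, neg_neg] at h1
    rw [zero_add, ← h1]
    exact subset_closure (haU (add_pi_mul_I_mem hζ)).1
  · have hd := hf.diam_pos
    -- Put `b = a (ζ + π i)`, `u = exp ζ`. Both `b - a` and `2 u - (b - a)` have norm at most `diam
    -- U`, so the parallelogram law gives `‖b - a - u‖ ^ 2 ≤ diam U ^ 2 - ‖u‖ ^ 2`, and the maximum
    -- principle applies.
    have hΘ : ∀ ζ ∈ Ω, a (ζ + Real.pi * Complex.I) - a ζ - Complex.exp ζ = 0 := by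
      refine eq_zero_of_norm_sq_le hd ?_ ?_
      · refine (DifferentiableOn.sub ?_ ha).sub Complex.differentiable_exp.differentiableOn
        exact ha.comp (by fun_prop) fun ζ hζ => add_pi_mul_I_mem hζ
      · intro ζ hζ
        have hζ' := add_pi_mul_I_mem hζ
        set b := a (ζ + Real.pi * Complex.I) with hb
        set u := Complex.exp ζ with hu
        have h1 : ‖b - a ζ‖ ≤ Metric.diam U :=
          hf.norm_sub_le_diam (subset_closure (haU hζ').1) (subset_closure (haU hζ).1)
        have h2 := hone' _ hζ'
        rw [exp_add_pi, ← hb, ← hu] at h2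
        have h3 : ‖a ζ + u - (b + -u)‖ ≤ Metric.diam U := hf.norm_sub_le_diam (hone' ζ hζ) h2
        have h4 := parallelogram_law_with_norm ℝ u (b - a ζ - u)
        have h5 : u + (b - a ζ - u) = b - a ζ := by ring
        have h6 : u - (b - a ζ - u) = a ζ + u - (b + -u) := by ring
        rw [h5, h6] at h4
        nlinarith [norm_nonneg (b - a ζ), norm_nonneg (a ζ + u - (b + -u))]
    -- The first iterate is now `a (ζ + π i)`, whose image under `f` is `-exp ζ`. Thus `a + exp` and
    -- `a - exp` both stay in `closure U`, which is too small for `2 ‖exp ζ‖ = 3/2 * diam U`.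
    have htwo : ∀ ζ ∈ Ω, chain f a a 2 ζ = a ζ - Complex.exp ζ := by
      intro ζ hζ
      have h1 := hfa _ (add_pi_mul_I_mem hζ)
      have h2 : a (ζ + Real.pi * Complex.I) = chain f a a 1 ζ := by
        rw [hone ζ hζ]; linear_combination hΘ ζ hζ
      rw [exp_add_pi, h2] at h1
      change a ζ + f (chain f a a 1 ζ) = _
      rw [h1]; ring
    have htwo' : ∀ ζ ∈ Ω, a ζ - Complex.exp ζ ∈ closure U := by
      intro ζ hζ
      have h1 : ContinuousAt (fun ζ => a ζ - Complex.exp ζ) ζ :=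
        (hac' ζ hζ).sub Complex.continuous_exp.continuousAt
      have h2 := mem_closure_image h1 (hdense hζ)
      rw [← closure_closure]
      refine closure_mono ?_ h2
      rintro _ ⟨ζ', hζ', rfl⟩
      simp only
      rw [← htwo ζ' hζ'.1.1]
      exact hD ζ' hζ' 2 hn2
    set d := Metric.diam U with hd'
    have hm := log_mem_expHalfPlane (d := d) (r := 3 / 4 * d) (by linarith) (by linarith)
    have h3 := hf.norm_sub_le_diam (hone' _ hm) (htwo' _ hm)
    rw [exp_ofReal_log (by linarith), add_sub_sub_cancel, ← two_mul] at h3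
    rw [norm_mul, Complex.norm_real, Real.norm_of_nonneg (by linarith)] at h3
    norm_num at h3
    linarith

end IsClassF

/-! ### The finite-dimensional operator and its invariant functionals -/

/-- The transfer operator on functions on a finite set. -/
noncomputable def finiteTransfer (f : ℂ → ℂ) (c : ℂ) (Q : Finset ℂ) : Module.End ℂ (Q → ℂ) :=
  LinearMap.funLeft ℂ ℂ ((↑) : Q → ℂ) ∘ₗ transfer f c ∘ₗ
    Function.ExtendByZero.linearMap ℂ ((↑) : Q → ℂ)

theorem finiteTransfer_apply (f : ℂ → ℂ) (c : ℂ) (Q : Finset ℂ) (u : Q → ℂ) (x : Q) :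
    finiteTransfer f c Q u x = transfer f c (Function.extend (↑) u 0) x := rfl

theorem IsInvariantSet.finiteTransfer_restrict {f : ℂ → ℂ} {U : Set ℂ} {c : ℂ} {Q : Finset ℂ}
    (hQ : IsInvariantSet f U c Q) (u : ℂ → ℂ) :
    finiteTransfer f c Q (fun x => u x) = fun x : Q => transfer f c u x := by
  ext x
  rw [finiteTransfer_apply]
  exact hQ.transfer_congr (fun y hy =>
    Subtype.val_injective.extend_apply (fun x : Q => u x) 0 ⟨y, hy⟩) x x.2

/-- An eigenvalue `1` of the transfer operator produces an invariant functional. -/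
theorem IsInvariantSet.exists_invariant_functional {f : ℂ → ℂ} {U : Set ℂ} {c : ℂ} {Q : Finset ℂ}
    (hQ : IsInvariantSet f U c Q) {v : ℂ → ℂ} (hv : ∀ x ∈ Q, transfer f c v x = v x)
    (hne : ∃ x ∈ Q, v x ≠ 0) :
    ∃ ℓ : ℂ → ℂ, (∃ x ∈ Q, ℓ x ≠ 0) ∧
      ∀ u : ℂ → ℂ, ∑ x ∈ Q, ℓ x * transfer f c u x = ∑ x ∈ Q, ℓ x * u x := by
  classical
  obtain ⟨x₀, hx₀, hvx₀⟩ := hne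
  set A := finiteTransfer f c Q with hA
  have hker : LinearMap.ker (1 - A) ≠ ⊥ := by
    intro h
    have h1 : (fun x : Q => v x) ∈ LinearMap.ker (1 - A) := by
      rw [LinearMap.mem_ker, LinearMap.sub_apply, Module.End.one_apply,
        hQ.finiteTransfer_restrict v, sub_eq_zero]
      ext x
      exact (hv x x.2).symm
    rw [h, Submodule.mem_bot] at h1
    exact hvx₀ (congrFun h1 ⟨x₀, hx₀⟩)
  have hrange : LinearMap.range (1 - A) < ⊤ := by
    rw [lt_top_iff_ne_top]
    exact fun h => hker (LinearMap.ker_eq_bot_iff_range_eq_top.2 h)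
  -- In finite dimension a kernel of `1 - A` makes its range proper; a functional killing the range
  -- is invariant under `A`.
  obtain ⟨φ, hφ0, hφ⟩ := Submodule.exists_le_ker_of_lt_top _ hrange
  have hsum : ∀ u : Q → ℂ, φ u = ∑ x : Q, φ (Pi.single x 1) * u x := by
    intro u
    conv_lhs => rw [← Finset.univ_sum_single u]
    rw [map_sum]
    refine Finset.sum_congr rfl fun x _ => ?_
    have : (Pi.single x (u x) : Q → ℂ) = u x • Pi.single x 1 := by
      rw [← Pi.single_smul]; simp
    rw [this, map_smul, smul_eq_mul, mul_comm]
  set ℓ : ℂ → ℂ := Function.extend ((↑) : Q → ℂ) (fun x : Q => φ (Pi.single x 1)) 0 with hℓ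
  have hℓx : ∀ x : Q, ℓ x = φ (Pi.single x 1) := fun x =>
    Subtype.val_injective.extend_apply (fun x : Q => φ (Pi.single x 1)) 0 x
  have hφu : ∀ u : ℂ → ℂ, φ (fun x : Q => u x) = ∑ x ∈ Q, ℓ x * u x := by
    intro u
    rw [hsum, ← Finset.sum_coe_sort Q (fun x => ℓ x * u x)]
    exact Finset.sum_congr rfl fun x _ => by rw [hℓx]
  refine ⟨ℓ, ?_, fun u => ?_⟩
  · by_contra! hcon
    apply hφ0
    ext u
    rw [LinearMap.comp_apply, hsum]
    refine (Finset.sum_eq_zero fun x _ => ?_).trans (by simp)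
    rw [← hℓx, hcon x x.2, zero_mul]
  · rw [← hφu, ← hφu, ← hQ.finiteTransfer_restrict u]
    have h1 : (1 - A) (fun x : Q => u x) ∈ LinearMap.ker φ := hφ ⟨_, rfl⟩
    rw [LinearMap.mem_ker, LinearMap.sub_apply, map_sub, sub_eq_zero] at h1
    exact h1.symm

/-- A finite family of germs of holomorphic functions with distinct values at `0` is a motion. -/
theorem exists_motion_of_family {Q : Finset ℂ} {h : ℂ → ℂ → ℂ} (h0 : ∀ x ∈ Q, h 0 x = x)
    (hd : ∀ x ∈ Q, ∀ᶠ t in 𝓝 (0 : ℂ), DifferentiableAt ℂ (fun t => h t x) t) :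
    ∃ r : ℝ, 0 < r ∧ IsHolomorphicMotion (Q : Set ℂ) (ball 0 r) h := by
  have hev : ∀ᶠ t in 𝓝 (0 : ℂ), ∀ x ∈ Q, ∀ y ∈ Q, x ≠ y → h t x ≠ h t y := by
    refine (Finset.eventually_all Q).2 fun x hx => (Finset.eventually_all Q).2 fun y hy => ?_
    by_cases hxy : x = y
    · simp [hxy]
    have h1 : ContinuousAt (fun t : ℂ => h t x - h t y) 0 :=
      (hd x hx).self_of_nhds.continuousAt.sub (hd y hy).self_of_nhds.continuousAt
    have h2 : ∀ᶠ t in 𝓝 (0 : ℂ), h t x - h t y ≠ 0 :=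
      h1.eventually_ne (by simpa [sub_eq_zero, h0 x hx, h0 y hy] using hxy)
    filter_upwards [h2] with t ht _ h
    exact ht (sub_eq_zero.2 h)
  obtain ⟨r, hr, hb⟩ := Metric.eventually_nhds_iff_ball.1
    (hev.and ((Finset.eventually_all Q).2 hd))
  refine ⟨r, hr, ⟨h0, fun t ht x hx y hy hxy => ?_,
    fun x hx t ht => ((hb t ht).2 x hx).differentiableWithinAt⟩⟩
  by_contra hne
  exact (hb t ht).1 x hx y hy hne hxy

/-! ### Excluding the eigenvalue `1` -/

namespace IsClassF

variable {f : ℂ → ℂ} {U V : Set ℂ} {c : ℂ} {Q : Finset ℂ}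

theorem noIdentityGerm_of_mem (hf : IsClassF f U V) (hQ : IsInvariantSet f U c Q) :
    NoIdentityGerm f U c := by
  by_cases hc : c = 0
  · rw [hc]; exact hf.noIdentityGerm_zero
  · exact hf.noIdentityGerm (hQ.mem_source c hQ.base_mem hc)

/-- There is no invariant vector that vanishes at the critical value. -/
theorem false_of_fixed_vector_of_eq_zero (hf : IsClassF f U V) (hQ : IsInvariantSet f U c Q)
    {v : ℂ → ℂ} (hv : ∀ x ∈ Q, transfer f c v x = v x) (hvc : v c = 0)
    (hne : ∃ x ∈ Q, v x ≠ 0) : False := by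
  classical
  set F : ℂ → ℂ := fun z => c + f z with hF
  have hFadd : ∀ z, f z + c = F z := fun z => add_comm _ _
  have hv0 : 0 ∈ Q → v 0 = 0 := fun h => by rw [← hv 0 h, transfer_zero]
  have hQF : ∀ x ∈ Q, x ≠ 0 → F x ∈ Q := fun x hx h => hFadd x ▸ hQ.map_mem x hx h
  -- With `v c = 0` the fixed vector is transported by the derivative, so a nonzero value persists
  -- along a forward orbit and yields a periodic cycle avoiding `0`.
  have hvF : ∀ x ∈ Q, x ≠ 0 → v (F x) = deriv f x * v x := by
    intro x hx hx0
    have h1 := hv x hx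
    rw [transfer_apply _ _ _ hx0, hvc, sub_zero, hFadd,
      div_eq_iff (hf.deriv_ne_zero ⟨hQ.mem_source x hx hx0, hx0⟩)] at h1
    rw [h1, mul_comm]
  obtain ⟨x, hx, hvx⟩ := hne
  have horb : ∀ x ∈ Q, v x ≠ 0 → ∀ i, F^[i] x ∈ Q ∧ v (F^[i] x) ≠ 0 := by
    intro x hx hvx i
    induction i with
    | zero => exact ⟨hx, hvx⟩
    | succ i ih =>
      rw [Function.iterate_succ_apply']
      have h0 : F^[i] x ≠ 0 := fun h => ih.2 (by rw [h]; exact hv0 (h ▸ ih.1))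
      refine ⟨hQF _ ih.1 h0, ?_⟩
      rw [hvF _ ih.1 h0]
      exact mul_ne_zero (hf.deriv_ne_zero ⟨hQ.mem_source _ ih.1 h0, h0⟩) ih.2
  obtain ⟨i, j, hij, hper⟩ : ∃ i j, i < j ∧ F^[i] x = F^[j] x := by
    obtain ⟨i, j, hne, h⟩ := Finite.exists_ne_map_eq_of_infinite
      (fun i : ℕ => (⟨F^[i] x, (horb x hx hvx i).1⟩ : Q))
    have h' : F^[i] x = F^[j] x := congrArg Subtype.val h
    rcases hne.lt_or_gt with h1 | h1
    · exact ⟨i, j, h1, h'⟩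
    · exact ⟨j, i, h1, h'.symm⟩
  set x₀ := F^[i] x with hx₀
  have hx₀Q := (horb x hx hvx i).1
  have hvx₀ := (horb x hx hvx i).2
  have hpp : x₀ ∈ Function.periodicPts F := by
    refine ⟨j - i, by omega, ?_⟩
    change F^[j - i] x₀ = x₀
    rw [hx₀, ← Function.iterate_add_apply, Nat.sub_add_cancel hij.le]
    exact hper.symm
  set p := Function.minimalPeriod F x₀ with hp
  have hp0 : 0 < p := Function.minimalPeriod_pos_of_mem_periodicPts hpp
  have hFp : F^[p] x₀ = x₀ := Function.iterate_minimalPeriod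
  have hinj : ∀ i < p, ∀ j < p, F^[i] x₀ = F^[j] x₀ → i = j := fun i hi j hj h =>
    (Function.iterate_eq_iterate_iff_of_lt_minimalPeriod hi hj).1 h
  have horb₀ := horb x₀ hx₀Q hvx₀
  have hne0 : ∀ i, F^[i] x₀ ≠ 0 := fun i h => (horb₀ i).2 (by
    rw [h]; exact hv0 (h ▸ (horb₀ i).1))
  have horbU : ∀ i, F^[i] x₀ ∈ U \ {0} := fun i =>
    ⟨hQ.mem_source _ (horb₀ i).1 (hne0 i), hne0 i⟩
  set Z := Q.filter (fun z => v z = 0) with hZ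
  set C := (Finset.range p).image (fun i => F^[i] x₀) with hC
  set Q' := Z ∪ C with hQ'
  have hZQ : ∀ z, z ∈ Z ↔ z ∈ Q ∧ v z = 0 := fun z => Finset.mem_filter
  have hCm : ∀ z, z ∈ C ↔ ∃ i < p, F^[i] x₀ = z := fun z => by simp [hC]
  have hFC : ∀ i, F^[i] x₀ ∈ C := fun i => (hCm _).2
    ⟨i % p, Nat.mod_lt _ hp0, Function.iterate_mod_minimalPeriod_eq⟩
  have hdisj : Disjoint Z C := by
    rw [Finset.disjoint_left]
    intro z hz hz'
    obtain ⟨i, -, rfl⟩ := (hCm z).1 hz'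
    exact (horb₀ i).2 ((hZQ _).1 hz).2
  have hFZ : ∀ z ∈ Z, z ≠ 0 → F z ∈ Z := fun z hz hz0 => by
    rw [hZQ] at hz ⊢
    exact ⟨hQF z hz.1 hz0, by rw [hvF z hz.1 hz0, hz.2, mul_zero]⟩
  have hcZ : c ∈ Z := (hZQ c).2 ⟨hQ.base_mem, hvc⟩
  have hQ'inv : IsInvariantSet f U c Q' := by
    refine ⟨Finset.mem_union_left _ hcZ, fun z hz hz0 => ?_, fun z hz hz0 => ?_⟩
    · rcases Finset.mem_union.1 hz with h | h
      · exact hQ.mem_source z ((hZQ z).1 h).1 hz0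
      · obtain ⟨i, -, rfl⟩ := (hCm z).1 h
        exact (horbU i).1
    · rw [hFadd]
      rcases Finset.mem_union.1 hz with h | h
      · exact Finset.mem_union_left _ (hFZ z h hz0)
      · obtain ⟨i, -, rfl⟩ := (hCm z).1 h
        rw [← Function.iterate_succ_apply' F]
        exact Finset.mem_union_right _ (hFC _)
  -- the motion
  have hidx : ∀ z : ℂ, ∃ i, z ∈ C → i < p ∧ F^[i] x₀ = z := fun z => by
    by_cases hz : z ∈ C
    · obtain ⟨i, hi⟩ := (hCm z).1 hz
      exact ⟨i, fun _ => hi⟩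
    · exact ⟨0, fun h => (hz h).elim⟩
  choose idx hidx using hidx
  have hidx' : ∀ i < p, idx (F^[i] x₀) = i := fun i hi => by
    obtain ⟨h1, h2⟩ := hidx _ (hFC i)
    exact hinj _ h1 _ hi h2
  -- The zeros of `v`, among them `c`, are frozen, and the cycle follows the orbit of `x₀ + t` for
  -- `p - 1` steps. Only the closing step from `y = F^[p - 1] x₀` can violate the lifting relation.
  set h : ℂ → ℂ → ℂ := fun t z => if v z = 0 then z else F^[idx z] (x₀ + t) with hh
  have hhZ : ∀ t, ∀ z ∈ Z, h t z = z := fun t z hz => by simp [hh, ((hZQ z).1 hz).2]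
  have hhC : ∀ t, ∀ i < p, h t (F^[i] x₀) = F^[i] (x₀ + t) := fun t i hi => by
    simp [hh, (horb₀ i).2, hidx' i hi]
  have hshift : Tendsto (fun t : ℂ => x₀ + t) (𝓝 0) (𝓝 x₀) := by
    have : Continuous fun t : ℂ => x₀ + t := by fun_prop
    simpa using this.tendsto 0
  obtain ⟨r, hr, hmot⟩ := exists_motion_of_family (Q := Q') (h := h) (fun z hz => by
      rcases Finset.mem_union.1 hz with h' | h'
      · exact hhZ 0 z h'
      · obtain ⟨i, hi, rfl⟩ := (hCm z).1 h'
        rw [hhC 0 i hi, add_zero]) (fun z hz => by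
      rcases Finset.mem_union.1 hz with h' | h'
      · simp only [hhZ _ z h']
        exact Eventually.of_forall fun t => differentiableAt_const z
      · obtain ⟨i, hi, rfl⟩ := (hCm z).1 h'
        simp only [hhC _ i hi]
        have h1 := (hf.analyticAt_iterate (c := c) (z := x₀) (p := i)
          fun k _ => (horbU k).1).eventually_analyticAt
        filter_upwards [hshift.eventually h1] with t ht
        exact ht.differentiableAt.comp t
          (by fun_prop : DifferentiableAt ℂ (fun t : ℂ => x₀ + t) t))
  set y := F^[p - 1] x₀ with hy
  have hFy : F y = x₀ := by
    rw [hy, ← Function.iterate_succ_apply' F, Nat.succ_eq_add_one, Nat.sub_add_cancel hp0, hFp]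
  -- On functions vanishing on `Z` the operator acts on the cycle by `u ↦ (u ∘ F) / f'`. As `v ∘ F =
  -- f' v`, summing against `1 / v` is invariant by a cyclic shift; the convention `1 / 0 = 0`
  -- removes `Z` from the sum.
  let S : Submodule ℂ (ℂ → ℂ) :=
    { carrier := {u | ∀ z ∈ Z, u z = 0}
      add_mem' := fun {a b} ha hb z hz => by simp [ha z hz, hb z hz]
      zero_mem' := fun z _ => rfl
      smul_mem' := fun k a ha z hz => by simp [ha z hz] }
  have hrelation := hf.eventually_relation hQ'inv hr hmot
    (Eventually.of_forall fun t h0 => hhZ t 0 (by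
      rcases Finset.mem_union.1 h0 with h' | h'
      · exact h'
      · obtain ⟨i, -, hi⟩ := (hCm 0).1 h'
        exact (hne0 i hi).elim)) (y := y) (Finset.mem_union_right _ (hFC _)) (hne0 _) (by
      intro z hz hz0 hzy
      refine Eventually.of_forall fun t => ?_
      rw [hFadd, hhZ t c hcZ]
      rcases Finset.mem_union.1 hz with h' | h'
      · rw [hhZ t z h', hhZ t _ (hFZ z h' hz0), hF]; ring
      · obtain ⟨i, hi, rfl⟩ := (hCm z).1 h'
        have hi' : i + 1 < p := by
          rcases (show i = p - 1 ∨ i + 1 < p by omega) with h1 | h1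
          · exact (hzy (by rw [h1])).elim
          · exact h1
        rw [← Function.iterate_succ_apply' F, hhC t _ hi', hhC t _ hi,
          Function.iterate_succ_apply']
        change c + f _ - c = _
        ring) S (by
      intro z hz
      refine Pi.single_eq_of_ne (fun hzy => ?_) _
      exact Finset.disjoint_left.1 hdisj hz (hzy ▸ hFC _)) (fun x => 1 / v x)
    (one_div_ne_zero (horb₀ _).2) (by
      intro u hu
      refine ⟨fun z hz => ?_, ?_⟩
      · by_cases hz0 : z = 0
        · rw [hz0, transfer_zero]
        · rw [transfer_apply _ _ _ hz0, hFadd, hu _ (hFZ z hz hz0), hu c hcZ, sub_zero, zero_div]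
      · rw [Finset.sum_union hdisj, Finset.sum_union hdisj]
        congr 1
        · refine Finset.sum_congr rfl fun z hz => ?_
          rw [((hZQ z).1 hz).2]; simp
        · rw [hC, Finset.sum_image (fun i hi j hj h => hinj i (by simpa using hi) j
            (by simpa using hj) h), Finset.sum_image (fun i hi j hj h => hinj i
            (by simpa using hi) j (by simpa using hj) h)]
          have h1 : ∀ i, 1 / v (F^[i] x₀) * transfer f c u (F^[i] x₀) =
              1 / v (F^[i + 1] x₀) * u (F^[i + 1] x₀) := by
            intro i
            rw [transfer_apply _ _ _ (hne0 i), hFadd, hu c hcZ, sub_zero,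
              Function.iterate_succ_apply', hvF _ (horb₀ i).1 (hne0 i)]
            have h2 := hf.deriv_ne_zero (horbU i)
            have h3 := (horb₀ i).2
            field_simp
          rw [Finset.sum_congr rfl fun i _ => h1 i]
          have h2 := Finset.sum_range_succ (fun i => 1 / v (F^[i] x₀) * u (F^[i] x₀)) p
          rw [Finset.sum_range_succ', hFp] at h2
          exact add_right_cancel h2)
  have hid : ∀ᶠ t in 𝓝 (0 : ℂ), F^[p] (x₀ + t) = x₀ + t := by
    filter_upwards [hrelation] with t ht
    have h1 := hhC t 0 hp0
    simp only [Function.iterate_zero, id] at h1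
    rw [hFadd, hFy, h1, hhZ t c hcZ, hy, hhC t _ (by omega)] at ht
    have h2 : F^[p] (x₀ + t) = F (F^[p - 1] (x₀ + t)) := by
      rw [← Function.iterate_succ_apply' F, Nat.succ_eq_add_one, Nat.sub_add_cancel hp0]
    rw [h2, hF]
    simp only
    rw [← ht]
    ring
  refine hf.noIdentityGerm_of_mem hQ x₀ p hp0 (fun i _ => horbU i) ?_
  have h1 : Tendsto (fun z : ℂ => z - x₀) (𝓝 x₀) (𝓝 0) := by
    have : Continuous fun z : ℂ => z - x₀ := by fun_prop
    simpa using this.tendsto x₀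
  filter_upwards [h1.eventually hid] with z hz
  simpa using hz

/-- There is no invariant vector that does not vanish at the critical value. -/
theorem false_of_fixed_vector_of_ne_zero (hf : IsClassF f U V) (hQ : IsInvariantSet f U c Q)
    {v : ℂ → ℂ} (hv : ∀ x ∈ Q, transfer f c v x = v x) (hvc : v c ≠ 0) : False := by
  classical
  have hc0 : c ≠ 0 := fun h => hvc (by
    rw [← hv c hQ.base_mem]
    nth_rewrite 2 [h]
    rw [transfer_zero])
  set X : ℕ → ℂ := fun i => chain f id id i c with hX
  have hX0 : X 0 = c := rfl
  have hXs : ∀ i, f (X i) + c = X (i + 1) := fun i => add_comm _ _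
  have hex : ∃ n, X n = 0 ∨ ∃ l < n, X n = X l := by
    by_contra! hcon
    have hmem : ∀ i, X i ∈ Q := by
      intro i
      induction i with
      | zero => exact hQ.base_mem
      | succ i ih => rw [← hXs]; exact hQ.map_mem _ ih (hcon i).1
    obtain ⟨i, j, hne, h⟩ := Finite.exists_ne_map_eq_of_infinite
      (fun i : ℕ => (⟨X i, hmem i⟩ : Q))
    have h' : X i = X j := congrArg Subtype.val h
    rcases hne.lt_or_gt with h1 | h1
    · exact (hcon j).2 i h1 h'.symm
    · exact (hcon i).2 j h1 h'
  -- The first time at which the orbit of `c` reaches `0` or an earlier orbit point.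
  set n := Nat.find hex with hn
  have hspec := Nat.find_spec hex
  have hmin : ∀ m < n, X m ≠ 0 ∧ ∀ l < m, X m ≠ X l := fun m hm => by
    have := Nat.find_min hex hm
    push Not at this
    exact this
  rw [← hn] at hspec
  have hn0 : 0 < n := by
    rcases Nat.eq_zero_or_pos n with h | h
    · rw [h] at hspec
      rcases hspec with h1 | ⟨l, h1, -⟩
      · exact (hc0 h1).elim
      · omega
    · exact h
  have hXQ : ∀ i ≤ n, X i ∈ Q := by
    intro i
    induction i with
    | zero => exact fun _ => hQ.base_mem
    | succ i ih =>
      intro hi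
      rw [← hXs]
      exact hQ.map_mem _ (ih (by omega)) (hmin i (by omega)).1
  have hXU : ∀ i < n, X i ∈ U \ {0} := fun i hi =>
    ⟨hQ.mem_source _ (hXQ i hi.le) (hmin i hi).1, (hmin i hi).1⟩
  have hXinj : ∀ i < n, ∀ j < n, X i = X j → i = j := by
    intro i hi j hj h
    rcases lt_trichotomy i j with h1 | h1 | h1
    · exact ((hmin j hj).2 i h1 h.symm).elim
    · exact h1
    · exact ((hmin i hi).2 j h1 h).elim
  have hXc : ∀ i < n, X (i + 1) ≠ c := fun i hi h => by
    rw [← hXs] at h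
    exact (hf.apply_mem (hXU i hi)).2 (add_eq_right.1 h)
  set Q' := (Finset.range (n + 1)).image X with hQ'
  have hQ'm : ∀ z, z ∈ Q' ↔ ∃ i ≤ n, X i = z := fun z => by simp [hQ']
  have hQ'lt : ∀ z ∈ Q', z ≠ 0 → ∃ i < n, X i = z := by
    intro z hz hz0
    obtain ⟨i, hi, rfl⟩ := (hQ'm z).1 hz
    rcases hi.lt_or_eq with hi | rfl
    · exact ⟨i, hi, rfl⟩
    · rcases hspec with h | ⟨l, hl, h⟩
      · exact (hz0 h).elim
      · exact ⟨l, hl, h.symm⟩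
  have hQ'inv : IsInvariantSet f U c Q' := by
    refine ⟨(hQ'm c).2 ⟨0, Nat.zero_le _, rfl⟩, fun z hz hz0 => ?_, fun z hz hz0 => ?_⟩
    · obtain ⟨i, hi, rfl⟩ := hQ'lt z hz hz0
      exact (hXU i hi).1
    · obtain ⟨i, hi, rfl⟩ := hQ'lt z hz hz0
      rw [hXs]
      exact (hQ'm _).2 ⟨i + 1, hi, rfl⟩
  have hcQ' := hQ'inv.base_mem
  have hQ'Q : ∀ z ∈ Q', z ∈ Q := fun z hz => by
    obtain ⟨i, hi, rfl⟩ := (hQ'm z).1 hz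
    exact hXQ i hi
  obtain ⟨ℓ, ⟨y₀, hy₀, hℓy₀⟩, hℓ⟩ := hQ'inv.exists_invariant_functional
    (fun x hx => hv x (hQ'Q x hx)) ⟨c, hcQ', hvc⟩
  set y := X (n - 1) with hy
  have hyX : f y + c = X n := by rw [hy, hXs, Nat.sub_add_cancel hn0]
  have hsingle : ∀ z, z ≠ c → ∀ x, transfer f c (Pi.single z 1) x =
      if x ≠ 0 ∧ f x + c = z then 1 / deriv f x else 0 := by
    intro z hz x
    by_cases hx0 : x = 0
    · rw [hx0, transfer_zero]; simp
    · rw [transfer_apply _ _ _ hx0, Pi.single_eq_of_ne hz.symm, sub_zero, Pi.single_apply]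
      by_cases h1 : f x + c = z <;> simp [h1, hx0]
  have hℓsingle : ∀ z ∈ Q', ∑ x ∈ Q', ℓ x * (Pi.single z 1 : ℂ → ℂ) x = ℓ z := by
    intro z hz
    rw [Finset.sum_eq_single z]
    · simp
    · intro x _ hxz; simp [hxz]
    · exact fun h => (h hz).elim
  -- Testing invariance on `Pi.single z 1` expresses `ℓ z`, for `z ≠ c`, through the predecessors of
  -- `z` in `Q'`. The predecessors of `X (i + 1)`, for `i + 1 < n`, are `X i` and possibly `y`, and
  -- `0` has at most `y`. So `ℓ y = 0` would force `ℓ = 0` on `Q'`.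
  have hℓy : ℓ y ≠ 0 := by
    intro hy0
    have hdown : ∀ k i, i + k + 1 = n → ℓ (X i) = 0 := by
      intro k
      induction k with
      | zero =>
        intro i hi
        have : i = n - 1 := by omega
        rw [this]; exact hy0
      | succ k ih =>
        intro i hi
        have h1 := hℓ (Pi.single (X (i + 1)) 1)
        rw [hℓsingle _ ((hQ'm _).2 ⟨i + 1, by omega, rfl⟩), ih (i + 1) (by omega)] at h1
        simp only [hsingle _ (hXc i (by omega))] at h1
        rw [Finset.sum_eq_single (X i)] at h1
        · rw [if_pos ⟨(hXU i (by omega)).2, hXs i⟩] at h1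
          exact (mul_eq_zero.1 h1).resolve_right
            (one_div_ne_zero (hf.deriv_ne_zero (hXU i (by omega))))
        · intro x hx hxi
          split_ifs with hcond
          · obtain ⟨j, hj, rfl⟩ := hQ'lt x hx hcond.1
            rw [hXs] at hcond
            rcases (show j + 1 < n ∨ j = n - 1 by omega) with h2 | h2
            · have := hXinj _ h2 _ (by omega) hcond.2
              exact (hxi (by rw [show j = i by omega])).elim
            · rw [h2, ← hy, hy0, zero_mul]
          · rw [mul_zero]
        · exact fun h => (h ((hQ'm _).2 ⟨i, by omega, rfl⟩)).elim
    by_cases h0 : y₀ = 0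
    · subst h0
      have h1 := hℓ (Pi.single 0 1)
      rw [hℓsingle _ hy₀] at h1
      simp only [hsingle _ hc0.symm] at h1
      rw [Finset.sum_eq_zero] at h1
      · exact hℓy₀ h1.symm
      · intro x hx
        split_ifs with hcond
        · obtain ⟨j, hj, rfl⟩ := hQ'lt x hx hcond.1
          rw [hXs] at hcond
          rcases (show j + 1 < n ∨ j = n - 1 by omega) with h2 | h2
          · exact ((hmin _ h2).1 hcond.2).elim
          · rw [h2, ← hy, hy0, zero_mul]
        · rw [mul_zero]
    · obtain ⟨i, hi, rfl⟩ := hQ'lt y₀ hy₀ h0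
      exact hℓy₀ (hdown (n - 1 - i) i (by omega))
  -- the motion
  have hidx : ∀ z : ℂ, ∃ i, (∃ j < n, X j = z) → i < n ∧ X i = z := fun z => by
    by_cases hz : ∃ j < n, X j = z
    · obtain ⟨i, hi⟩ := hz
      exact ⟨i, fun _ => hi⟩
    · exact ⟨0, fun h => (hz h).elim⟩
  choose idx hidx using hidx
  have hidx' : ∀ i < n, idx (X i) = i := fun i hi => by
    obtain ⟨h1, h2⟩ := hidx _ ⟨i, hi, rfl⟩
    exact hXinj _ h1 _ hi h2
  -- The motion follows the critical orbit as the parameter moves from `c` to `c + t`; only the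
  -- relation closing the orbit at step `n` is not built in.
  set h : ℂ → ℂ → ℂ := fun t z => if z = 0 then 0 else chain f id id (idx z) (c + t) with hh
  have hh0 : ∀ t, h t 0 = 0 := fun t => by simp [hh]
  have hhX : ∀ t, ∀ i < n, h t (X i) = chain f id id i (c + t) := fun t i hi => by
    simp [hh, (hmin i hi).1, hidx' i hi]
  have hhc : ∀ t, h t c = c + t := fun t => hhX t 0 hn0
  have hshift : Tendsto (fun t : ℂ => c + t) (𝓝 0) (𝓝 c) := by
    have : Continuous fun t : ℂ => c + t := by fun_prop
    simpa using this.tendsto 0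
  have hcD : c ∈ chainDomain f U id id univ n := ⟨mem_univ _, hXU⟩
  obtain ⟨r, hr, hmot⟩ := exists_motion_of_family (Q := Q') (h := h) (fun z hz => by
      by_cases hz0 : z = 0
      · rw [hz0, hh0]
      · obtain ⟨i, hi, rfl⟩ := hQ'lt z hz hz0
        rw [hhX 0 i hi, add_zero]) (fun z hz => by
      by_cases hz0 : z = 0
      · simp only [hz0, hh0]
        exact Eventually.of_forall fun t => differentiableAt_const _
      · obtain ⟨i, hi, rfl⟩ := hQ'lt z hz hz0
        simp only [hhX _ i hi]
        have h1 := (hf.isOpen_chainDomain (n := n) isOpen_univ differentiableOn_id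
          differentiableOn_id).mem_nhds hcD
        filter_upwards [hshift.eventually_mem h1] with t ht
        exact (hf.differentiableAt_chain isOpen_univ differentiableOn_id differentiableOn_id
          ht.1 fun j hj => ht.2 j (hj.trans hi)).comp t
            (by fun_prop : DifferentiableAt ℂ (fun t : ℂ => c + t) t))
  have hrelation := hf.eventually_relation hQ'inv hr hmot
    (Eventually.of_forall fun t _ => hh0 t) (y := y) ((hQ'm _).2 ⟨n - 1, by omega, rfl⟩)
    (hmin _ (by omega)).1 (by
      intro z hz hz0 hzy
      refine Eventually.of_forall fun t => ?_
      obtain ⟨i, hi, rfl⟩ := hQ'lt z hz hz0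
      have hi' : i + 1 < n := by
        rcases (show i = n - 1 ∨ i + 1 < n by omega) with h1 | h1
        · exact (hzy (by rw [h1])).elim
        · exact h1
      rw [hXs, hhc, hhX t _ hi', hhX t _ hi]
      simp [chain]) ⊤ trivial ℓ hℓy (fun u _ => ⟨trivial, hℓ u⟩)
  have hsub : Tendsto (fun z : ℂ => z - c) (𝓝 c) (𝓝 0) := by
    have : Continuous fun z : ℂ => z - c := by fun_prop
    simpa using this.tendsto c
  have hlast : ∀ᶠ t in 𝓝 (0 : ℂ), chain f id id n (c + t) = h t (X n) := by
    filter_upwards [hrelation] with t ht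
    rw [hyX, hhc, hy, hhX t (n - 1) (by omega)] at ht
    have h1 : chain f id id n (c + t) = c + t + f (chain f id id (n - 1) (c + t)) := by
      conv_lhs => rw [← Nat.sub_add_cancel hn0]
      rfl
    rw [h1, ← ht]
    ring
  rcases hspec with h0 | ⟨l, hl, h0⟩
  · refine hf.not_eventually_orbit_relation hn0 hXU (Or.inl rfl) ?_
    filter_upwards [hsub.eventually hlast] with z hz
    rw [h0, hh0] at hz
    simpa using hz
  -- A return to `X 0 = c` would need `f` to vanish at `X (n - 1)`.
  · have hl1 : 1 ≤ l := by
      rcases Nat.eq_zero_or_pos l with rfl | h1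
      · have := hXc (n - 1) (by omega)
        rw [Nat.sub_add_cancel hn0] at this
        exact (this h0).elim
      · exact h1
    refine hf.not_eventually_orbit_relation hn0 hXU (Or.inr ⟨l, hl1, hl, rfl⟩) ?_
    filter_upwards [hsub.eventually hlast] with z hz
    rw [h0, hhX _ l hl] at hz
    simpa using hz

/-- `1` is not an eigenvalue of the transfer operator. -/
theorem eigenvalue_ne_one (hf : IsClassF f U V) (hQ : IsInvariantSet f U c Q) {v : ℂ → ℂ}
    (hv : ∀ x ∈ Q, transfer f c v x = v x) (hne : ∃ x ∈ Q, v x ≠ 0) : False := by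
  by_cases hvc : v c = 0
  · exact hf.false_of_fixed_vector_of_eq_zero hQ hv hvc hne
  · exact hf.false_of_fixed_vector_of_ne_zero hQ hv hvc

end IsClassF

/-! ### The characteristic determinant along an orbit -/

/-- The determinant of a unipotent bidiagonal matrix perturbed in its first column and its last
row. -/
theorem det_bidiagonal_perturbation (m k : ℕ) (hk : k ≤ m) (t : ℕ → ℂ) :
    Matrix.det (Matrix.of fun i j : Fin (m + 1) => (if i = j then (1 : ℂ) else 0) -
      t i * ((if (j : ℕ) = if (i : ℕ) = m then k else i + 1 then 1 else 0) -
        if (j : ℕ) = 0 then 1 else 0)) =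
      ∑ i ∈ Finset.range (m + 2), ∏ j ∈ Finset.range i, t j -
        (∏ j ∈ Finset.Ico k (m + 1), t j) *
          ∑ i ∈ Finset.range (k + 1), ∏ j ∈ Finset.range i, t j := by
  set N : Matrix (Fin (m + 1)) (Fin (m + 1)) ℂ := Matrix.of fun i j =>
    (if i = j then (1 : ℂ) else 0) - t i * (if (j : ℕ) = i + 1 then 1 else 0) with hN
  -- `y` and `z` solve `N y = t` and `N z = e_m`. The perturbation `t e_0ᵀ - t_m e_m e_kᵀ` therefore
  -- equals `N Y W`, and exchanging `Y` and `W` reduces the determinant to size two.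
  set y : ℕ → ℂ := fun i => ∑ s ∈ Finset.Ico i (m + 1), ∏ j ∈ Finset.Ico i (s + 1), t j with hy
  set z : ℕ → ℂ := fun i => ∏ j ∈ Finset.Ico i m, t j with hz
  set Y : Matrix (Fin (m + 1)) (Fin 2) ℂ := Matrix.of fun i => ![y i, z i] with hY
  set W : Matrix (Fin 2) (Fin (m + 1)) ℂ := Matrix.of ![fun j => if (j : ℕ) = 0 then 1 else 0,
    fun j => -(t m * if (j : ℕ) = k then 1 else 0)] with hW
  have hY0 : ∀ i, Y i 0 = y i := fun i => rfl
  have hY1 : ∀ i, Y i 1 = z i := fun i => rfl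
  have hyrec : ∀ i ≤ m, y i = t i + t i * y (i + 1) := by
    intro i hi
    simp only [hy]
    rw [Finset.sum_eq_sum_Ico_succ_bot (by omega), Finset.mul_sum]
    congr 1
    · simp
    · refine Finset.sum_congr rfl fun s hs => ?_
      rw [Finset.mem_Ico] at hs
      rw [Finset.prod_eq_prod_Ico_succ_bot (by omega)]
  have hzrec : ∀ i < m, z i = t i * z (i + 1) := fun i hi =>
    Finset.prod_eq_prod_Ico_succ_bot hi t
  have hym : y (m + 1) = 0 := by simp [hy]
  have hzm : z m = 1 := by simp [hz]
  have hNdet : N.det = 1 := by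
    rw [Matrix.det_of_isUpperTriangular]
    · refine Finset.prod_eq_one fun i _ => ?_
      simp [hN]
    · intro i j hij
      have hij' : (j : ℕ) < i := hij
      have h1 : i ≠ j := fun h => by rw [h] at hij'; omega
      have h2 : (j : ℕ) ≠ i + 1 := by omega
      simp [hN, h1, h2]
  have hNmul : ∀ (u : ℕ → ℂ) (i : Fin (m + 1)), ∑ j, N i j * u j =
      u i - t i * if (i : ℕ) = m then 0 else u (i + 1) := by
    intro u i
    simp only [hN, Matrix.of_apply, sub_mul, Finset.sum_sub_distrib, ite_mul, one_mul, zero_mul,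
      Finset.sum_ite_eq, Finset.mem_univ, if_true, mul_assoc, ← Finset.mul_sum]
    congr 2
    by_cases him : (i : ℕ) = m
    · rw [if_pos him]
      refine Finset.sum_eq_zero fun j _ => if_neg ?_
      have := j.2
      omega
    · rw [if_neg him]
      have hlt : (i : ℕ) + 1 < m + 1 := by have := i.2; omega
      rw [Finset.sum_eq_single (⟨i + 1, hlt⟩ : Fin (m + 1))]
      · simp
      · intro j _ hj
        exact if_neg fun h => hj (Fin.ext h)
      · simp
  have hfac : (Matrix.of fun i j : Fin (m + 1) => (if i = j then (1 : ℂ) else 0) -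
      t i * ((if (j : ℕ) = if (i : ℕ) = m then k else i + 1 then 1 else 0) -
        if (j : ℕ) = 0 then 1 else 0)) = N * (1 + Y * W) := by
    ext i j
    rw [mul_add, mul_one, ← Matrix.mul_assoc, Matrix.add_apply, Matrix.mul_apply (M := N * Y),
      Fin.sum_univ_two, Matrix.mul_apply, Matrix.mul_apply]
    have h1 : ∑ j, N i j * Y j 0 = t i := by
      have := hNmul y i
      simp only [hY0]
      rw [this]
      by_cases him : (i : ℕ) = m
      · rw [if_pos him, hyrec i (by omega), him, hym]; ring
      · rw [if_neg him, hyrec i (by have := i.2; omega)]; ring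
    have h2 : ∑ j, N i j * Y j 1 = if (i : ℕ) = m then 1 else 0 := by
      have := hNmul z i
      simp only [hY1]
      rw [this]
      by_cases him : (i : ℕ) = m
      · rw [if_pos him, if_pos him, him, hzm]; ring
      · rw [if_neg him, if_neg him, hzrec i (by have := i.2; omega)]; ring
    rw [h1, h2]
    simp only [hN, hW, Matrix.of_apply, Matrix.cons_val_zero, Matrix.cons_val_one]
    by_cases him : (i : ℕ) = m
    · have h3 : ¬ (j : ℕ) = i + 1 := by have := j.2; omega
      rw [if_pos him, if_pos him, if_neg h3, him]
      ring
    · rw [if_neg him, if_neg him]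
      ring
  rw [hfac, Matrix.det_mul, hNdet, one_mul, Matrix.det_one_add_mul_comm, Matrix.det_fin_two]
  have hWY : ∀ c : Fin 2, (W * Y) 0 c = Y 0 c ∧ ∀ h : k < m + 1, (W * Y) 1 c =
      -(t m * Y ⟨k, h⟩ c) := by
    intro c
    rw [Matrix.mul_apply, Matrix.mul_apply]
    constructor
    · rw [Finset.sum_eq_single 0]
      · simp [hW]
      · intro j _ hj
        simp [hW, hj]
      · simp
    · intro h
      rw [Finset.sum_eq_single ⟨k, h⟩]
      · simp [hW]
      · intro j _ hj
        have : (j : ℕ) ≠ k := fun h => hj (Fin.ext h)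
        simp [hW, this]
      · simp
  have hkm : k < m + 1 := by omega
  simp only [Matrix.add_apply, (hWY _).1, (hWY _).2 hkm, Matrix.one_apply_eq,
    Matrix.one_apply_ne (zero_ne_one), Matrix.one_apply_ne (one_ne_zero)]
  simp only [hY0, hY1, Fin.val_zero]
  set P := ∏ j ∈ Finset.Ico k (m + 1), t j with hP
  set T := ∏ j ∈ Finset.range k, t j with hT
  have hPz : t m * z k = P := by
    rw [hP, Finset.prod_Ico_succ_top (by omega), mul_comm]
  have hz0 : z 0 = T * z k := by
    rw [hT, Finset.range_eq_Ico]
    exact (Finset.prod_Ico_consecutive t (Nat.zero_le k) hk).symm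
  have hy0 : ∀ n, n ≤ m + 1 → ∑ i ∈ Finset.range (n + 1), ∏ j ∈ Finset.range i, t j +
      (∏ j ∈ Finset.range n, t j) * y n =
      ∑ i ∈ Finset.range (m + 2), ∏ j ∈ Finset.range i, t j := by
    intro n hn
    have h1 := Finset.sum_range_add_sum_Ico (fun i => ∏ j ∈ Finset.range i, t j)
      (show n + 1 ≤ m + 2 by omega)
    rw [← h1]
    congr 1
    rw [hy, Finset.mul_sum, ← Finset.sum_Ico_add' _ n (m + 1) 1]
    refine Finset.sum_congr rfl fun s hs => ?_
    rw [Finset.mem_Ico] at hs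
    rw [Finset.range_eq_Ico, Finset.range_eq_Ico,
      Finset.prod_Ico_consecutive t (Nat.zero_le n) (by omega)]
  have h0 := hy0 0 (by omega)
  have hk' := hy0 k (by omega)
  simp only [Finset.sum_range_one, zero_add, Finset.prod_range_zero, one_mul] at h0
  rw [← hT] at hk'
  rw [← h0] at hk' ⊢
  linear_combination (-(1 + y 0)) * hPz + t m * y k * hz0 + y k * T * hPz + P * hk'

/-- In the enumeration `x` the operator reads off the successor coordinate minus the coordinate `0`
of `c`. Setting `t j = 0` where `x j = 0` encodes the fixed marked point, and makes `k` irrelevant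
when the last point is marked. -/
theorem det_one_sub_finiteTransfer {f : ℂ → ℂ} {U : Set ℂ} {c : ℂ} {Q : Finset ℂ}
    (hQ : IsInvariantSet f U c Q) {m k : ℕ} (hk : k ≤ m) {x : ℕ → ℂ}
    (hQx : Q = (Finset.range (m + 1)).image x) (hinj : InjOn x (Iio (m + 1))) (hx0 : x 0 = c)
    (hx : ∀ i < m, x i ≠ 0 ∧ f (x i) + c = x (i + 1)) (hxm : x m ≠ 0 → f (x m) + c = x k)
    {ρ : ℂ} {t : ℕ → ℂ} (ht : ∀ j ≤ m, t j = if x j = 0 then 0 else ρ / deriv f (x j)) :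
    LinearMap.det (1 - ρ • finiteTransfer f c Q) =
      ∑ i ∈ Finset.range (m + 2), ∏ j ∈ Finset.range i, t j -
        (∏ j ∈ Finset.Ico k (m + 1), t j) *
          ∑ i ∈ Finset.range (k + 1), ∏ j ∈ Finset.range i, t j := by
  classical
  rw [← det_bidiagonal_perturbation m k hk t, ← LinearMap.det_toMatrix']
  have hmem : ∀ i : Fin (m + 1), x i ∈ Q := fun i => by
    rw [hQx]; exact Finset.mem_image_of_mem x (Finset.mem_range.2 i.2)
  let e : Fin (m + 1) ≃ Q := Equiv.ofBijective (fun i => ⟨x i, hmem i⟩) ⟨fun i j h =>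
    Fin.ext (hinj i.2 j.2 (congrArg Subtype.val h)), fun z => by
      obtain ⟨i, hi, hiz⟩ := Finset.mem_image.1 (hQx.subset z.2)
      exact ⟨⟨i, Finset.mem_range.1 hi⟩, Subtype.ext hiz⟩⟩
  have hev : ∀ i, (e i : ℂ) = x i := fun i => rfl
  rw [← Matrix.det_submatrix_equiv_self e]
  congr 1
  ext i j
  rw [Matrix.submatrix_apply, LinearMap.toMatrix'_apply, LinearMap.sub_apply, Pi.sub_apply,
    LinearMap.smul_apply, Pi.smul_apply, smul_eq_mul, Module.End.one_apply, Matrix.of_apply]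
  have hxx : ∀ a b, a ≤ m → b ≤ m → (x a = x b ↔ b = a) := fun a b ha hb =>
    ⟨fun h => (hinj (Nat.lt_succ_of_le ha) (Nat.lt_succ_of_le hb) h).symm, fun h => h ▸ rfl⟩
  have hjm : (j : ℕ) ≤ m := Nat.lt_succ_iff.1 j.2
  have him : (i : ℕ) ≤ m := Nat.lt_succ_iff.1 i.2
  have h1 : (Pi.single (e j) 1 : Q → ℂ) = fun z : Q => (Pi.single (x j) 1 : ℂ → ℂ) z := by
    ext z
    by_cases hz : z = e j
    · subst hz; simp [hev]
    · have : (z : ℂ) ≠ x j := fun h => hz (Subtype.ext h)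
      rw [Pi.single_eq_of_ne hz, Pi.single_eq_of_ne this]
  have h1' : (Pi.single (e j) 1 : Q → ℂ) (e i) = if i = j then 1 else 0 := by
    rw [Pi.single_apply]
    simp
  rw [← h1', h1, hQ.finiteTransfer_restrict, ht i him]
  congr 1
  change ρ * transfer f c (Pi.single (x j) 1) (x i) = _
  by_cases hxi : x i = 0
  · rw [hxi, transfer_zero, if_pos rfl, mul_zero, zero_mul]
  · rw [transfer_apply _ _ _ hxi, if_neg hxi, ← hx0]
    have h2 : f (x i) + x 0 = x (if (i : ℕ) = m then k else i + 1) := by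
      rw [hx0]
      by_cases h : (i : ℕ) = m
      · rw [if_pos h, h]; exact hxm (h ▸ hxi)
      · rw [if_neg h]; exact (hx i (by omega)).2
    have h3 : (if (i : ℕ) = m then k else i + 1) ≤ m := by split_ifs <;> omega
    rw [h2, Pi.single_apply, Pi.single_apply]
    simp only [hxx _ _ h3 hjm, hxx 0 _ (Nat.zero_le _) hjm]
    ring

/-! ### Spectral conclusions -/

namespace IsClassF

variable {f : ℂ → ℂ} {U V : Set ℂ} {c : ℂ} {Q : Finset ℂ} {g : MarkedMap 1}

theorem exists_eigenvector {A : Module.End ℂ (Q → ℂ)} {μ : ℂ} (hμ : μ ∈ spectrum ℂ A) :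
    ∃ u : Q → ℂ, u ≠ 0 ∧ A u = μ • u := by
  obtain ⟨u, hu⟩ := (Module.End.hasEigenvalue_iff_mem_spectrum.2 hμ).exists_hasEigenvector
  exact ⟨u, hu.2, hu.apply_eq_smul⟩

/-- Eigenvectors of the transfer operator on `Q`, as functions on `ℂ`. -/
theorem exists_eigenfunction {μ : ℂ}
    (hμ : μ ∈ spectrum ℂ (finiteTransfer f c Q)) :
    ∃ v : ℂ → ℂ, (∀ x ∈ Q, transfer f c v x = μ * v x) ∧ ∃ x ∈ Q, v x ≠ 0 := by
  obtain ⟨u, hu0, hu⟩ := exists_eigenvector hμ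
  set v : ℂ → ℂ := Function.extend ((↑) : Q → ℂ) u 0 with hv
  have hvu : ∀ x : Q, v x = u x := fun x => Subtype.val_injective.extend_apply u 0 x
  refine ⟨v, fun x hx => ?_, ?_⟩
  · have := congrFun hu ⟨x, hx⟩
    rw [finiteTransfer_apply] at this
    rw [hv, this, ← hv, hvu ⟨x, hx⟩]
    rfl
  · by_contra! hcon
    exact hu0 (funext fun x => by rw [← hvu x, hcon x x.2]; rfl)

theorem spectrum_finiteTransfer (hf : IsClassF f U V) (hQ : IsInvariantSet f U c Q) :
    spectrum ℂ (finiteTransfer f c Q) ⊆ closedBall (0 : ℂ) 1 \ {1} := by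
  intro μ hμ
  obtain ⟨v, hv, hne⟩ := exists_eigenfunction hμ
  refine ⟨by simpa using hf.norm_eigenvalue_le_one hQ hv hne, fun h => ?_⟩
  rw [mem_singleton_iff.1 h] at hv
  exact hf.eigenvalue_ne_one hQ (fun x hx => by rw [hv x hx, one_mul]) hne

theorem spectralRadius_finiteTransfer (hf : IsClassF f U V) (hQ : IsInvariantSet f U c Q)
    (hV : closedBall (0 : ℂ) (Metric.diam U) ⊆ V) :
    spectralRadius ℂ (finiteTransfer f c Q) < 1 := by
  have hfin : (spectrum ℂ (finiteTransfer f c Q)).Finite := Module.End.finite_spectrum _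
  have : spectralRadius ℂ (finiteTransfer f c Q) =
      hfin.toFinset.sup fun k => (‖k‖₊ : ENNReal) := by
    rw [Finset.sup_eq_iSup]
    simp [spectralRadius]
  rw [this, Finset.sup_lt_iff (by simp)]
  intro μ hμ
  obtain ⟨v, hv, hne⟩ := exists_eigenfunction (hfin.mem_toFinset.1 hμ)
  have := hf.norm_eigenvalue_lt_one hQ hV hv hne
  exact_mod_cast this

/-- A kernel vector of `1 - ρ A` is an eigenvector of `A` for `ρ⁻¹`, of modulus at least `1`. -/
theorem det_one_sub_smul_ne_zero (hf : IsClassF f U V) (hQ : IsInvariantSet f U c Q)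
    (hV : closedBall (0 : ℂ) (Metric.diam U) ⊆ V) {ρ : ℂ} (hρ : ‖ρ‖ ≤ 1) :
    LinearMap.det (1 - ρ • finiteTransfer f c Q) ≠ 0 := by
  intro h
  obtain ⟨u, hu, hu0⟩ := (Submodule.ne_bot_iff _).1 (LinearMap.bot_lt_ker_of_det_eq_zero h).ne'
  rw [LinearMap.mem_ker, LinearMap.sub_apply, Module.End.one_apply, LinearMap.smul_apply,
    sub_eq_zero] at hu
  have hρ0 : ρ ≠ 0 := fun h0 => hu0 (by rw [hu, h0, zero_smul])
  have hmem : ρ⁻¹ ∈ spectrum ℂ (finiteTransfer f c Q) := by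
    refine Module.End.hasEigenvalue_iff_mem_spectrum.1
      (Module.End.hasEigenvalue_of_hasEigenvector (x := u) ⟨?_, hu0⟩)
    rw [Module.End.mem_eigenspace_iff]
    nth_rewrite 2 [hu]
    rw [smul_smul, inv_mul_cancel₀ hρ0, one_smul]
  obtain ⟨v, hv, hne⟩ := exists_eigenfunction hmem
  have h1 := hf.norm_eigenvalue_lt_one hQ hV hv hne
  rw [norm_inv] at h1
  exact absurd h1 (not_lt.2 ((one_le_inv₀ (norm_pos_iff.2 hρ0)).2 hρ))

/-- Positivity of the characteristic determinant at `1`, if it is real along `[0, 1]`. -/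
theorem det_re_pos (hf : IsClassF f U V) (hQ : IsInvariantSet f U c Q)
    (hV : closedBall (0 : ℂ) (Metric.diam U) ⊆ V)
    (him : ∀ s : ℝ, (LinearMap.det (1 - (s : ℂ) • finiteTransfer f c Q)).im = 0) :
    0 < (LinearMap.det (1 - finiteTransfer f c Q)).re := by
  classical
  set A := finiteTransfer f c Q
  have hcont : Continuous fun s : ℝ => (LinearMap.det (1 - (s : ℂ) • A)).re := by
    have h1 : ∀ s : ℝ, LinearMap.det (1 - (s : ℂ) • A) =
        Matrix.det (1 - (s : ℂ) • LinearMap.toMatrix' A) := by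
      intro s
      rw [← LinearMap.det_toMatrix', map_sub, map_smul, LinearMap.toMatrix'_one]
    simp only [h1]
    refine Complex.continuous_re.comp (Continuous.matrix_det ?_)
    fun_prop
  by_contra! hle
  have h0 : (LinearMap.det (1 - ((0 : ℝ) : ℂ) • A)).re = 1 := by simp
  have h1 : (LinearMap.det (1 - ((1 : ℝ) : ℂ) • A)).re ≤ 0 := by simpa using hle
  -- The determinant is `1` at `s = 0`; a nonpositive real part at `s = 1` would produce a zero of
  -- it in `[0, 1]`, since its imaginary part vanishes.
  obtain ⟨s, hs, hs0⟩ := intermediate_value_Icc' (zero_le_one' ℝ) hcont.continuousOn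
    (show (0 : ℝ) ∈ Icc _ _ from ⟨h1, by rw [h0]; exact zero_le_one⟩)
  refine hf.det_one_sub_smul_ne_zero hQ hV (ρ := (s : ℂ)) ?_ (Complex.ext hs0 (him s))
  rw [Complex.norm_real, Real.norm_of_nonneg hs.1]
  exact hs.2

/-! ### Translation to the additive deformation of the marked map -/

theorem mem_range_marked_iff (h0 : g.c₀ 0 = 0) {x : ℂ} : x ∈ Set.range g.c₀ ↔ x = 0 := by
  constructor
  · rintro ⟨j, rfl⟩
    rw [Subsingleton.elim j 0, h0]
  · rintro rfl
    exact ⟨0, h0⟩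

theorem isInvariantSet_gP (hU : g.U = U) (h0 : g.c₀ 0 = 0)
    (hg : ∀ z ∈ U, g.toFun z = f z + g.toFun 0) : IsInvariantSet f U (g.toFun 0) g.gP := by
  have hsub : ∀ x ∈ g.gP, x ∈ g.P := fun x hx => by
    obtain ⟨y, hy, rfl⟩ := Finset.mem_image.1 hx
    exact g.mapsTo_P y hy
  have hmem : ∀ x ∈ g.gP, x ≠ 0 → x ∈ U := fun x hx hx0 =>
    hU ▸ g.mem_U x (hsub x hx) fun h => hx0 ((mem_range_marked_iff h0).1 h)
  refine ⟨Finset.mem_image_of_mem _ (h0 ▸ g.c₀_mem 0), hmem, fun x hx hx0 => ?_⟩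
  rw [← hg x (hmem x hx hx0)]
  exact Finset.mem_image_of_mem _ (hsub x hx)

theorem additive_isLift_iff (hU : g.U = U) (h0 : g.c₀ 0 = 0)
    (hg : ∀ z ∈ U, g.toFun z = f z + g.toFun 0) {h h' : ℂ → ℂ → ℂ} {Λ : Set ℂ} :
    g.additive.IsLift h h' Λ ↔ IsMotionLift f U (g.toFun 0) g.gP h h' Λ := by
  have hQ := isInvariantSet_gP hU h0 hg
  refine forall₂_congr fun t _ => ?_
  have hc : g.c₁ 0 = g.toFun 0 := by simp [MarkedMap.c₁, h0]
  have hG : ∀ x ∈ g.gP, x ≠ 0 → (h' t x ∈ g.U ∧ g.additive.G (fun j => h t (g.c₁ j)) (h' t x) =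
      h t (g.toFun x) ↔ h' t x ∈ U ∧ f (h' t x) = h t (f x + g.toFun 0) - h t (g.toFun 0)) := by
    intro x hx hx0
    rw [hU]
    refine and_congr_right fun hmem => ?_
    simp only [MarkedMap.additive, h0, hc]
    rw [hg _ hmem, hg x (hQ.mem_source x hx hx0)]
    constructor <;> intro h1 <;> linear_combination h1
  constructor
  · rintro ⟨-, h1, h2⟩
    refine ⟨fun hmem => ?_, fun x hx hx0 => (hG x hx hx0).1
      (h2 x hx fun h => hx0 ((mem_range_marked_iff h0).1 h))⟩
    have := h1 0 (h0 ▸ hmem)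
    simpa [MarkedMap.additive, h0] using this
  · rintro ⟨h1, h2⟩
    refine ⟨trivial, fun j hj => ?_, fun x hx hx0 => ?_⟩
    · rw [Subsingleton.elim j 0, h0] at hj ⊢
      simpa [MarkedMap.additive, h0] using h1 hj
    · have hx0' : x ≠ 0 := fun h => hx0 ((mem_range_marked_iff h0).2 h)
      exact (hG x hx hx0').2 (h2 x hx hx0')

theorem liftingProperty_additive (hf : IsClassF f U V) (hU : g.U = U) (h0 : g.c₀ 0 = 0)
    (hg : ∀ z ∈ U, g.toFun z = f z + g.toFun 0) : g.additive.LiftingProperty := by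
  intro h hh
  obtain ⟨ε, hε, hε1, H, hH0, hHm, hHl, hbd⟩ :=
    hf.exists_twisted_lifts (isInvariantSet_gP hU h0 hg) (ψ := id) differentiable_id (injOn_id _)
      (fun _ _ => rfl) (fun a ha b hb => hf.ball_subset_target (by
        simpa using hf.dist_lt_diam ha hb)) one_pos hh
  refine ⟨ε, hε, hε1, H, hH0, hHm, fun k => ?_, hbd⟩
  obtain ⟨h', -, h2, h3⟩ := hHl k
  rw [h3]
  exact (additive_isLift_iff hU h0 hg).2 h2

theorem isPointedDomain_ball {r : ℝ} (hr : 0 < r) : IsPointedDomain (ball (0 : ℂ) r) :=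
  ⟨isOpen_ball, (convex_ball 0 r).isConnected (nonempty_ball.2 hr), mem_ball_self hr⟩

/-- Uniqueness holds because every vector is the velocity of an affine motion which has a lift near
`0`. -/
theorem isTransferOperator_additive_iff (hf : IsClassF f U V) (hU : g.U = U) (h0 : g.c₀ 0 = 0)
    (hg : ∀ z ∈ U, g.toFun z = f z + g.toFun 0) (B : Module.End ℂ (g.gP → ℂ)) :
    g.additive.IsTransferOperator B ↔ B = finiteTransfer f (g.toFun 0) g.gP := by
  have hQ := isInvariantSet_gP hU h0 hg
  have hT : g.additive.IsTransferOperator (finiteTransfer f (g.toFun 0) g.gP) := by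
    intro Λ Λ₀ h h' _ hΛ₀ hsub hh hh' hl
    rw [hQ.finiteTransfer_restrict (fun y => deriv (fun t => h t y) 0)]
    ext x
    exact (hf.deriv_motionLift hQ (hΛ₀.1.mem_nhds hΛ₀.2.2) (hh.mono subset_rfl hsub) hh'
      ((additive_isLift_iff hU h0 hg).1 hl) x.2).symm
  refine ⟨fun hB => ?_, fun h => h ▸ hT⟩
  refine LinearMap.ext fun u => ?_
  set v : ℂ → ℂ := Function.extend ((↑) : g.gP → ℂ) u 0 with hv
  have hvu : ∀ x : g.gP, v x = u x := fun x => Subtype.val_injective.extend_apply u 0 x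
  obtain ⟨r, hr, hmot⟩ := exists_motion_of_velocity g.gP v
  obtain ⟨ε, hε, hεr, H, hH0, hHm, hHl, -⟩ :=
    hf.exists_twisted_lifts hQ (ψ := id) differentiable_id (injOn_id _)
      (fun _ _ => rfl) (fun a ha b hb => hf.ball_subset_target (by
        simpa using hf.dist_lt_diam ha hb)) hr hmot
  obtain ⟨h', h1, h2, -⟩ := hHl 0
  rw [hH0] at h2
  have hsub : ball (0 : ℂ) ε ⊆ ball 0 r := ball_subset_ball hεr
  have e1 := hB _ _ _ _ (isPointedDomain_ball hr) (isPointedDomain_ball hε) hsub hmot h1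
    ((additive_isLift_iff hU h0 hg).2 h2)
  have e2 := hT _ _ _ _ (isPointedDomain_ball hr) (isPointedDomain_ball hε) hsub hmot h1
    ((additive_isLift_iff hU h0 hg).2 h2)
  have hder : (fun x : g.gP => deriv (fun t : ℂ => (x : ℂ) + t * v x) 0) = u := by
    ext x
    have h3 : HasDerivAt (fun t : ℂ => (x : ℂ) + t * v x) (1 * v x) 0 :=
      ((hasDerivAt_id (0 : ℂ)).mul_const (v x)).const_add (x : ℂ)
    rw [h3.deriv, one_mul, hvu]
  rw [hder] at e1 e2
  rw [e1, e2]

end IsClassF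

/-! ### Orbit sums, their reality, and the two determinant formulas -/

/-- The chain rule along an orbit. -/
theorem hasDerivAt_iterate {F : ℂ → ℂ} {x : ℂ} {n : ℕ}
    (h : ∀ j < n, DifferentiableAt ℂ F (F^[j] x)) :
    HasDerivAt F^[n] (∏ j ∈ Finset.range n, deriv F (F^[j] x)) x := by
  induction n with
  | zero => simpa using hasDerivAt_id x
  | succ n ih =>
    rw [Finset.prod_range_succ, mul_comm, Function.iterate_succ']
    exact (h n (by omega)).hasDerivAt.comp x (ih fun j hj => h j (by omega))

namespace MarkedMap

variable {f : ℂ → ℂ} {U : Set ℂ} {g : MarkedMap 1}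

theorem orbit_succ (g : MarkedMap 1) (i : ℕ) : g.orbit (i + 1) = g.toFun (g.orbit i) :=
  Function.iterate_succ_apply' _ _ _

theorem orbit_zero (g : MarkedMap 1) : g.orbit 0 = g.c₀ 0 := rfl

theorem iterate_orbit (g : MarkedMap 1) (i j : ℕ) : g.toFun^[j] (g.orbit i) = g.orbit (i + j) := by
  rw [orbit, orbit, ← Function.iterate_add_apply, add_comm]

theorem deriv_toFun (hopen : IsOpen U) (hg : ∀ z ∈ U, g.toFun z = f z + g.toFun 0) {x : ℂ}
    (hx : x ∈ U) : deriv g.toFun x = deriv f x := by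
  have h1 : g.toFun =ᶠ[𝓝 x] fun z => f z + g.toFun 0 := by
    filter_upwards [hopen.mem_nhds hx] with z hz using hg z hz
  rw [h1.deriv_eq, deriv_add_const]

theorem deriv_iterate_orbit {a n : ℕ} (h : ∀ j < n, g.orbit (a + j) ∈ g.U) :
    deriv g.toFun^[n] (g.orbit a) = ∏ j ∈ Finset.range n, deriv g.toFun (g.orbit (a + j)) := by
  have := hasDerivAt_iterate (F := g.toFun) (x := g.orbit a) (n := n) fun j hj => by
    rw [iterate_orbit]
    exact g.holomorphic.differentiableAt (g.isOpen_U.mem_nhds (h j hj))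
  rw [this.deriv]
  simp only [iterate_orbit]

theorem pow_div_deriv_iterate_orbit {a n : ℕ} (h : ∀ j < n, g.orbit (a + j) ∈ g.U) (ρ : ℂ) :
    ρ ^ n / deriv g.toFun^[n] (g.orbit a) =
      ∏ j ∈ Finset.range n, ρ / deriv g.toFun (g.orbit (a + j)) := by
  rw [deriv_iterate_orbit h, Finset.prod_div_distrib, Finset.prod_const, Finset.card_range]

/-- Near a real point the map equals its conjugate by complex conjugation, so its derivative there
is real. -/
theorem conj_deriv_eq (hr : g.IsReal) {x : ℂ} (hx : x ∈ g.U) (him : x.im = 0) :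
    (starRingEnd ℂ) (deriv g.toFun x) = deriv g.toFun x := by
  have hxc : (starRingEnd ℂ) x = x := Complex.conj_eq_iff_im.2 him
  have h1 : HasDerivAt g.toFun (deriv g.toFun x) x :=
    (g.holomorphic.differentiableAt (g.isOpen_U.mem_nhds hx)).hasDerivAt
  have h2 := h1.conj_conj
  rw [hxc] at h2
  have h3 : g.toFun =ᶠ[𝓝 x] (starRingEnd ℂ) ∘ g.toFun ∘ (starRingEnd ℂ) := by
    filter_upwards [g.isOpen_U.mem_nhds hx] with z hz
    simp [(hr.2 z hz).2]
  exact (h2.congr_of_eventuallyEq h3).unique h1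

end MarkedMap

namespace MarkedMap

variable {f : ℂ → ℂ} {U : Set ℂ} {g : MarkedMap 1}

/-- The factors of the sums over the marked orbit, with the convention that the marked point
contributes `0`. -/
noncomputable def orbitRatio (f : ℂ → ℂ) (g : MarkedMap 1) (ρ : ℂ) (j : ℕ) : ℂ :=
  if g.orbit (j + 1) = 0 then 0 else ρ / deriv f (g.orbit (j + 1))

theorem orbit_mem_P (g : MarkedMap 1) (i : ℕ) : g.orbit i ∈ g.P := by
  induction i with
  | zero => exact g.c₀_mem 0
  | succ i ih => rw [orbit_succ]; exact g.mapsTo_P _ ih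

theorem orbit_mem_U (hU : g.U = U) (h0 : g.c₀ 0 = 0) {i : ℕ} (hi : g.orbit i ≠ 0) :
    g.orbit i ∈ U :=
  hU ▸ g.mem_U _ (orbit_mem_P g i) fun h => hi ((IsClassF.mem_range_marked_iff h0).1 h)

theorem orbit_ne_zero (h0 : g.c₀ 0 = 0) {q : ℕ} (hq : g.IsMarkedOrbit q) {i : ℕ} (hi : 0 < i)
    (hiq : i < q) : g.orbit i ≠ 0 := by
  intro h
  rw [← h0, ← orbit_zero] at h
  have := hq.1 hiq (hi.trans hiq) h
  omega

theorem gP_eq_image_orbit {q : ℕ} (hq : g.IsMarkedOrbit q) :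
    g.gP = (Finset.range q).image fun i => g.orbit (i + 1) := by
  rw [gP, hq.2, Finset.image_image]
  exact Finset.image_congr fun i _ => (orbit_succ g i).symm

theorem orbitSum_eq (hopen : IsOpen U) (hU : g.U = U) (h0 : g.c₀ 0 = 0)
    (hg : ∀ z ∈ U, g.toFun z = f z + g.toFun 0) {n : ℕ}
    (hn : ∀ i, 0 < i → i < n → g.orbit i ≠ 0) (ρ : ℂ) :
    g.orbitSum n ρ = ∑ i ∈ Finset.range n, ∏ j ∈ Finset.range i, orbitRatio f g ρ j := by
  refine Finset.sum_congr rfl fun i hi => ?_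
  have hin := Finset.mem_range.1 hi
  have hne : ∀ j < i, g.orbit (1 + j) ≠ 0 := fun j hj => hn _ (by omega) (by omega)
  rw [pow_div_deriv_iterate_orbit fun j hj => hU.symm ▸ orbit_mem_U hU h0 (hne j hj)]
  refine Finset.prod_congr rfl fun j hj => ?_
  have hj' := hne j (Finset.mem_range.1 hj)
  rw [deriv_toFun hopen hg (orbit_mem_U hU h0 hj'), add_comm 1 j, orbitRatio]
  rw [add_comm 1 j] at hj'
  rw [if_neg hj']

theorem conj_orbitRatio (hopen : IsOpen U) (hU : g.U = U) (h0 : g.c₀ 0 = 0)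
    (hg : ∀ z ∈ U, g.toFun z = f z + g.toFun 0) (hr : g.IsReal) (s : ℝ) (j : ℕ) :
    (starRingEnd ℂ) (orbitRatio f g s j) = orbitRatio f g s j := by
  by_cases h : g.orbit (j + 1) = 0
  · simp [orbitRatio, h]
  · have hmem := orbit_mem_U hU h0 h
    rw [orbitRatio, if_neg h, map_div₀, Complex.conj_ofReal, ← deriv_toFun hopen hg hmem,
      conj_deriv_eq hr (hU.symm ▸ hmem) (hr.1 _ (orbit_mem_P g _))]

end MarkedMap

namespace IsClassF

open MarkedMap

variable {f : ℂ → ℂ} {U V : Set ℂ} {g : MarkedMap 1}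

theorem map_add_eq_orbit (hU : g.U = U) (h0 : g.c₀ 0 = 0)
    (hg : ∀ z ∈ U, g.toFun z = f z + g.toFun 0) {i : ℕ} (hi : g.orbit i ≠ 0) :
    f (g.orbit i) + g.toFun 0 = g.orbit (i + 1) := by
  rw [orbit_succ, hg _ (orbit_mem_U hU h0 hi)]

theorem orbit_one (h0 : g.c₀ 0 = 0) : g.orbit (0 + 1) = g.toFun 0 := by
  rw [orbit_succ, orbit_zero, h0]

/-- Enumerate `g(P)` as `c_1, …, c_q` with `c_q = 0` last. The last ratio is `0`, which kills both
the correction term and the final summand of the general formula. -/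
theorem det_periodic (hf : IsClassF f U V) (hU : g.U = U) (h0 : g.c₀ 0 = 0)
    (hg : ∀ z ∈ U, g.toFun z = f z + g.toFun 0) {q : ℕ} (hq1 : 1 ≤ q) (hq : g.IsMarkedOrbit q)
    (hper : g.orbit q = g.orbit 0) (ρ : ℂ) :
    LinearMap.det (1 - ρ • finiteTransfer f (g.toFun 0) g.gP) = g.orbitSum q ρ := by
  have hQ := isInvariantSet_gP hU h0 hg
  obtain ⟨m, rfl⟩ := Nat.exists_eq_add_of_le' hq1
  have hne : ∀ i, 0 < i → i < m + 1 → g.orbit i ≠ 0 := fun i hi hiq => orbit_ne_zero h0 hq hi hiq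
  have hzero : g.orbit (m + 1) = 0 := by rw [hper, orbit_zero, h0]
  have hinj : InjOn (fun i => g.orbit (i + 1)) (Iio (m + 1)) := by
    intro i hi j hj hij
    rw [mem_Iio] at hi hj
    simp only at hij
    rcases (show i < m ∨ i = m by omega) with hi' | rfl
    · rcases (show j < m ∨ j = m by omega) with hj' | rfl
      · have := hq.1 (show i + 1 < m + 1 by omega) (show j + 1 < m + 1 by omega) hij
        omega
      · exact (hne (i + 1) (by omega) (by omega) (hij.trans hzero)).elim
    · rcases (show j < i ∨ j = i by omega) with hj' | rfl
      · exact (hne (j + 1) (by omega) (by omega) (hij.symm.trans hzero)).elim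
      · rfl
  rw [det_one_sub_finiteTransfer hQ (Nat.zero_le m) (gP_eq_image_orbit hq) hinj (orbit_one h0)
    (fun i hi => ⟨hne _ (by omega) (by omega), map_add_eq_orbit hU h0 hg
      (hne _ (by omega) (by omega))⟩) (fun h => (h hzero).elim) (ρ := ρ) (t := orbitRatio f g ρ)
    (fun j _ => rfl), orbitSum_eq hf.isOpen_source hU h0 hg hne]
  have hm : orbitRatio f g ρ m = 0 := if_pos hzero
  have hprod : ∏ j ∈ Finset.range (m + 1), orbitRatio f g ρ j = 0 :=
    Finset.prod_eq_zero (Finset.self_mem_range_succ m) hm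
  rw [← Finset.range_eq_Ico, Finset.sum_range_succ _ (m + 1), hprod]
  ring

/-- Here `c_q = c_l` repeats, so `g(P)` has the `q - 1` points `c_1, …, c_{q-1}`, and the last one
is followed by `c_l`, whose index in this enumeration is `l - 1`. -/
theorem det_preperiodic (hf : IsClassF f U V) (hU : g.U = U) (h0 : g.c₀ 0 = 0)
    (hg : ∀ z ∈ U, g.toFun z = f z + g.toFun 0) {l q : ℕ} (hl : 1 ≤ l) (hlq : l < q)
    (hq : g.IsMarkedOrbit q) (hper : g.orbit q = g.orbit l) (ρ : ℂ) :
    LinearMap.det (1 - ρ • finiteTransfer f (g.toFun 0) g.gP) = g.orbitSum q ρ -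
      ρ ^ (q - l) / deriv (g.toFun^[q - l]) (g.orbit l) * g.orbitSum l ρ := by
  have hQ := isInvariantSet_gP hU h0 hg
  obtain ⟨k, rfl⟩ := Nat.exists_eq_add_of_le' hl
  obtain ⟨m, rfl⟩ := Nat.exists_eq_add_of_le' (show 2 ≤ q by omega)
  have hkm : k ≤ m := by omega
  have hne : ∀ i, 0 < i → i < m + 2 → g.orbit i ≠ 0 := fun i hi hiq => orbit_ne_zero h0 hq hi hiq
  have hinj : InjOn (fun i => g.orbit (i + 1)) (Iio (m + 1)) := by
    intro i hi j hj hij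
    rw [mem_Iio] at hi hj
    have := hq.1 (show i + 1 < m + 2 by omega) (show j + 1 < m + 2 by omega) hij
    omega
  have himage : g.gP = (Finset.range (m + 1)).image fun i => g.orbit (i + 1) := by
    rw [gP_eq_image_orbit hq, Finset.range_add_one, Finset.image_insert, Finset.insert_eq_self]
    exact Finset.mem_image.2 ⟨k, Finset.mem_range.2 (by omega), hper.symm⟩
  rw [det_one_sub_finiteTransfer hQ hkm himage hinj (orbit_one h0)
    (fun i hi => ⟨hne _ (by omega) (by omega), map_add_eq_orbit hU h0 hg
      (hne _ (by omega) (by omega))⟩) (fun h => (map_add_eq_orbit hU h0 hg h).trans hper)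
    (ρ := ρ) (t := orbitRatio f g ρ)
    (fun j _ => rfl), orbitSum_eq hf.isOpen_source hU h0 hg hne,
    orbitSum_eq hf.isOpen_source hU h0 hg (fun i h1 h2 => hne i h1 (by omega))]
  congr 2
  have hne' : ∀ j < m + 2 - (k + 1), g.orbit (k + 1 + j) ≠ 0 := fun j hj =>
    hne _ (by omega) (by omega)
  rw [pow_div_deriv_iterate_orbit fun j hj => hU.symm ▸ orbit_mem_U hU h0 (hne' j hj),
    Finset.prod_Ico_eq_prod_range, show m + 2 - (k + 1) = m + 1 - k by omega]
  refine Finset.prod_congr rfl fun j hj => ?_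
  have hj' := hne' j (by have := Finset.mem_range.1 hj; omega)
  rw [deriv_toFun hf.isOpen_source hg (orbit_mem_U hU h0 hj'), orbitRatio]
  rw [show k + 1 + j = k + j + 1 by omega] at hj' ⊢
  rw [if_neg hj']

theorem im_eq_zero_of_conj {z : ℂ} (h : (starRingEnd ℂ) z = z) : z.im = 0 :=
  Complex.conj_eq_iff_im.1 h

theorem conj_orbitSum (hf : IsClassF f U V) (hU : g.U = U) (h0 : g.c₀ 0 = 0)
    (hg : ∀ z ∈ U, g.toFun z = f z + g.toFun 0) (hr : g.IsReal) {n : ℕ}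
    (hn : ∀ i, 0 < i → i < n → g.orbit i ≠ 0) (s : ℝ) :
    (starRingEnd ℂ) (g.orbitSum n s) = g.orbitSum n s := by
  rw [orbitSum_eq hf.isOpen_source hU h0 hg hn, map_sum]
  refine Finset.sum_congr rfl fun i _ => ?_
  rw [map_prod]
  exact Finset.prod_congr rfl fun j _ => conj_orbitRatio hf.isOpen_source hU h0 hg hr s j

theorem conj_pow_div_deriv_iterate (hU : g.U = U) (h0 : g.c₀ 0 = 0) (hr : g.IsReal) {a n : ℕ}
    (h : ∀ j < n, g.orbit (a + j) ≠ 0) (s : ℝ) :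
    (starRingEnd ℂ) ((s : ℂ) ^ n / deriv g.toFun^[n] (g.orbit a)) =
      (s : ℂ) ^ n / deriv g.toFun^[n] (g.orbit a) := by
  have hmem : ∀ j < n, g.orbit (a + j) ∈ g.U := fun j hj => hU.symm ▸ orbit_mem_U hU h0 (h j hj)
  rw [pow_div_deriv_iterate_orbit hmem, map_prod]
  refine Finset.prod_congr rfl fun j hj => ?_
  rw [map_div₀, Complex.conj_ofReal, conj_deriv_eq hr (hmem j (Finset.mem_range.1 hj))
    (hr.1 _ (orbit_mem_P g _))]

end IsClassF

end

/-! ### Assembly -/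

theorem mainTheorem5 (f : ℂ → ℂ) (U V : Set ℂ) (hf : IsClassF f U V)
    (g : MarkedMap 1) (hU : g.U = U) (h0 : g.c₀ 0 = 0)
    (hg : ∀ z ∈ U, g.toFun z = f z + g.toFun 0) :
    g.additive.LiftingProperty ∧
    ∃ A : Module.End ℂ (g.gP → ℂ),
      -- `A` is the transfer operator of the deformation
      (∀ B : Module.End ℂ (g.gP → ℂ), g.additive.IsTransferOperator B ↔ B = A) ∧
      spectrum ℂ A ⊆ Metric.closedBall (0 : ℂ) 1 \ {1} ∧
      -- robust separation
      (Metric.closedBall (0 : ℂ) (Metric.diam U) ⊆ V →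
        spectralRadius ℂ A < 1 ∧
        (∀ ρ : ℂ, ‖ρ‖ ≤ 1 → LinearMap.det (1 - ρ • A) ≠ 0) ∧
        -- the marked point is periodic of period `q`
        (∀ q : ℕ, 1 ≤ q → g.IsMarkedOrbit q → g.orbit q = g.orbit 0 →
          (∀ ρ : ℂ, ‖ρ‖ ≤ 1 →
            LinearMap.det (1 - ρ • A) = g.orbitSum q ρ ∧ g.orbitSum q ρ ≠ 0) ∧
          (g.IsReal → g.additive.IsReal →
            (g.orbitSum q 1).im = 0 ∧ 0 < (g.orbitSum q 1).re)) ∧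
        -- the marked point is strictly preperiodic, with `c_q = c_l`
        (∀ l q : ℕ, 1 ≤ l → l < q → g.IsMarkedOrbit q → g.orbit q = g.orbit l →
          (∀ ρ : ℂ, ‖ρ‖ ≤ 1 →
            LinearMap.det (1 - ρ • A) = g.orbitSum q ρ -
              ρ ^ (q - l) / deriv (g.toFun^[q - l]) (g.orbit l) * g.orbitSum l ρ) ∧
          (g.IsReal → g.additive.IsReal →
            (g.orbitSum q 1 -
              1 / deriv (g.toFun^[q - l]) (g.orbit l) * g.orbitSum l 1).im = 0 ∧
            0 < (g.orbitSum q 1 -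
              1 / deriv (g.toFun^[q - l]) (g.orbit l) * g.orbitSum l 1).re))) := by
  have hQ := IsClassF.isInvariantSet_gP hU h0 hg
  refine ⟨hf.liftingProperty_additive hU h0 hg, finiteTransfer f (g.toFun 0) g.gP,
    hf.isTransferOperator_additive_iff hU h0 hg, hf.spectrum_finiteTransfer hQ, fun hV =>
    ⟨hf.spectralRadius_finiteTransfer hQ hV, fun ρ hρ => hf.det_one_sub_smul_ne_zero hQ hV hρ,
      fun q hq1 hq hper => ?_, fun l q hl hlq hq hper => ?_⟩⟩
  · have hdet := hf.det_periodic hU h0 hg hq1 hq hper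
    refine ⟨fun ρ hρ => ⟨hdet ρ, hdet ρ ▸ hf.det_one_sub_smul_ne_zero hQ hV hρ⟩, fun hr _ => ?_⟩
    have him : ∀ s : ℝ, (g.orbitSum q s).im = 0 := fun s => IsClassF.im_eq_zero_of_conj
      (hf.conj_orbitSum hU h0 hg hr (fun i h1 h2 => MarkedMap.orbit_ne_zero h0 hq h1 h2) s)
    have hpos := hf.det_re_pos hQ hV fun s => by rw [hdet]; exact him s
    have h1 := hdet 1
    rw [one_smul] at h1
    rw [h1] at hpos
    exact ⟨by simpa using him 1, hpos⟩
  · have hdet := hf.det_preperiodic hU h0 hg hl hlq hq hper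
    refine ⟨fun ρ _ => hdet ρ, fun hr _ => ?_⟩
    have hne : ∀ i, 0 < i → i < q → g.orbit i ≠ 0 := fun i h1 h2 =>
      MarkedMap.orbit_ne_zero h0 hq h1 h2
    -- Reality is needed for every real `s`, not only for `s = 1`, to run the intermediate value
    -- argument.
    have him : ∀ s : ℝ, (g.orbitSum q s -
        (s : ℂ) ^ (q - l) / deriv (g.toFun^[q - l]) (g.orbit l) * g.orbitSum l s).im = 0 := by
      intro s
      refine IsClassF.im_eq_zero_of_conj ?_
      rw [map_sub, map_mul, hf.conj_orbitSum hU h0 hg hr hne s,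
        hf.conj_orbitSum hU h0 hg hr (fun i h1 h2 => hne i h1 (by omega)) s,
        IsClassF.conj_pow_div_deriv_iterate hU h0 hr (fun j hj => hne _ (by omega) (by omega)) s]
    have hpos := hf.det_re_pos hQ hV fun s => by rw [hdet]; exact him s
    have h1 := hdet 1
    rw [one_smul, one_pow] at h1
    rw [h1] at hpos
    exact ⟨by simpa using him 1, hpos⟩
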